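/- Fix an alphabet $\Sigma$ (finite or infinite). A \emph{labelled iposet} is a finite set $P$ with two strict partial orders, the precedence order $<$ and the event order $\dashrightarrow$, such that any two distinct points are comparable in at least one of them, a labelling $\lambda:P\to\Sigma$, and subsets $S_P,T_P\subseteq P$ (source and target interface) of $<$-minimal and $<$-maximal points, respectively. A \emph{subsumption} $P\to Q$ is a bijection $f$ that preserves labels, satisfies $f(S_P)=S_Q$ and $f(T_P)=T_Q$, reflects precedence ($f(x)<_Q f(y)$ implies $x<_P y$), and preserves the event order of $<_P$-incomparable points; we then write $P\sqsubseteq Q$. An \emph{isomorphism} is a subsumption that is an isomorphism for $<$, and an \emph{ipomset} is an isomorphism class of labelled iposets. It is an \emph{interval} ipomset if there are $b,e:P\to\mathbb R$ with $b\le e$ and $x<y\iff e(x)<b(y)$. A finite word $U$ over $\Sigma$ with sets $S,T$ of positions is regarded as the ipomset $(S,U,T)$ of its positions with empty $<$ and the natural order as $\dashrightarrow$; $\epsilon$ is the empty ipomset, and $[a],[\bullet a],[a\bullet],[\bullet a\bullet]$ are the one-point ipomsets labelled $a$ with the point in neither interface, in $S$ only, in $T$ only, or in both. $P\parallel Q$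 is the disjoint union, with $x\dashrightarrow y$ added for all $x\in P$, $y\in Q$. $P*Q$ is defined if $T_P\cong S_Q$ as labelled sets totally ordered by $\dashrightarrow$; it is $P\sqcup Q$ with $T_P$ and $S_Q$ identified along the unique isomorphism, $S_{P*Q}=S_P$, $T_{P*Q}=T_Q$, event order the transitive closure of ${\dashrightarrow_P}\cup{\dashrightarrow_Q}$, and $x<y$ iff $x<_Py$, or $x<_Qy$, or $x\in P\setminus T_P$ and $y\in Q\setminus S_Q$. For a set $A$ of ipomsets, $A{\downarrow}$ is the set of interval ipomsets $P$ with $P\sqsubseteq Q$ for some $Q\in A$. A \emph{language} is a set $L$ of interval ipomsets with $L{\downarrow}\subseteq L$. For languages put $L*M=\{P*Q\mid P\in L,\,Q\in M,\,T_P\cong S_Q\}{\downarrow}$, $L\parallel M=\{P\parallel Q\mid P\in L,\,Q\in M\}{\downarrow}$, $L^1=L$, $L^{n+1}=L*L^n$ and $L^+=\bigcup_{n\ge1}L^n$. The \emph{rational} languages form the smallest class that contains $\emptyset$, $\{\epsilon\}$, $\{[a]\}$, $\{[\bullet a]\}$, $\{[a\bullet]\}$, $\{[\bullet a\bullet]\}$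 for all $a\in\Sigma$ and is closed under $\cup$, $*$, $\parallel$ and $^+$. Let $\square$ be the category whose objects are finite words over $\Sigma$ and whose morphisms $d_{A,B}:U\to V$ are triples $(\partial,A,B)$ of an order and label preserving injection $\partial$ of the positions of $U$ into those of $V$ and disjoint sets $A,B$ with $A\cup B=V\setminus\partial(U)$; the composite of $(\partial,A,B):U\to V$ and $(\partial',C,D):V\to W$ is $(\partial'\partial,\partial'(A)\cup C,\partial'(B)\cup D)$. A \emph{higher-dimensional automaton} (HDA) is a presheaf $X$ on $\square$ with finitely many elements (cells) in total, with sets of start cells and accept cells. For $x\in X[V]$ write $\delta^0_A(x)=X[d_{A,\emptyset}](x)$ and $\delta^1_B(x)=X[d_{\emptyset,B}](x)$. A path in $X$ is a finite sequence of cells joined by up-steps from $\delta^0_A(x)$ to $x$ and down-steps from $x$ to $\delta^1_B(x)$. For $x\in X[V]$, the ipomset of such an up-step is $(V\setminus A,V,V)$, that of the down-step is $(V,V,V\setminus B)$, that of the path of length $0$ at $x$ is $(V,V,V)$, and that of a longer path is the gluing composition $*$ of the ipomsets of its steps. $X$ \emph{recognises} the set of the ipomsets of all paths from a start cell to an accept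 cell. A language is \emph{regular} if it is recognised by some HDA. \textbf{Theorem (Kleene theorem).} A language is regular if and only if it is rational. -/

import Mathlib

namespace HDAKleene

open CategoryTheory

universe u

/-! ### Labelled posets with interfaces and ipomsets -/

/-- A labelled iposet over the alphabet `α`: a finite set with a precedence order `prec`, an event
order `evord`, a labelling, and source and target interfaces.  Any two distinct points are
comparable in at least one of the two orders. -/
structure Iposet (α : Type u) where
  carrier : Type
  finite : Finite carrier
  prec : carrier → carrier → Prop
  evord : carrier → carrier → Prop
  src : Set carrier
  tgt : Set carrier
  label : carrier → α
  prec_irrefl : ∀ x, ¬ prec x x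
  prec_trans : ∀ x y z, prec x y → prec y z → prec x z
  evord_irrefl : ∀ x, ¬ evord x x
  evord_trans : ∀ x y z, evord x y → evord y z → evord x z
  comparable : ∀ x y, x = y ∨ prec x y ∨ prec y x ∨ evord x y ∨ evord y x
  src_minimal : ∀ x ∈ src, ∀ y, ¬ prec y x
  tgt_maximal : ∀ x ∈ tgt, ∀ y, ¬ prec x y

namespace Iposet

variable {α : Type u}

/-- A subsumption `P → Q`: a bijection respecting interfaces and labels, reflecting precedence and
preserving the event order of precedence-incomparable points. -/
structure IsSubsumption (P Q : Iposet α) (f : P.carrier ≃ Q.carrier) : Prop where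
  src_iff : ∀ x, x ∈ P.src ↔ f x ∈ Q.src
  tgt_iff : ∀ x, x ∈ P.tgt ↔ f x ∈ Q.tgt
  label_eq : ∀ x, Q.label (f x) = P.label x
  prec_of : ∀ x y, Q.prec (f x) (f y) → P.prec x y
  evord_of : ∀ x y, P.evord x y → ¬ P.prec x y → ¬ P.prec y x → Q.evord (f x) (f y)

/-- `P.Subsu Q` (in symbols `P ⊑ Q`): there is a subsumption `P → Q`. -/
def Subsu (P Q : Iposet α) : Prop :=
  ∃ f : P.carrier ≃ Q.carrier, IsSubsumption P Q f

/-- An isomorphism of labelled iposets is a subsumption that is an isomorphism of the precedence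
orders.  It then also preserves and reflects the event order of precedence-incomparable points; the
event order between precedence-comparable points carries no information. -/
def Iso (P Q : Iposet α) : Prop :=
  ∃ f : P.carrier ≃ Q.carrier, IsSubsumption P Q f ∧ ∀ x y, P.prec x y ↔ Q.prec (f x) (f y)

theorem Iso.subsu {P Q : Iposet α} (h : Iso P Q) : Subsu P Q :=
  let ⟨f, hf, _⟩ := h
  ⟨f, hf⟩

theorem Subsu.trans {P Q R : Iposet α} (h : Subsu P Q) (k : Subsu Q R) : Subsu P R := by
  obtain ⟨f, hf⟩ := h
  obtain ⟨g, hg⟩ := k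
  refine ⟨f.trans g, ⟨fun x => ?_, fun x => ?_, fun x => ?_, fun x y h => ?_, fun x y h h1 h2 => ?_⟩⟩
  · exact (hf.src_iff x).trans (hg.src_iff _)
  · exact (hf.tgt_iff x).trans (hg.tgt_iff _)
  · exact (hg.label_eq _).trans (hf.label_eq x)
  · exact hf.prec_of _ _ (hg.prec_of _ _ h)
  · exact hg.evord_of _ _ (hf.evord_of x y h h1 h2) (fun h => h1 (hf.prec_of _ _ h))
      (fun h => h2 (hf.prec_of _ _ h))

theorem Iso.refl (P : Iposet α) : Iso P P :=
  ⟨Equiv.refl _, ⟨fun _ => Iff.rfl, fun _ => Iff.rfl, fun _ => rfl, fun _ _ h => h,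
    fun _ _ h _ _ => h⟩, fun _ _ => Iff.rfl⟩

theorem Iso.trans {P Q R : Iposet α} (h : Iso P Q) (k : Iso Q R) : Iso P R := by
  obtain ⟨f, hf, hf'⟩ := h
  obtain ⟨g, hg, hg'⟩ := k
  refine ⟨f.trans g, ⟨fun x => ?_, fun x => ?_, fun x => ?_, fun x y h => ?_, fun x y h h1 h2 => ?_⟩,
    fun x y => (hf' x y).trans (hg' _ _)⟩
  · exact (hf.src_iff x).trans (hg.src_iff _)
  · exact (hf.tgt_iff x).trans (hg.tgt_iff _)
  · exact (hg.label_eq _).trans (hf.label_eq x)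
  · exact hf.prec_of _ _ (hg.prec_of _ _ h)
  · exact hg.evord_of _ _ (hf.evord_of x y h h1 h2) (fun h => h1 (hf.prec_of _ _ h))
      (fun h => h2 (hf.prec_of _ _ h))

theorem Iso.symm {P Q : Iposet α} (h : Iso P Q) : Iso Q P := by
  obtain ⟨f, hf, hf'⟩ := h
  refine ⟨f.symm, ⟨fun x => ?_, fun x => ?_, fun x => ?_, fun x y h => ?_, fun x y h h1 h2 => ?_⟩,
    fun x y => ?_⟩
  · simpa using (hf.src_iff (f.symm x)).symm
  · simpa using (hf.tgt_iff (f.symm x)).symm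
  · simpa using (hf.label_eq (f.symm x)).symm
  · simpa using (hf' _ _).1 h
  · have k1 : ¬ P.prec (f.symm x) (f.symm y) := by simpa [hf'] using h1
    have k2 : ¬ P.prec (f.symm y) (f.symm x) := by simpa [hf'] using h2
    rcases P.comparable (f.symm x) (f.symm y) with e | e | e | e | e
    · obtain rfl := f.symm.injective e
      exact absurd h (Q.evord_irrefl _)
    · exact absurd e k1
    · exact absurd e k2
    · exact e
    · have := hf.evord_of _ _ e k2 k1
      simp only [Equiv.apply_symm_apply] at this
      exact absurd (Q.evord_trans _ _ _ h this) (Q.evord_irrefl _)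
  · simpa using (hf' (f.symm x) (f.symm y)).symm

/-- Isomorphism of labelled iposets as a setoid. -/
instance setoid (α : Type u) : Setoid (Iposet α) :=
  ⟨Iso, ⟨Iso.refl, Iso.symm, Iso.trans⟩⟩

/-- Existence of an interval representation of the precedence order. -/
def IsInterval (P : Iposet α) : Prop :=
  ∃ b e : P.carrier → ℝ, (∀ x, b x ≤ e x) ∧ ∀ x y, P.prec x y ↔ e x < b y

/-- Parallel composition. -/
def par (P Q : Iposet α) : Iposet α where
  carrier := P.carrier ⊕ Q.carrier
  finite := by
    have := P.finite
    have := Q.finite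
    infer_instance
  prec := Sum.LiftRel P.prec Q.prec
  evord := Sum.Lex P.evord Q.evord
  src := Sum.elim P.src Q.src
  tgt := Sum.elim P.tgt Q.tgt
  label := Sum.elim P.label Q.label
  prec_irrefl := by
    rintro (x | x) h
    · exact P.prec_irrefl x (Sum.liftRel_inl_inl.1 h)
    · exact Q.prec_irrefl x (Sum.liftRel_inr_inr.1 h)
  prec_trans := by
    rintro _ _ _ (⟨h⟩ | ⟨h⟩) (⟨k⟩ | ⟨k⟩)
    · exact .inl (P.prec_trans _ _ _ h k)
    · exact .inr (Q.prec_trans _ _ _ h k)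
  evord_irrefl := by
    rintro (x | x) h
    · exact P.evord_irrefl x (Sum.lex_inl_inl.1 h)
    · exact Q.evord_irrefl x (Sum.lex_inr_inr.1 h)
  evord_trans := by
    rintro (x | x) (y | y) (z | z) h k <;>
      simp only [Sum.lex_inl_inl, Sum.lex_inr_inr, Sum.lex_inr_inl, Sum.Lex.sep] at *
    · exact P.evord_trans _ _ _ h k
    · exact Q.evord_trans _ _ _ h k
  comparable := by
    rintro (x | x) (y | y)
    · simpa using P.comparable x y
    · simp
    · simp
    · simpa using Q.comparable x y
  src_minimal := by
    rintro _ hx _ (⟨h⟩ | ⟨h⟩)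
    · exact P.src_minimal _ hx _ h
    · exact Q.src_minimal _ hx _ h
  tgt_maximal := by
    rintro _ hx _ (⟨h⟩ | ⟨h⟩)
    · exact P.tgt_maximal _ hx _ h
    · exact Q.tgt_maximal _ hx _ h

/-- An isomorphism of lo-sets from the target interface of `P` to the source interface of `Q`
(both are totally ordered by the event order). -/
structure Match (P Q : Iposet α) where
  equiv : P.tgt ≃ Q.src
  evord_iff : ∀ x y : P.tgt, P.evord x y ↔ Q.evord (equiv x) (equiv y)
  label_eq : ∀ x : P.tgt, Q.label (equiv x) = P.label x

namespace Match

variable {P Q : Iposet α} (f : Match P Q)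

/-- The carrier of the gluing: the disjoint union of `P` and `Q` with `x` and `f x` identified for
all `x` in the target interface of `P`, written with the points of `P` as representatives of the
identified points. -/
abbrev Carrier (_ : Match P Q) : Type := P.carrier ⊕ {q : Q.carrier // q ∉ Q.src}

/-- The structural inclusion of `P` into the gluing. -/
def inP (p : P.carrier) : f.Carrier := Sum.inl p

open Classical in
/-- The structural inclusion of `Q` into the gluing. -/
noncomputable def inQ (q : Q.carrier) : f.Carrier :=
  if h : q ∈ Q.src then Sum.inl (f.equiv.symm ⟨q, h⟩).1 else Sum.inr ⟨q, h⟩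

/-- Precedence order of the gluing. -/
def Prec (x y : f.Carrier) : Prop :=
  Relation.Map P.prec f.inP f.inP x y ∨ Relation.Map Q.prec f.inQ f.inQ x y ∨
    ∃ p ∉ P.tgt, ∃ q ∉ Q.src, f.inP p = x ∧ f.inQ q = y

/-- Event order of the gluing: the transitive closure of the union of both event orders. -/
def Evord : f.Carrier → f.Carrier → Prop :=
  Relation.TransGen fun x y =>
    Relation.Map P.evord f.inP f.inP x y ∨ Relation.Map Q.evord f.inQ f.inQ x y

theorem inP_inj {p p' : P.carrier} (h : f.inP p = f.inP p') : p = p' := Sum.inl_injective h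

theorem inQ_src (x : P.tgt) : f.inQ (f.equiv x) = f.inP x := by
  simp [inQ, inP]

theorem inQ_eq_inP {q : Q.carrier} {p : P.carrier} (h : f.inQ q = f.inP p) :
    ∃ hp : p ∈ P.tgt, q = f.equiv ⟨p, hp⟩ := by
  unfold inQ inP at h
  split_ifs at h with hq
  obtain rfl := Sum.inl_injective h
  exact ⟨(f.equiv.symm ⟨q, hq⟩).2, by simp⟩

theorem inQ_inj {q q' : Q.carrier} (h : f.inQ q = f.inQ q') : q = q' := by
  unfold inQ at h
  split_ifs at h with h1 h2 h2
  · have := f.equiv.symm.injective (Subtype.ext (Sum.inl_injective h))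
    exact congrArg Subtype.val this
  · exact congrArg Subtype.val (Sum.inr_injective h)

theorem exists_rep (x : f.Carrier) : (∃ p, f.inP p = x) ∨ ∃ q ∉ Q.src, f.inQ q = x := by
  rcases x with p | ⟨q, hq⟩
  · exact .inl ⟨p, rfl⟩
  · exact .inr ⟨q, hq, by simp [inQ, hq]⟩

theorem evord_cases {x y : f.Carrier} (h : f.Evord x y) :
    Relation.Map P.evord f.inP f.inP x y ∨ Relation.Map Q.evord f.inQ f.inQ x y ∨
    (∃ (p : P.carrier) (t : P.tgt) (q : Q.carrier), P.evord p t ∧ Q.evord (f.equiv t) q ∧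
      f.inP p = x ∧ f.inQ q = y) ∨
    (∃ (q : Q.carrier) (t : P.tgt) (p : P.carrier), Q.evord q (f.equiv t) ∧ P.evord t p ∧
      f.inQ q = x ∧ f.inP p = y) := by
  induction h with
  | single h => exact h.elim .inl fun h => .inr (.inl h)
  | tail _ k ih =>
    rcases k with ⟨a, b, hab, rfl, rfl⟩ | ⟨a, b, hab, rfl, rfl⟩
    · rcases ih with ⟨c, d, hcd, rfl, e⟩ | ⟨c, d, hcd, rfl, e⟩ | ⟨p, t, q, h1, h2, rfl, e⟩ |
        ⟨q, t, p, h1, h2, rfl, e⟩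
      · obtain rfl := f.inP_inj e
        exact .inl ⟨c, b, P.evord_trans _ _ _ hcd hab, rfl, rfl⟩
      · obtain ⟨ha, rfl⟩ := f.inQ_eq_inP e
        exact .inr (.inr (.inr ⟨c, ⟨a, ha⟩, b, hcd, hab, rfl, rfl⟩))
      · obtain ⟨ha, rfl⟩ := f.inQ_eq_inP e
        have := (f.evord_iff t ⟨a, ha⟩).2 h2
        exact .inl ⟨p, b, P.evord_trans _ _ _ h1 (P.evord_trans _ _ _ this hab), rfl, rfl⟩
      · obtain rfl := f.inP_inj e
        exact .inr (.inr (.inr ⟨q, t, b, h1, P.evord_trans _ _ _ h2 hab, rfl, rfl⟩))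
    · rcases ih with ⟨c, d, hcd, rfl, e⟩ | ⟨c, d, hcd, rfl, e⟩ | ⟨p, t, q, h1, h2, rfl, e⟩ |
        ⟨q, t, p, h1, h2, rfl, e⟩
      · obtain ⟨ha, rfl⟩ := f.inQ_eq_inP e.symm
        exact .inr (.inr (.inl ⟨c, ⟨d, ha⟩, b, hcd, hab, rfl, rfl⟩))
      · obtain rfl := f.inQ_inj e
        exact .inr (.inl ⟨c, b, Q.evord_trans _ _ _ hcd hab, rfl, rfl⟩)
      · obtain rfl := f.inQ_inj e
        exact .inr (.inr (.inl ⟨p, t, b, h1, Q.evord_trans _ _ _ h2 hab, rfl, rfl⟩))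
      · obtain ⟨ha, rfl⟩ := f.inQ_eq_inP e.symm
        have := (f.evord_iff t ⟨p, ha⟩).1 h2
        exact .inr (.inl ⟨q, b, Q.evord_trans _ _ _ h1 (Q.evord_trans _ _ _ this hab), rfl, rfl⟩)

theorem evord_irrefl (x : f.Carrier) : ¬ f.Evord x x := by
  intro h
  rcases f.evord_cases h with ⟨c, d, h', rfl, e⟩ | ⟨c, d, h', rfl, e⟩ | ⟨p, t, q, h1, h2, rfl, e⟩ |
    ⟨q, t, p, h1, h2, rfl, e⟩
  · obtain rfl := f.inP_inj e
    exact P.evord_irrefl _ h'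
  · obtain rfl := f.inQ_inj e
    exact Q.evord_irrefl _ h'
  · obtain ⟨hp, rfl⟩ := f.inQ_eq_inP e
    exact P.evord_irrefl _ (P.evord_trans _ _ _ h1 ((f.evord_iff t ⟨p, hp⟩).2 h2))
  · obtain ⟨hp, rfl⟩ := f.inQ_eq_inP e.symm
    exact P.evord_irrefl _ (P.evord_trans _ _ _ ((f.evord_iff ⟨p, hp⟩ t).2 h1) h2)

theorem prec_irrefl (x : f.Carrier) : ¬ f.Prec x x := by
  rintro (⟨c, d, h, rfl, e⟩ | ⟨c, d, h, rfl, e⟩ | ⟨p, hp, q, hq, rfl, e⟩)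
  · obtain rfl := f.inP_inj e
    exact P.prec_irrefl _ h
  · obtain rfl := f.inQ_inj e
    exact Q.prec_irrefl _ h
  · exact hp (f.inQ_eq_inP e).1

theorem prec_trans (x y z : f.Carrier) (h : f.Prec x y) (k : f.Prec y z) : f.Prec x z := by
  rcases h with ⟨a, b, h, rfl, rfl⟩ | ⟨a, b, h, rfl, rfl⟩ | ⟨p, hp, q, hq, rfl, rfl⟩
  · have ha : a ∉ P.tgt := fun ha => P.tgt_maximal _ ha _ h
    rcases k with ⟨c, d, k, e, rfl⟩ | ⟨c, d, k, e, rfl⟩ | ⟨p', hp', q', hq', e, rfl⟩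
    · obtain rfl := f.inP_inj e
      exact .inl ⟨a, d, P.prec_trans _ _ _ h k, rfl, rfl⟩
    · exact .inr (.inr ⟨a, ha, d, fun hd => Q.src_minimal _ hd _ k, rfl, rfl⟩)
    · exact .inr (.inr ⟨a, ha, q', hq', rfl, rfl⟩)
  · have hb : b ∉ Q.src := fun hb => Q.src_minimal _ hb _ h
    rcases k with ⟨c, d, k, e, rfl⟩ | ⟨c, d, k, e, rfl⟩ | ⟨p', hp', q', hq', e, rfl⟩
    · exact absurd k (P.tgt_maximal _ (f.inQ_eq_inP e.symm).1 _)
    · obtain rfl := f.inQ_inj e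
      exact .inr (.inl ⟨a, d, Q.prec_trans _ _ _ h k, rfl, rfl⟩)
    · exact absurd (f.inQ_eq_inP e.symm).1 hp'
  · rcases k with ⟨c, d, k, e, rfl⟩ | ⟨c, d, k, e, rfl⟩ | ⟨p', hp', q', hq', e, rfl⟩
    · exact absurd k (P.tgt_maximal _ (f.inQ_eq_inP e.symm).1 _)
    · exact .inr (.inr ⟨p, hp, d, fun hd => Q.src_minimal _ hd _ k, rfl, rfl⟩)
    · exact .inr (.inr ⟨p, hp, q', hq', rfl, rfl⟩)

theorem comparable_P (a b : P.carrier) : f.inP a = f.inP b ∨ f.Prec (f.inP a) (f.inP b) ∨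
    f.Prec (f.inP b) (f.inP a) ∨ f.Evord (f.inP a) (f.inP b) ∨ f.Evord (f.inP b) (f.inP a) := by
  rcases P.comparable a b with h | h | h | h | h
  · exact .inl (congrArg f.inP h)
  · exact .inr (.inl (.inl ⟨a, b, h, rfl, rfl⟩))
  · exact .inr (.inr (.inl (.inl ⟨b, a, h, rfl, rfl⟩)))
  · exact .inr (.inr (.inr (.inl (.single (.inl ⟨a, b, h, rfl, rfl⟩)))))
  · exact .inr (.inr (.inr (.inr (.single (.inl ⟨b, a, h, rfl, rfl⟩)))))

theorem comparable_Q (a b : Q.carrier) : f.inQ a = f.inQ b ∨ f.Prec (f.inQ a) (f.inQ b) ∨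
    f.Prec (f.inQ b) (f.inQ a) ∨ f.Evord (f.inQ a) (f.inQ b) ∨ f.Evord (f.inQ b) (f.inQ a) := by
  rcases Q.comparable a b with h | h | h | h | h
  · exact .inl (congrArg f.inQ h)
  · exact .inr (.inl (.inr (.inl ⟨a, b, h, rfl, rfl⟩)))
  · exact .inr (.inr (.inl (.inr (.inl ⟨b, a, h, rfl, rfl⟩))))
  · exact .inr (.inr (.inr (.inl (.single (.inr ⟨a, b, h, rfl, rfl⟩)))))
  · exact .inr (.inr (.inr (.inr (.single (.inr ⟨b, a, h, rfl, rfl⟩)))))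

theorem comparable (x y : f.Carrier) :
    x = y ∨ f.Prec x y ∨ f.Prec y x ∨ f.Evord x y ∨ f.Evord y x := by
  rcases f.exists_rep x with ⟨a, rfl⟩ | ⟨a, ha, rfl⟩ <;>
    rcases f.exists_rep y with ⟨b, rfl⟩ | ⟨b, hb, rfl⟩
  · exact f.comparable_P a b
  · by_cases h : a ∈ P.tgt
    · have := f.comparable_Q (f.equiv ⟨a, h⟩) b
      rwa [f.inQ_src] at this
    · exact .inr (.inl (.inr (.inr ⟨a, h, b, hb, rfl, rfl⟩)))
  · by_cases h : b ∈ P.tgt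
    · have := f.comparable_Q a (f.equiv ⟨b, h⟩)
      rwa [f.inQ_src] at this
    · exact .inr (.inr (.inl (.inr (.inr ⟨b, h, a, ha, rfl, rfl⟩))))
  · exact f.comparable_Q a b

end Match

/-- Gluing composition of `P` and `Q` along an isomorphism `f` from the target interface of `P` to
the source interface of `Q`. -/
noncomputable def glue (P Q : Iposet α) (f : Match P Q) : Iposet α where
  carrier := f.Carrier
  finite := by
    have := P.finite
    have := Q.finite
    infer_instance
  prec := f.Prec
  evord := f.Evord
  src := f.inP '' P.src
  tgt := f.inQ '' Q.tgt
  label := Sum.elim P.label fun q => Q.label q.1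
  prec_irrefl := f.prec_irrefl
  prec_trans := f.prec_trans
  evord_irrefl := f.evord_irrefl
  evord_trans := fun _ _ _ h k => h.trans k
  comparable := f.comparable
  src_minimal := by
    rintro _ ⟨p, hp, rfl⟩ y (⟨a, b, h, rfl, e⟩ | ⟨a, b, h, rfl, e⟩ | ⟨a, ha, q, hq, rfl, e⟩)
    · obtain rfl := f.inP_inj e
      exact P.src_minimal _ hp _ h
    · obtain ⟨_, rfl⟩ := f.inQ_eq_inP e
      exact Q.src_minimal _ (Subtype.prop _) _ h
    · obtain ⟨_, rfl⟩ := f.inQ_eq_inP e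
      exact hq (Subtype.prop _)
  tgt_maximal := by
    rintro _ ⟨q, hq, rfl⟩ y (⟨a, b, h, e, rfl⟩ | ⟨a, b, h, e, rfl⟩ | ⟨a, ha, b, hb, e, rfl⟩)
    · exact P.tgt_maximal _ (f.inQ_eq_inP e.symm).1 _ h
    · obtain rfl := f.inQ_inj e
      exact Q.tgt_maximal _ hq _ h
    · exact ha (f.inQ_eq_inP e.symm).1

end Iposet

/-- An ipomset is an isomorphism class of labelled iposets. -/
def Ipomset (α : Type u) : Type (max 1 u) := Quotient (Iposet.setoid α)

namespace Ipomset

variable {α : Type u}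

/-- The isomorphism class of a labelled iposet. -/
def mk (P : Iposet α) : Ipomset α := Quotient.mk _ P

/-- Subsumption `P ⊑ Q` of ipomsets. -/
def Subsu (P Q : Ipomset α) : Prop :=
  Quotient.liftOn₂ P Q Iposet.Subsu fun _ _ _ _ h k => propext
    ⟨fun s => (Iposet.Iso.subsu (Iposet.Iso.symm h)).trans (s.trans (Iposet.Iso.subsu k)),
      fun s => (Iposet.Iso.subsu h).trans (s.trans (Iposet.Iso.subsu (Iposet.Iso.symm k)))⟩

/-- Interval ipomsets. -/
def IsInterval (P : Ipomset α) : Prop := ∃ p : Iposet α, mk p = P ∧ p.IsInterval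

/-- `IsPar P Q R` says that `R = P ∥ Q`. -/
def IsPar (P Q R : Ipomset α) : Prop :=
  ∃ p q : Iposet α, mk p = P ∧ mk q = Q ∧ mk (p.par q) = R

/-- `IsGlue P Q R` says that `P * Q` is defined (the target interface of `P` is isomorphic to the
source interface of `Q`) and equal to `R`. -/
def IsGlue (P Q R : Ipomset α) : Prop :=
  ∃ (p q : Iposet α) (f : p.Match q), mk p = P ∧ mk q = Q ∧ mk (p.glue q f) = R

/-- Down-closure of a set of ipomsets inside the interval ipomsets. -/
def down (L : Set (Ipomset α)) : Set (Ipomset α) :=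
  {P | P.IsInterval ∧ ∃ Q ∈ L, P.Subsu Q}

/-- An interval ipomset language: a set of interval ipomsets that is down-closed: with `Q` it
contains all interval ipomsets subsumed by `Q`. -/
def IsLanguage (L : Set (Ipomset α)) : Prop :=
  (∀ P ∈ L, P.IsInterval) ∧ ∀ P Q : Ipomset α, P.IsInterval → P.Subsu Q → Q ∈ L → P ∈ L

/-- Gluing composition of languages. -/
def glueLang (L M : Set (Ipomset α)) : Set (Ipomset α) :=
  down {R | ∃ P ∈ L, ∃ Q ∈ M, IsGlue P Q R}

/-- Parallel composition of languages. -/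
def parLang (L M : Set (Ipomset α)) : Set (Ipomset α) :=
  down {R | ∃ P ∈ L, ∃ Q ∈ M, IsPar P Q R}

/-- `powSucc L n` is the power `Lⁿ⁺¹`, where `L¹ = L` and `Lⁿ⁺¹ = L * Lⁿ`. -/
def powSucc (L : Set (Ipomset α)) : ℕ → Set (Ipomset α)
  | 0 => L
  | n + 1 => glueLang L (powSucc L n)

/-- Kleene plus, the union of all powers `Lⁿ` with `n ≥ 1`. -/
def plusLang (L : Set (Ipomset α)) : Set (Ipomset α) := ⋃ n : ℕ, powSucc L n

end Ipomset

/-! ### The labelled precube category -/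

/-- Isomorphism classes of lo-sets, that is, words over `α`; these are the objects of the labelled
precube category.  The events of the word are its positions, in their natural order. -/
structure Word (α : Type u) where
  length : ℕ
  label : Fin length → α

namespace Word

variable {α : Type u}

/-- A coface map `d_{A,B} : U → V`: an order and label preserving map `∂` from `U` to `V`, with the
complement of its range split into the set `A` of unstarted and the set `B` of terminated events. -/
@[ext]
structure Coface (U V : Word α) where
  emb : Fin U.length ↪o Fin V.length
  unstarted : Set (Fin V.length)
  terminated : Set (Fin V.length)
  label_emb : ∀ i, V.label (emb i) = U.label i
  disjoint : Disjoint unstarted terminated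
  union_eq : unstarted ∪ terminated = (Set.range emb)ᶜ

/-- The identity coface map. -/
def Coface.id (U : Word α) : Coface U U where
  emb := RelEmbedding.refl _
  unstarted := ∅
  terminated := ∅
  label_emb _ := rfl
  disjoint := by simp
  union_eq := by ext; simp

/-- The composite of `d_{A,B} : U → V` and `d_{C,D} : V → W` is
`d_{∂(A) ∪ C, ∂(B) ∪ D} : U → W`, where `∂ : V → W` underlies `d_{C,D}`. -/
def Coface.comp {U V W : Word α} (d : Coface U V) (e : Coface V W) : Coface U W where
  emb := d.emb.trans e.emb
  unstarted := e.emb '' d.unstarted ∪ e.unstarted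
  terminated := e.emb '' d.terminated ∪ e.terminated
  label_emb i := (e.label_emb _).trans (d.label_emb i)
  disjoint := by
    have h1 : ∀ x, x ∈ e.unstarted ∪ e.terminated → ∀ y, e.emb y ≠ x := by
      intro x hx y hy
      rw [e.union_eq] at hx
      exact hx ⟨y, hy⟩
    rw [Set.disjoint_left]
    rintro _ (⟨x, hx, rfl⟩ | hx) (⟨y, hy, e'⟩ | hy)
    · obtain rfl := e.emb.injective e'
      exact Set.disjoint_left.1 d.disjoint hx hy
    · exact h1 _ (.inr hy) _ rfl
    · exact h1 _ (.inl hx) _ e'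
    · exact Set.disjoint_left.1 e.disjoint hx hy
  union_eq := by
    ext w
    have h1 := Set.ext_iff.1 e.union_eq w
    have h2 := fun v => Set.ext_iff.1 d.union_eq v
    simp only [Set.mem_union, Set.mem_compl_iff, Set.mem_range, Set.mem_image] at h1 h2 ⊢
    constructor
    · rintro ((⟨v, hv, rfl⟩ | h) | (⟨v, hv, rfl⟩ | h)) ⟨u, hu⟩
      · exact (h2 v).1 (.inl hv) ⟨u, e.emb.injective hu⟩
      · exact h1.1 (.inl h) ⟨_, hu⟩
      · exact (h2 v).1 (.inr hv) ⟨u, e.emb.injective hu⟩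
      · exact h1.1 (.inr h) ⟨_, hu⟩
    · intro h
      by_cases hw : ∃ v, e.emb v = w
      · obtain ⟨v, rfl⟩ := hw
        rcases (h2 v).2 (fun ⟨u, hu⟩ => h ⟨u, congrArg e.emb hu⟩) with k | k
        · exact .inl (.inl ⟨v, k, rfl⟩)
        · exact .inr (.inl ⟨v, k, rfl⟩)
      · rcases h1.2 hw with k | k
        · exact .inl (.inr k)
        · exact .inr (.inr k)

/-- The labelled precube category. -/
instance : Category (Word α) where
  Hom := Coface
  id := Coface.id
  comp := Coface.comp
  id_comp d := by
    apply Coface.ext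
    · rfl
    · simp [Coface.comp, Coface.id]
    · simp [Coface.comp, Coface.id]
  comp_id d := by
    apply Coface.ext
    · rfl
    · simp [Coface.comp, Coface.id]
    · simp [Coface.comp, Coface.id]
  assoc d e g := by
    apply Coface.ext
    · rfl
    · simp [Coface.comp, Set.image_union, Set.image_image, Set.union_assoc]
    · simp [Coface.comp, Set.image_union, Set.image_image, Set.union_assoc]

/-- The discrete ipomset on the word `U` with source interface `S` and target interface `T`. -/
def ilo (U : Word α) (S T : Set (Fin U.length)) : Iposet α where
  carrier := Fin U.length
  finite := inferInstance
  prec _ _ := False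
  evord i j := i < j
  src := S
  tgt := T
  label := U.label
  prec_irrefl _ h := h
  prec_trans _ _ _ h _ := h
  evord_irrefl _ := lt_irrefl _
  evord_trans _ _ _ := lt_trans
  comparable x y := by
    rcases lt_trichotomy x y with h | h | h <;> simp [h]
  src_minimal _ _ _ h := h
  tgt_maximal _ _ _ h := h

/-- The empty word. -/
def nil (α : Type u) : Word α := ⟨0, Fin.elim0⟩

/-- The word with the single letter `a`. -/
def single (a : α) : Word α := ⟨1, fun _ => a⟩

end Word

/-! ### Rational languages -/

/-- The rational languages: the smallest class that contains `∅`, `{ε}`, `{[a]}`, `{[•a]}`,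
`{[a•]}`, `{[•a•]}` and is closed under union, gluing and parallel composition and Kleene plus. -/
inductive IsRational {α : Type u} : Set (Ipomset α) → Prop
  | empty : IsRational ∅
  | epsilon : IsRational {Ipomset.mk ((Word.nil α).ilo ∅ ∅)}
  | letter (a : α) : IsRational {Ipomset.mk ((Word.single a).ilo ∅ ∅)}
  | letter_src (a : α) : IsRational {Ipomset.mk ((Word.single a).ilo Set.univ ∅)}
  | letter_tgt (a : α) : IsRational {Ipomset.mk ((Word.single a).ilo ∅ Set.univ)}
  | letter_src_tgt (a : α) : IsRational {Ipomset.mk ((Word.single a).ilo Set.univ Set.univ)}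
  | union {L M : Set (Ipomset α)} : IsRational L → IsRational M → IsRational (L ∪ M)
  | glue {L M : Set (Ipomset α)} :
      IsRational L → IsRational M → IsRational (Ipomset.glueLang L M)
  | par {L M : Set (Ipomset α)} :
      IsRational L → IsRational M → IsRational (Ipomset.parLang L M)
  | plus {L : Set (Ipomset α)} : IsRational L → IsRational (Ipomset.plusLang L)

/-! ### Higher-dimensional automata -/

/-- A higher-dimensional automaton: a presheaf on the labelled precube category with finitely many
cells in total, together with sets of start and accept cells. -/
structure HDA (α : Type u) where
  presheaf : (Word α)ᵒᵖ ⥤ Type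
  finite : Finite (Σ U : Word α, presheaf.obj (Opposite.op U))
  start : Set (Σ U : Word α, presheaf.obj (Opposite.op U))
  accept : Set (Σ U : Word α, presheaf.obj (Opposite.op U))

namespace HDA

variable {α : Type u} (X : HDA α)

/-- The cells of an HDA, of all dimensions; `x.1` is the word of events of the cell `x`. -/
abbrev Cell : Type u := Σ U : Word α, X.presheaf.obj (Opposite.op U)

/-- The face of the cell `x` along the coface map `d`. -/
def face {U V : Word α} (d : U ⟶ V) (x : X.presheaf.obj (Opposite.op V)) : X.Cell :=
  ⟨U, X.presheaf.map d.op x⟩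

/-- Paths in an HDA, as sequences of up-steps `δ⁰_A(x) ↗ x` and down-steps `x ↘ δ¹_B(x)`. -/
inductive Path : X.Cell → X.Cell → Type u
  | nil (x : X.Cell) : Path x x
  | up {z : X.Cell} {U V : Word α} (d : U ⟶ V) (hd : Word.Coface.terminated d = ∅)
      (x : X.presheaf.obj (Opposite.op V)) (p : Path z (X.face d x)) : Path z ⟨V, x⟩
  | down {z : X.Cell} {U V : Word α} (d : U ⟶ V) (hd : Word.Coface.unstarted d = ∅)
      (x : X.presheaf.obj (Opposite.op V)) (p : Path z ⟨V, x⟩) : Path z (X.face d x)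

/-- `Ev p P` says that `P` is the ipomset `ev(p)` of the path `p`: the identity on the events of
`x` for the path of length `0` at `x`, and otherwise the gluing of the ipomsets of its steps, which
are `(U∖A, U, U)` for an up-step starting `A` and `(U, U, U∖B)` for a down-step terminating `B`. -/
inductive Path.Ev : {x y : X.Cell} → X.Path x y → Ipomset α → Prop
  | nil (x : X.Cell) : Path.Ev (.nil x) (Ipomset.mk (x.1.ilo Set.univ Set.univ))
  | up {z : X.Cell} {U V : Word α} (d : U ⟶ V) (hd : Word.Coface.terminated d = ∅)
      (x : X.presheaf.obj (Opposite.op V)) (p : X.Path z (X.face d x)) {P R : Ipomset α} :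
      Path.Ev p P →
      Ipomset.IsGlue P (Ipomset.mk (V.ilo (Word.Coface.unstarted d)ᶜ Set.univ)) R →
      Path.Ev (.up d hd x p) R
  | down {z : X.Cell} {U V : Word α} (d : U ⟶ V) (hd : Word.Coface.unstarted d = ∅)
      (x : X.presheaf.obj (Opposite.op V)) (p : X.Path z ⟨V, x⟩) {P R : Ipomset α} :
      Path.Ev p P →
      Ipomset.IsGlue P (Ipomset.mk (V.ilo Set.univ (Word.Coface.terminated d)ᶜ)) R →
      Path.Ev (.down d hd x p) R

/-- The set of ipomsets of accepting paths. -/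
def lang : Set (Ipomset α) :=
  {P | ∃ x ∈ X.start, ∃ y ∈ X.accept, ∃ p : X.Path x y, Path.Ev X p P}

end HDA

/-- A set of ipomsets is regular if it is recognised by an HDA. -/
def IsRegular {α : Type u} (L : Set (Ipomset α)) : Prop := ∃ X : HDA α, X.lang = L

end HDAKleene

/-! Both directions pass through finite graphs (`STGraph`) whose states carry words of events and
whose edges are starters (V∖A, V, V) or terminators (V, V, V∖B). An HDA is such a graph, but the
states of a graph need not have faces.

Regular implies rational. Between two states of a graph there are finitely many starters and
terminators. Each is a parallel product of one-point ipomsets, and nothing else is subsumed by it,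
because no precedence can be added (`isRational_ilo`). Kleene's state elimination
(`Via.down_insert`), with a down-closure at every stage, then gives a rational expression for the
down-closure of the language of the graph.

Rational implies regular. The core is `STGraph.lang_hda`: the down-closure of the language of every
graph is regular. Given this, union, gluing and plus are the usual automata constructions with
silent links, and parallel composition comes from the tensor product of two HDAs, which only has to
be a graph (`HDA.parLang_eq`).

The HDA of a graph A is built from the free presheaf on its states: an element over U is a state
together with a face U of its word, and the elements over U are preordered by those steps of A that
leave the events of U alone. A cell of the HDA over U is a map from the cube on U to this presheaf
that is strict on lower faces but only lax on the others: once events are terminated, A may have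
moved on.

This HDA accepts the down-closure. A run of A with ipomset Q yields a lax map on the track object of
Q, the presheaf of configurations (unstarted, running, terminated) of Q; such maps are glued step by
step (`HasTrack.glue`). They pull back along P ⊑ Q, since a subsumption sends configurations to
configurations. If P is interval, its track object can be traversed by steps
(`STGraph.reach_of_track`), which gives an accepting path with ipomset P.

It accepts nothing more. Along a path of the HDA with ipomset R there is a run of A with ipomset W
that may have started more events and terminated fewer than R has (`STGraph.relaxed_of_reach`). So W
has at most the precedence of R, and when the two configurations coincide at the end, R ⊑ W. -/

namespace HDAKleene

open CategoryTheory

universe u v w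

variable {α : Type u}

section

/-! ### Gluings, relationally -/

namespace Iposet

theorem prec_asymm (P : Iposet α) {x y : P.carrier} (h : P.prec x y) : ¬ P.prec y x :=
  fun k => P.prec_irrefl _ (P.prec_trans _ _ _ h k)

theorem evord_asymm (P : Iposet α) {x y : P.carrier} (h : P.evord x y) : ¬ P.evord y x :=
  fun k => P.evord_irrefl _ (P.evord_trans _ _ _ h k)

/-- `R` is the gluing of `P` and `Q`, with structural inclusions `i` and `j`. -/
structure IsGluing (P Q R : Iposet α) (i : P.carrier → R.carrier) (j : Q.carrier → R.carrier) :
    Prop where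
  inj_left : Function.Injective i
  inj_right : Function.Injective j
  cover : ∀ r, (∃ p, i p = r) ∨ ∃ q, j q = r
  overlap : ∀ {p q}, i p = j q → p ∈ P.tgt ∧ q ∈ Q.src
  of_tgt : ∀ p ∈ P.tgt, ∃ q, j q = i p
  of_src : ∀ q ∈ Q.src, ∃ p, i p = j q
  label_left : ∀ p, R.label (i p) = P.label p
  label_right : ∀ q, R.label (j q) = Q.label q
  src_iff : ∀ r, r ∈ R.src ↔ ∃ p ∈ P.src, i p = r
  tgt_iff : ∀ r, r ∈ R.tgt ↔ ∃ q ∈ Q.tgt, j q = r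
  prec_left : ∀ {a b}, R.prec (i a) (i b) ↔ P.prec a b
  prec_right : ∀ {a b}, R.prec (j a) (j b) ↔ Q.prec a b
  prec_cross : ∀ {p q}, p ∉ P.tgt → q ∉ Q.src → R.prec (i p) (j q)
  -- Only incomparable pairs matter: isomorphisms ignore the event order elsewhere, so the
  -- transitive closure in the definition of gluing never has to be analysed again.
  evord_left : ∀ {a b}, P.evord a b → ¬ P.prec a b → ¬ P.prec b a → R.evord (i a) (i b)
  evord_right : ∀ {a b}, Q.evord a b → ¬ Q.prec a b → ¬ Q.prec b a → R.evord (j a) (j b)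

/-- Reversal of the precedence order. -/
def op (P : Iposet α) : Iposet α where
  carrier := P.carrier
  finite := P.finite
  prec x y := P.prec y x
  evord := P.evord
  src := P.tgt
  tgt := P.src
  label := P.label
  prec_irrefl := P.prec_irrefl
  prec_trans x y z h k := P.prec_trans z y x k h
  evord_irrefl := P.evord_irrefl
  evord_trans := P.evord_trans
  comparable x y := by
    have := P.comparable x y
    tauto
  src_minimal := P.tgt_maximal
  tgt_maximal := P.src_minimal

/-- Time reversal swaps the factors and fixes the event order. It yields `cases'`, `assoc'` and
`iso_right` from their mirror images. -/
theorem IsGluing.op {P Q R : Iposet α} {i j} (h : IsGluing P Q R i j) :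
    IsGluing Q.op P.op R.op j i where
  inj_left := h.inj_right
  inj_right := h.inj_left
  cover r := (h.cover r).symm
  overlap e := (h.overlap e.symm).symm
  of_tgt := h.of_src
  of_src := h.of_tgt
  label_left := h.label_right
  label_right := h.label_left
  src_iff := h.tgt_iff
  tgt_iff := h.src_iff
  prec_left := h.prec_right
  prec_right := h.prec_left
  prec_cross hp hq := h.prec_cross hq hp
  evord_left e h1 h2 := h.evord_right e h2 h1
  evord_right e h1 h2 := h.evord_left e h2 h1

/-- The two orders never disagree on precedence-incomparable points when one is the image of the
other under a map preserving the event order of incomparable points. -/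
theorem evord_of_evord_map {P R : Iposet α} {i : P.carrier → R.carrier}
    (hi : ∀ {a b}, P.evord a b → ¬ P.prec a b → ¬ P.prec b a → R.evord (i a) (i b))
    {a b : P.carrier} (h : R.evord (i a) (i b)) (h1 : ¬ P.prec a b) (h2 : ¬ P.prec b a) :
    P.evord a b := by
  rcases P.comparable a b with rfl | e | e | e | e
  · exact absurd h (R.evord_irrefl _)
  · exact absurd e h1
  · exact absurd e h2
  · exact e
  · exact absurd h (R.evord_asymm (hi e h2 h1))

namespace IsGluing

variable {P Q R : Iposet α} {i : P.carrier → R.carrier} {j : Q.carrier → R.carrier}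

/-- An interface point lies in both factors, so one of them decides: it is minimal in Q and maximal
in P. If neither point is in the interface, `prec_cross` orders them the other way. -/
theorem not_prec (h : IsGluing P Q R i j) (q : Q.carrier) (p : P.carrier) :
    ¬ R.prec (j q) (i p) := by
  intro k
  by_cases hp : p ∈ P.tgt
  · obtain ⟨q', e⟩ := h.of_tgt p hp
    rw [← e, h.prec_right] at k
    exact Q.src_minimal _ (h.overlap e.symm).2 _ k
  by_cases hq : q ∈ Q.src
  · obtain ⟨p', e⟩ := h.of_src q hq
    rw [← e, h.prec_left] at k
    exact P.tgt_maximal _ (h.overlap e).1 _ k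
  exact R.prec_asymm k (h.prec_cross hp hq)

/-- A point of the gluing is either from `P` or from `Q` outside of the source interface. -/
theorem cases (h : IsGluing P Q R i j) (r : R.carrier) :
    (∃ p, i p = r) ∨ ∃ q ∉ Q.src, j q = r := by
  rcases h.cover r with ⟨p, e⟩ | ⟨q, e⟩
  · exact .inl ⟨p, e⟩
  · by_cases hq : q ∈ Q.src
    · obtain ⟨p, e'⟩ := h.of_src q hq
      exact .inl ⟨p, e'.trans e⟩
    · exact .inr ⟨q, hq, e⟩

theorem cases' (h : IsGluing P Q R i j) (r : R.carrier) :
    (∃ p ∉ P.tgt, i p = r) ∨ ∃ q, j q = r := (h.op.cases r).symm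

/-- A point of P outside the target and a point of Q outside the source are always ordered, so an
incomparable pair lies within one factor. Hence the factors determine the relevant event order of
the gluing. -/
theorem incomparable_cases (h : IsGluing P Q R i j) {x y : R.carrier} (h1 : ¬ R.prec x y)
    (h2 : ¬ R.prec y x) : (∃ a b, i a = x ∧ i b = y) ∨ ∃ a b, j a = x ∧ j b = y := by
  rcases h.cases' x with ⟨p, hp, rfl⟩ | ⟨q, rfl⟩
  · rcases h.cases y with ⟨p', rfl⟩ | ⟨q', hq', rfl⟩
    · exact .inl ⟨_, _, rfl, rfl⟩
    · exact absurd (h.prec_cross hp hq') h1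
  · rcases h.cases' y with ⟨p', hp', rfl⟩ | ⟨q', rfl⟩
    · by_cases hq : q ∈ Q.src
      · obtain ⟨p, e'⟩ := h.of_src q hq
        exact .inl ⟨_, _, e', rfl⟩
      · exact absurd (h.prec_cross hp' hq) h2
    · exact .inr ⟨_, _, rfl, rfl⟩

/-- Subsumption out of a gluing. -/
theorem subsu (h : IsGluing P Q R i j) {Z : Iposet α} (g : P.carrier → Z.carrier)
    (k : Q.carrier → Z.carrier) (hg : Function.Injective g) (hk : Function.Injective k)
    (cover : ∀ z, (∃ p, g p = z) ∨ ∃ q, k q = z)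
    (agree : ∀ p q, g p = k q ↔ i p = j q)
    (label_left : ∀ p, Z.label (g p) = P.label p) (label_right : ∀ q, Z.label (k q) = Q.label q)
    (src_iff : ∀ r, r ∈ Z.src ↔ ∃ p ∈ P.src, g p = r)
    (tgt_iff : ∀ r, r ∈ Z.tgt ↔ ∃ q ∈ Q.tgt, k q = r)
    (prec_left : ∀ a b, Z.prec (g a) (g b) → P.prec a b)
    (prec_right : ∀ a b, Z.prec (k a) (k b) → Q.prec a b)
    (not_prec : ∀ p q, p ∉ P.tgt → q ∉ Q.src → ¬ Z.prec (k q) (g p))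
    (evord_left : ∀ {a b}, P.evord a b → ¬ P.prec a b → ¬ P.prec b a → Z.evord (g a) (g b))
    (evord_right : ∀ {a b}, Q.evord a b → ¬ Q.prec a b → ¬ Q.prec b a → Z.evord (k a) (k b)) :
    ∃ f : R.carrier ≃ Z.carrier, IsSubsumption R Z f ∧ (∀ p, f (i p) = g p) ∧
      ∀ q, f (j q) = k q := by
  classical
  -- Of the equivalence `agree`, one direction makes the common extension of `g` and `k` well
  -- defined and the other makes it injective.
  have ex : ∀ r, ∃ z, (∀ p, i p = r → g p = z) ∧ ∀ q, j q = r → k q = z := by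
    intro r
    rcases h.cover r with ⟨p, rfl⟩ | ⟨q, rfl⟩
    · exact ⟨g p, fun p' e => congrArg g (h.inj_left e), fun q e => ((agree _ _).2 e.symm).symm⟩
    · exact ⟨k q, fun p e => (agree _ _).2 e, fun q' e => congrArg k (h.inj_right e)⟩
  choose f hf1 hf2 using ex
  have fi : ∀ p, f (i p) = g p := fun p => (hf1 _ p rfl).symm
  have fj : ∀ q, f (j q) = k q := fun q => (hf2 _ q rfl).symm
  have finj : Function.Injective f := by
    intro x y e
    rcases h.cover x with ⟨p, rfl⟩ | ⟨q, rfl⟩ <;> rcases h.cover y with ⟨p', rfl⟩ | ⟨q', rfl⟩ <;>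
      simp only [fi, fj] at e
    · rw [hg e]
    · exact (agree _ _).1 e
    · exact ((agree _ _).1 e.symm).symm
    · rw [hk e]
  have fsurj : Function.Surjective f := by
    intro z
    rcases cover z with ⟨p, rfl⟩ | ⟨q, rfl⟩
    · exact ⟨_, fi p⟩
    · exact ⟨_, fj q⟩
  refine ⟨Equiv.ofBijective f ⟨finj, fsurj⟩, ⟨fun x => ?_, fun x => ?_, fun x => ?_,
    fun x y => ?_, fun x y e h1 h2 => ?_⟩, fi, fj⟩
  · change x ∈ R.src ↔ f x ∈ Z.src
    rw [h.src_iff, src_iff]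
    simp only [← fi, finj.eq_iff]
  · change x ∈ R.tgt ↔ f x ∈ Z.tgt
    rw [h.tgt_iff, tgt_iff]
    simp only [← fj, finj.eq_iff]
  · change Z.label (f x) = R.label x
    rcases h.cover x with ⟨p, rfl⟩ | ⟨q, rfl⟩
    · rw [fi, label_left, h.label_left]
    · rw [fj, label_right, h.label_right]
  · change Z.prec (f x) (f y) → R.prec x y
    rcases h.cases' x with ⟨p, hp, rfl⟩ | ⟨q, rfl⟩ <;>
      rcases h.cases y with ⟨p', rfl⟩ | ⟨q', hq', rfl⟩ <;> intro e <;> simp only [fi, fj] at e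
    · exact h.prec_left.2 (prec_left _ _ e)
    · exact h.prec_cross hp hq'
    -- An interface point can be moved to the factor of the other point; without one, `not_prec`
    -- excludes the case.
    · by_cases hp : p' ∈ P.tgt
      · obtain ⟨q', e'⟩ := h.of_tgt p' hp
        rw [(agree _ _).2 e'.symm] at e
        rw [← e']
        exact h.prec_right.2 (prec_right _ _ e)
      by_cases hq : q ∈ Q.src
      · obtain ⟨p, e'⟩ := h.of_src q hq
        rw [← (agree _ _).2 e'] at e
        rw [← e']
        exact h.prec_left.2 (prec_left _ _ e)
      exact absurd e (not_prec _ _ hp hq)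
    · exact h.prec_right.2 (prec_right _ _ e)
  · change Z.evord (f x) (f y)
    rcases h.incomparable_cases h1 h2 with ⟨a, b, rfl, rfl⟩ | ⟨a, b, rfl, rfl⟩
    · rw [h.prec_left] at h1 h2
      rw [fi, fi]
      exact evord_left (evord_of_evord_map h.evord_left e h1 h2) h1 h2
    · rw [h.prec_right] at h1 h2
      rw [fj, fj]
      exact evord_right (evord_of_evord_map h.evord_right e h1 h2) h1 h2

/-- Gluings along the same identification are isomorphic. -/
theorem iso {R' : Iposet α} {i' : P.carrier → R'.carrier} {j' : Q.carrier → R'.carrier}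
    (h : IsGluing P Q R i j) (h' : IsGluing P Q R' i' j')
    (agree : ∀ p q, i' p = j' q ↔ i p = j q) : Iso R R' := by
  obtain ⟨f, hf, fi, fj⟩ := h.subsu i' j' h'.inj_left h'.inj_right h'.cover agree h'.label_left
    h'.label_right h'.src_iff h'.tgt_iff (fun _ _ => h'.prec_left.1) (fun _ _ => h'.prec_right.1)
    (fun _ _ _ _ => h'.not_prec _ _) h'.evord_left h'.evord_right
  refine ⟨f, hf, fun x y => ⟨fun e => ?_, hf.prec_of x y⟩⟩
  rcases h.cases' x with ⟨p, hp, rfl⟩ | ⟨q, rfl⟩ <;>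
    rcases h.cases y with ⟨p', rfl⟩ | ⟨q', hq', rfl⟩ <;> simp only [fi, fj]
  · exact h'.prec_left.2 (h.prec_left.1 e)
  · exact h'.prec_cross hp hq'
  · exact absurd e (h.not_prec _ _)
  · exact h'.prec_right.2 (h.prec_right.1 e)

end IsGluing

theorem Match.isGluing {P Q : Iposet α} (f : Match P Q) :
    IsGluing P Q (P.glue Q f) f.inP f.inQ where
  inj_left _ _ := f.inP_inj
  inj_right _ _ := f.inQ_inj
  cover r := (f.exists_rep r).imp_right fun ⟨q, _, e⟩ => ⟨q, e⟩
  overlap e := by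
    obtain ⟨hp, rfl⟩ := f.inQ_eq_inP e.symm
    exact ⟨hp, (f.equiv _).2⟩
  of_tgt p hp := ⟨_, f.inQ_src ⟨p, hp⟩⟩
  of_src q hq := ⟨f.equiv.symm ⟨q, hq⟩, by rw [← f.inQ_src, Equiv.apply_symm_apply]⟩
  label_left _ := rfl
  label_right q := by
    by_cases hq : q ∈ Q.src
    · have := f.label_eq (f.equiv.symm ⟨q, hq⟩)
      simp only [Equiv.apply_symm_apply] at this
      simp [Match.inQ, hq, glue, this]
    · simp [Match.inQ, hq, glue]
  src_iff _ := Iff.rfl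
  tgt_iff _ := Iff.rfl
  prec_left {a b} := by
    constructor
    · rintro (⟨c, d, h, e, e'⟩ | ⟨c, d, h, e, e'⟩ | ⟨p, hp, q, hq, e, e'⟩)
      · rwa [← f.inP_inj e, ← f.inP_inj e']
      · obtain ⟨_, rfl⟩ := f.inQ_eq_inP e'
        exact absurd h (Q.src_minimal _ (f.equiv _).2 _)
      · obtain ⟨_, rfl⟩ := f.inQ_eq_inP e'
        exact absurd (f.equiv _).2 hq
    · exact fun h => .inl ⟨a, b, h, rfl, rfl⟩
  prec_right {a b} := by
    constructor
    · rintro (⟨c, d, h, e, e'⟩ | ⟨c, d, h, e, e'⟩ | ⟨p, hp, q, hq, e, e'⟩)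
      · exact absurd h (P.tgt_maximal _ (f.inQ_eq_inP e.symm).1 _)
      · rwa [← f.inQ_inj e, ← f.inQ_inj e']
      · exact absurd (f.inQ_eq_inP e.symm).1 hp
    · exact fun h => .inr (.inl ⟨a, b, h, rfl, rfl⟩)
  prec_cross hp hq := .inr (.inr ⟨_, hp, _, hq, rfl, rfl⟩)
  evord_left h _ _ := .single (.inl ⟨_, _, h, rfl, rfl⟩)
  evord_right h _ _ := .single (.inr ⟨_, _, h, rfl, rfl⟩)

/-- A label and order preserving relation between interfaces is a matching. -/
theorem exists_match {P Q : Iposet α} (r : P.carrier → Q.carrier → Prop)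
    (hr : ∀ p q, r p q → p ∈ P.tgt ∧ q ∈ Q.src)
    (left : ∀ p ∈ P.tgt, ∃ q, r p q) (right : ∀ q ∈ Q.src, ∃ p, r p q)
    (inj : ∀ p p' q, r p q → r p' q → p = p') (uniq : ∀ p q q', r p q → r p q' → q = q')
    (label : ∀ p q, r p q → Q.label q = P.label p)
    (evord : ∀ p q p' q', r p q → r p' q' → P.evord p p' → Q.evord q q') :
    ∃ f : Match P Q, ∀ p q, f.inP p = f.inQ q ↔ r p q := by
  choose g hg using left
  choose g' hg' using right
  have hgr : ∀ p hp q, r p q ↔ q = g p hp :=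
    fun p hp q => ⟨fun h => uniq _ _ _ h (hg p hp), fun h => h ▸ hg p hp⟩
  let F : Match P Q :=
    { equiv :=
        { toFun := fun x => ⟨g x x.2, (hr _ _ (hg x x.2)).2⟩
          invFun := fun y => ⟨g' y y.2, (hr _ _ (hg' y y.2)).1⟩
          left_inv := fun x => Subtype.ext (inj _ _ _ (hg' _ _) (hg _ _))
          right_inv := fun y => Subtype.ext (uniq _ _ _ (hg _ _) (hg' _ _)) }
      evord_iff := fun x y => by
        -- Target points are maximal, hence totally ordered by the event order, so preserving it
        -- implies reflecting it.
        refine ⟨evord _ _ _ _ (hg _ _) (hg _ _), fun h => ?_⟩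
        rcases P.comparable x y with e | e | e | e | e
        · obtain rfl := Subtype.ext e
          exact absurd h (Q.evord_irrefl _)
        · exact absurd e (P.tgt_maximal _ x.2 _)
        · exact absurd e (P.tgt_maximal _ y.2 _)
        · exact e
        · exact absurd h (Q.evord_asymm (evord _ _ _ _ (hg _ _) (hg _ _) e))
      label_eq := fun x => label _ _ (hg _ _) }
  refine ⟨F, fun p q => ⟨fun e => ?_, fun h => ?_⟩⟩
  · obtain ⟨hp, rfl⟩ := F.inQ_eq_inP e.symm
    exact hg p hp
  · obtain ⟨hp, _⟩ := hr _ _ h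
    rw [(hgr p hp q).1 h]
    exact (F.inQ_src ⟨p, hp⟩).symm

/-- Both interfaces sit in R at the same pairwise incomparable points, so their event orders both
agree with that of R and the identification is a matching. -/
theorem IsGluing.exists_match {P Q R : Iposet α} {i j} (h : IsGluing P Q R i j) :
    ∃ f : Match P Q, Iso (P.glue Q f) R ∧ ∀ p q, f.inP p = f.inQ q ↔ i p = j q := by
  have ev : ∀ p q p' q', i p = j q → i p' = j q' → P.evord p p' → Q.evord q q' := by
    intro p q p' q' e e' k
    have := h.evord_left k (P.tgt_maximal _ (h.overlap e).1 _) (P.tgt_maximal _ (h.overlap e').1 _)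
    rw [e, e'] at this
    exact evord_of_evord_map h.evord_right this (Q.src_minimal _ (h.overlap e').2 _)
      (Q.src_minimal _ (h.overlap e).2 _)
  obtain ⟨f, hf⟩ := Iposet.exists_match (fun p q => i p = j q) (fun _ _ => h.overlap)
    (fun p hp => (h.of_tgt p hp).imp fun _ => Eq.symm) (fun q hq => h.of_src q hq)
    (fun p p' q e e' => h.inj_left (e.trans e'.symm))
    (fun p q q' e e' => h.inj_right (e.symm.trans e'))
    (fun p q e => by rw [← h.label_left, e, h.label_right]) ev
  exact ⟨f, f.isGluing.iso h fun p q => (hf p q).symm, hf⟩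

/-- Transport of gluings along isomorphisms. -/
theorem IsGluing.congr {P Q R P' Q' R' : Iposet α} {i j} (h : IsGluing P Q R i j)
    (hP : Iso P' P) (hQ : Iso Q' Q) (hR : Iso R R') : ∃ i' j', IsGluing P' Q' R' i' j' := by
  obtain ⟨f, hf, hf'⟩ := hP
  obtain ⟨g, hg, hg'⟩ := hQ
  obtain ⟨k, hk, hk'⟩ := hR
  refine ⟨fun p => k (i (f p)), fun q => k (j (g q)), ?_⟩
  have e1 : ∀ {a b}, k a = k b ↔ a = b := fun {a b} => k.injective.eq_iff
  exact
  { inj_left := k.injective.comp (h.inj_left.comp f.injective)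
    inj_right := k.injective.comp (h.inj_right.comp g.injective)
    cover := fun r => by
      rcases h.cover (k.symm r) with ⟨p, e⟩ | ⟨q, e⟩
      · exact .inl ⟨f.symm p, by simp [e]⟩
      · exact .inr ⟨g.symm q, by simp [e]⟩
    overlap := fun {p q} e => by
      rw [hf.tgt_iff, hg.src_iff]
      exact h.overlap (k.injective e)
    of_tgt := fun p hp => by
      obtain ⟨q, e⟩ := h.of_tgt _ ((hf.tgt_iff _).1 hp)
      exact ⟨g.symm q, by simp [e]⟩
    of_src := fun q hq => by
      obtain ⟨p, e⟩ := h.of_src _ ((hg.src_iff _).1 hq)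
      exact ⟨f.symm p, by simp [e]⟩
    label_left := fun p => by rw [hk.label_eq, h.label_left, hf.label_eq]
    label_right := fun p => by rw [hk.label_eq, h.label_right, hg.label_eq]
    src_iff := fun r => by
      obtain ⟨r, rfl⟩ := k.surjective r
      simp only [← hk.src_iff, h.src_iff, hf.src_iff, e1]
      exact ⟨fun ⟨p, hp, e⟩ => ⟨f.symm p, by simpa using hp, by simpa using e⟩,
        fun ⟨p, hp, e⟩ => ⟨_, hp, e⟩⟩
    tgt_iff := fun r => by
      obtain ⟨r, rfl⟩ := k.surjective r
      simp only [← hk.tgt_iff, h.tgt_iff, hg.tgt_iff, e1]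
      exact ⟨fun ⟨p, hp, e⟩ => ⟨g.symm p, by simpa using hp, by simpa using e⟩,
        fun ⟨p, hp, e⟩ => ⟨_, hp, e⟩⟩
    prec_left := by simp [← hk', h.prec_left, hf']
    prec_right := by simp [← hk', h.prec_right, hg']
    prec_cross := fun hp hq => by
      rw [← hk']
      rw [hf.tgt_iff] at hp
      rw [hg.src_iff] at hq
      exact h.prec_cross hp hq
    evord_left := fun {a b} e h1 h2 => by
      have := hf.evord_of _ _ e h1 h2
      rw [hf'] at h1 h2
      refine hk.evord_of _ _ (h.evord_left this h1 h2) ?_ ?_ <;> rwa [h.prec_left]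
    evord_right := fun {a b} e h1 h2 => by
      have := hg.evord_of _ _ e h1 h2
      rw [hg'] at h1 h2
      refine hk.evord_of _ _ (h.evord_right this h1 h2) ?_ ?_ <;> rwa [h.prec_right] }

end Iposet

namespace Ipomset

open Iposet

theorem mk_eq {P Q : Iposet α} : mk P = mk Q ↔ Iso P Q := Quotient.eq

theorem exists_rep (P : Ipomset α) : ∃ p : Iposet α, mk p = P := Quotient.exists_rep P

theorem subsu_mk {P Q : Iposet α} : (mk P).Subsu (mk Q) ↔ P.Subsu Q := Iff.rfl

/-- Representatives of all three classes can be chosen freely; `IsGlue` is used through this form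
from here on. -/
theorem isGlue_mk {P Q R : Iposet α} :
    IsGlue (mk P) (mk Q) (mk R) ↔ ∃ i j, IsGluing P Q R i j := by
  constructor
  · rintro ⟨p, q, f, hp, hq, hr⟩
    exact f.isGluing.congr (mk_eq.1 hp.symm) (mk_eq.1 hq.symm) (mk_eq.1 hr)
  · rintro ⟨i, j, h⟩
    obtain ⟨f, hf, _⟩ := h.exists_match
    exact ⟨P, Q, f, rfl, rfl, mk_eq.2 hf⟩

end Ipomset

end

/-! ### Associativity, monotonicity and interval representations of gluings. -/

section

namespace Iposet

namespace IsGluing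

/-- Associativity of gluing, from left to right. -/
theorem assoc {P Q R A S : Iposet α} {i j k l} (h : IsGluing P Q A i j) (h' : IsGluing A R S k l) :
    ∃ (B : Iposet α) (i' : Q.carrier → B.carrier) (j' : R.carrier → B.carrier)
      (k' : P.carrier → S.carrier) (l' : B.carrier → S.carrier),
      IsGluing Q R B i' j' ∧ IsGluing P B S k' l' := by
  have jt : ∀ q, j q ∈ A.tgt ↔ q ∈ Q.tgt := fun q => by
    rw [h.tgt_iff]
    exact ⟨fun ⟨q', hq', e⟩ => h.inj_right e ▸ hq', fun hq => ⟨q, hq, rfl⟩⟩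
  -- The gluing of Q and R is the part of S covered by Q and R, with the source interface of Q and
  -- the target interface of S.
  let B : Iposet α :=
    { carrier := {s : S.carrier // (∃ q, k (j q) = s) ∨ ∃ r, l r = s}
      finite := have := S.finite; inferInstance
      prec := fun x y => S.prec x y
      evord := fun x y => S.evord x y
      src := {x | ∃ q ∈ Q.src, k (j q) = x}
      tgt := {x | x.1 ∈ S.tgt}
      label := fun x => S.label x
      prec_irrefl := fun x => S.prec_irrefl x
      prec_trans := fun x y z => S.prec_trans x y z
      evord_irrefl := fun x => S.evord_irrefl x
      evord_trans := fun x y z => S.evord_trans x y z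
      comparable := fun x y => by simpa [Subtype.ext_iff] using S.comparable x y
      src_minimal := by
        rintro ⟨x, hx⟩ ⟨q, hq, rfl⟩ ⟨y, ⟨q', rfl⟩ | ⟨r, rfl⟩⟩ e
        · exact Q.src_minimal _ hq _ (h.prec_right.1 (h'.prec_left.1 e))
        · exact h'.not_prec _ _ e
      tgt_maximal := fun x hx y => S.tgt_maximal _ hx _ }
  have hB : ∀ x : B.carrier, (∃ q, k (j q) = x.1) ∨ ∃ r, l r = x.1 := fun x => x.2
  refine ⟨B, fun q => ⟨k (j q), .inl ⟨q, rfl⟩⟩, fun r => ⟨l r, .inr ⟨r, rfl⟩⟩, fun p => k (i p),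
    Subtype.val, ?_, ?_⟩
  · exact
    { inj_left := fun a b e => h.inj_right (h'.inj_left (congrArg Subtype.val e))
      inj_right := fun a b e => h'.inj_right (congrArg Subtype.val e)
      cover := fun ⟨x, hx⟩ => hx.imp (fun ⟨q, e⟩ => ⟨q, Subtype.ext e⟩) fun ⟨q, e⟩ =>
        ⟨q, Subtype.ext e⟩
      overlap := fun {q r} e => by
        have := h'.overlap (congrArg Subtype.val e)
        rwa [jt] at this
      of_tgt := fun q hq => (h'.of_tgt (j q) ((jt q).2 hq)).imp fun r e => Subtype.ext e
      of_src := fun r hr => by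
        obtain ⟨a, e⟩ := h'.of_src r hr
        obtain ⟨q, hq, rfl⟩ := (h.tgt_iff _).1 (h'.overlap e).1
        exact ⟨q, Subtype.ext e⟩
      label_left := fun q => (h'.label_left _).trans (h.label_right _)
      label_right := fun r => h'.label_right _
      src_iff := fun x => by simp [B, Subtype.ext_iff]
      tgt_iff := fun x => by simpa [B, Subtype.ext_iff] using h'.tgt_iff x
      prec_left := h'.prec_left.trans h.prec_right
      prec_right := h'.prec_right
      prec_cross := fun hq hr => h'.prec_cross (by rwa [jt]) hr
      evord_left := fun e h1 h2 => h'.evord_left (h.evord_right e h1 h2) (by rwa [h.prec_right])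
        (by rwa [h.prec_right])
      evord_right := h'.evord_right }
  · have key : ∀ p (x : B.carrier), k (i p) = x.1 → p ∈ P.tgt ∧ x ∈ B.src := by
      rintro p ⟨x, ⟨q, rfl⟩ | ⟨r, rfl⟩⟩ e
      · obtain ⟨h1, h2⟩ := h.overlap (h'.inj_left e)
        exact ⟨h1, q, h2, rfl⟩
      · obtain ⟨q, hq, e'⟩ := (h.tgt_iff _).1 (h'.overlap e).1
        obtain ⟨h1, h2⟩ := h.overlap e'.symm
        exact ⟨h1, q, h2, by rw [e', ← e]⟩
    have cross : ∀ p ∉ P.tgt, ∀ q ∉ Q.src, S.prec (k (i p)) (k (j q)) := fun p hp q hq =>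
      h'.prec_left.2 (h.prec_cross hp hq)
    exact
    { inj_left := h'.inj_left.comp h.inj_left
      inj_right := Subtype.val_injective
      cover := fun s => by
        rcases h'.cover s with ⟨a, rfl⟩ | ⟨r, rfl⟩
        · rcases h.cover a with ⟨p, rfl⟩ | ⟨q, rfl⟩
          · exact .inl ⟨p, rfl⟩
          · exact .inr ⟨⟨_, .inl ⟨q, rfl⟩⟩, rfl⟩
        · exact .inr ⟨⟨_, .inr ⟨r, rfl⟩⟩, rfl⟩
      overlap := fun {p x} e => key p x e
      of_tgt := fun p hp => by
        obtain ⟨q, e⟩ := h.of_tgt p hp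
        exact ⟨⟨_, .inl ⟨q, rfl⟩⟩, congrArg k e⟩
      of_src := by
        rintro ⟨x, hx⟩ ⟨q, hq, rfl⟩
        obtain ⟨p, e⟩ := h.of_src q hq
        exact ⟨p, congrArg k e⟩
      label_left := fun p => (h'.label_left _).trans (h.label_left _)
      label_right := fun x => rfl
      src_iff := fun s => by
        rw [h'.src_iff]
        constructor
        · rintro ⟨a, ha, rfl⟩
          obtain ⟨p, hp, rfl⟩ := (h.src_iff _).1 ha
          exact ⟨p, hp, rfl⟩
        · rintro ⟨p, hp, rfl⟩
          exact ⟨_, (h.src_iff _).2 ⟨p, hp, rfl⟩, rfl⟩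
      tgt_iff := fun s => by
        constructor
        · intro hs
          obtain ⟨r, hr, rfl⟩ := (h'.tgt_iff _).1 hs
          exact ⟨⟨_, .inr ⟨r, rfl⟩⟩, hs, rfl⟩
        · rintro ⟨x, hx, rfl⟩
          exact hx
      prec_left := h'.prec_left.trans h.prec_left
      prec_right := Iff.rfl
      prec_cross := by
        rintro p ⟨x, hx⟩ hp hs
        rcases hx with ⟨q, rfl⟩ | ⟨r, rfl⟩
        · exact cross p hp q fun hq => hs ⟨q, hq, rfl⟩
        -- A point in the source of R is also a point of Q, where `cross` applies. Any other point
        -- is ordered after P by the outer gluing, because the target of A comes from Q and so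
        -- cannot contain a point of P outside the target of P.
        · by_cases hr : r ∈ R.src
          · obtain ⟨a, e⟩ := h'.of_src r hr
            obtain ⟨q, hq, rfl⟩ := (h.tgt_iff _).1 (h'.overlap e).1
            have := cross p hp q fun hq => hs ⟨q, hq, e⟩
            rwa [e] at this
          · refine h'.prec_cross (fun ht => ?_) hr
            obtain ⟨q, hq, e⟩ := (h.tgt_iff _).1 ht
            exact hp (h.overlap e.symm).1
      evord_left := fun e h1 h2 => h'.evord_left (h.evord_left e h1 h2) (by rwa [h.prec_left])
        (by rwa [h.prec_left])
      evord_right := fun e _ _ => e }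

/-- Associativity of gluing, from right to left. -/
theorem assoc' {P Q R B S : Iposet α} {i j k l} (h : IsGluing Q R B i j)
    (h' : IsGluing P B S k l) :
    ∃ (A : Iposet α) (i' : P.carrier → A.carrier) (j' : Q.carrier → A.carrier)
      (k' : A.carrier → S.carrier) (l' : R.carrier → S.carrier),
      IsGluing P Q A i' j' ∧ IsGluing A R S k' l' := by
  obtain ⟨A, i', j', k', l', h1, h2⟩ := h.op.assoc h'.op
  exact ⟨A.op, j', i', l', k', h1.op, h2.op⟩

/-- Gluing is monotone with respect to subsumption. -/
theorem mono {P Q R P' Q' : Iposet α} {i j} (h : IsGluing P Q R i j) (hP : Subsu P P')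
    (hQ : Subsu Q Q') : ∃ (R' : Iposet α) (i' : P'.carrier → R'.carrier)
      (j' : Q'.carrier → R'.carrier), IsGluing P' Q' R' i' j' ∧ Subsu R R' := by
  obtain ⟨f, hf⟩ := hP
  obtain ⟨g, hg⟩ := hQ
  have ft : ∀ p, f.symm p ∈ P.tgt ↔ p ∈ P'.tgt := fun p => by simp [hf.tgt_iff]
  have gs : ∀ p, g.symm p ∈ Q.src ↔ p ∈ Q'.src := fun p => by simp [hg.src_iff]
  -- The identification is transported along the two bijections. Interface points are incomparable,
  -- so their event order can be pulled back to P, carried over to Q and pushed on to Q'.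
  obtain ⟨m', hm'⟩ := Iposet.exists_match (P := P') (Q := Q')
    (fun p q => i (f.symm p) = j (g.symm q))
    (fun p q e => by rw [← ft, ← gs]; exact h.overlap e)
    (fun p hp => by
      obtain ⟨q, e⟩ := h.of_tgt _ ((ft p).2 hp)
      exact ⟨g q, by simp [e]⟩)
    (fun p hp => by
      obtain ⟨q, e⟩ := h.of_src _ ((gs p).2 hp)
      exact ⟨f q, by simp [e]⟩)
    (fun p p' q e e' => f.symm.injective (h.inj_left (e.trans e'.symm)))
    (fun p q q' e e' => g.symm.injective (h.inj_right (e.symm.trans e')))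
    (fun p q e => by
      have h1 := hf.label_eq (f.symm p)
      have h2 := hg.label_eq (g.symm q)
      simp only [Equiv.apply_symm_apply] at h1 h2
      rw [h1, h2, ← h.label_left, e, h.label_right])
    (fun p q p' q' e e' k => by
      obtain ⟨h1, h2⟩ := h.overlap e
      obtain ⟨h3, h4⟩ := h.overlap e'
      have k1 := evord_of_evord_map (P := P) (R := P') (i := f) (fun {a b} => hf.evord_of a b)
        (a := f.symm p) (b := f.symm p') (by simpa using k) (P.tgt_maximal _ h1 _)
        (P.tgt_maximal _ h3 _)
      have k2 := h.evord_left k1 (P.tgt_maximal _ h1 _) (P.tgt_maximal _ h3 _)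
      rw [e, e'] at k2
      have k3 := evord_of_evord_map h.evord_right k2 (Q.src_minimal _ h4 _) (Q.src_minimal _ h2 _)
      simpa using hg.evord_of _ _ k3 (Q.src_minimal _ h4 _) (Q.src_minimal _ h2 _))
  have G := m'.isGluing
  refine ⟨_, _, _, G, ?_⟩
  obtain ⟨F, hF, -⟩ := h.subsu (fun p => m'.inP (f p)) (fun q => m'.inQ (g q))
    (G.inj_left.comp f.injective) (G.inj_right.comp g.injective)
    (fun z => (G.cover z).imp (fun ⟨p, e⟩ => ⟨f.symm p, by simpa using e⟩)
      fun ⟨p, e⟩ => ⟨g.symm p, by simpa using e⟩)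
    (fun p q => (hm' _ _).trans (by simp))
    (fun p => (G.label_left _).trans (hf.label_eq _))
    (fun p => (G.label_right _).trans (hg.label_eq _))
    (fun r => by
      rw [G.src_iff]
      simp only [hf.src_iff]
      exact ⟨fun ⟨p, hp, e⟩ => ⟨f.symm p, by simpa using hp, by simpa using e⟩,
        fun ⟨p, hp, e⟩ => ⟨_, hp, e⟩⟩)
    (fun r => by
      rw [G.tgt_iff]
      simp only [hg.tgt_iff]
      exact ⟨fun ⟨p, hp, e⟩ => ⟨g.symm p, by simpa using hp, by simpa using e⟩,
        fun ⟨p, hp, e⟩ => ⟨_, hp, e⟩⟩)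
    (fun a b e => hf.prec_of _ _ (G.prec_left.1 e))
    (fun a b e => hg.prec_of _ _ (G.prec_right.1 e))
    (fun p q _ _ => G.not_prec _ _)
    (fun {a b} e h1 h2 => G.evord_left (hf.evord_of _ _ e h1 h2) (fun k => h1 (hf.prec_of _ _ k))
      (fun k => h2 (hf.prec_of _ _ k)))
    (fun {a b} e h1 h2 => G.evord_right (hg.evord_of _ _ e h1 h2) (fun k => h1 (hg.prec_of _ _ k))
      (fun k => h2 (hg.prec_of _ _ k)))
  exact ⟨F, hF⟩

/-- Gluings of interval iposets are interval. -/
theorem isInterval {P Q R : Iposet α} {i j} (h : IsGluing P Q R i j) (hP : P.IsInterval)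
    (hQ : Q.IsInterval) : R.IsInterval := by
  classical
  obtain ⟨b, e, hbe, hp⟩ := hP
  obtain ⟨b', e', hbe', hp'⟩ := hQ
  have := P.finite
  have := Q.finite
  obtain ⟨M, hM⟩ := (Set.finite_range e).bddAbove
  obtain ⟨N, hN⟩ := (Set.finite_range b').bddBelow
  have hM' : ∀ p, e p ≤ M := fun p => hM ⟨p, rfl⟩
  have hN' : ∀ q, N ≤ b' q := fun q => hN ⟨q, rfl⟩
  -- Shifting the intervals of Q by `d` makes each of them begin after all intervals of P have
  -- ended.
  let d := M - N + 1
  have hd : ∀ p q, e p < b' q + d := fun p q => by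
    have := hM' p
    have := hN' q
    simp only [d]
    linarith
  -- A glued interface point begins as in P and ends as in Q.
  have exb : ∀ r, ∃ z : ℝ, (∀ p, i p = r → z = b p) ∧ ∀ q ∉ Q.src, j q = r → z = b' q + d := by
    intro r
    rcases h.cases r with ⟨p, rfl⟩ | ⟨q, hq, rfl⟩
    · exact ⟨b p, fun p' k => by rw [h.inj_left k], fun q hq k => absurd (h.overlap k.symm).2 hq⟩
    · exact ⟨b' q + d, fun p k => absurd (h.overlap k).2 hq, fun q' _ k => by rw [h.inj_right k]⟩
  have exe : ∀ r, ∃ z : ℝ, (∀ p ∉ P.tgt, i p = r → z = e p) ∧ ∀ q, j q = r → z = e' q + d := by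
    intro r
    rcases h.cases' r with ⟨p, hp, rfl⟩ | ⟨q, rfl⟩
    · exact ⟨e p, fun p' _ k => by rw [h.inj_left k], fun q k => absurd (h.overlap k.symm).1 hp⟩
    · exact ⟨e' q + d, fun p hp k => absurd (h.overlap k).1 hp, fun q' k => by rw [h.inj_right k]⟩
  choose B hB hB' using exb
  choose E hE hE' using exe
  refine ⟨B, E, fun r => ?_, fun x y => ?_⟩
  · rcases h.cases r with ⟨p, rfl⟩ | ⟨q, hq, rfl⟩
    · rw [hB _ p rfl]
      by_cases hp : p ∈ P.tgt
      · obtain ⟨q, k⟩ := h.of_tgt p hp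
        rw [hE' _ q k]
        linarith [hd p q, hbe p, hbe' q]
      · rw [hE _ p hp rfl]
        exact hbe p
    · rw [hB' _ q hq rfl, hE' _ q rfl]
      linarith [hbe' q]
  · rcases h.cases' x with ⟨p, hpt, rfl⟩ | ⟨q, rfl⟩ <;>
      rcases h.cases y with ⟨p', rfl⟩ | ⟨q', hq', rfl⟩
    · rw [hE _ p hpt rfl, hB _ p' rfl, h.prec_left, hp]
    · rw [hE _ p hpt rfl, hB' _ q' hq' rfl]
      exact iff_of_true (h.prec_cross hpt hq') (hd p q')
    · rw [hE' _ q rfl, hB _ p' rfl]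
      refine iff_of_false (h.not_prec _ _) ?_
      linarith [hd p' q, hbe p', hbe' q]
    · rw [hE' _ q rfl, hB' _ q' hq' rfl, h.prec_right, hp']
      constructor <;> intro <;> linarith

/-- Gluing with an identity on the right. -/
theorem iso_left {P Q R : Iposet α} {i j} (h : IsGluing P Q R i j) (hs : Q.src = Set.univ)
    (ht : Q.tgt = Set.univ) : Iso P R := by
  have surj : Function.Surjective i := fun r => by
    rcases h.cases r with h | ⟨q, hq, _⟩
    · exact h
    · simp [hs] at hq
  refine ⟨Equiv.ofBijective i ⟨h.inj_left, surj⟩, ⟨fun x => ?_, fun x => ?_, h.label_left,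
    fun x y => h.prec_left.1, fun x y e h1 h2 => h.evord_left e h1 h2⟩, fun x y => h.prec_left.symm⟩
  · change _ ↔ i x ∈ _
    rw [h.src_iff]
    exact ⟨fun hx => ⟨x, hx, rfl⟩, fun ⟨p, hp, e⟩ => h.inj_left e ▸ hp⟩
  · change _ ↔ i x ∈ _
    rw [h.tgt_iff]
    simp only [ht, Set.mem_univ, true_and]
    exact ⟨fun hx => h.of_tgt x hx, fun ⟨q, e⟩ => (h.overlap e.symm).1⟩

theorem _root_.HDAKleene.Iposet.Iso.op {P Q : Iposet α} (h : Iso P Q) : Iso P.op Q.op := by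
  obtain ⟨f, hf, hp⟩ := h
  exact ⟨f, ⟨hf.tgt_iff, hf.src_iff, hf.label_eq, fun x y => hf.prec_of y x,
    fun x y e h1 h2 => hf.evord_of x y e h2 h1⟩, fun x y => hp y x⟩

/-- Gluing with an identity on the left. -/
theorem iso_right {P Q R : Iposet α} {i j} (h : IsGluing P Q R i j) (hs : P.src = Set.univ)
    (ht : P.tgt = Set.univ) : Iso Q R :=
  (h.op.iso_left ht hs).op

end IsGluing

end Iposet

namespace Ipomset

open Iposet

theorem Subsu.refl (P : Ipomset α) : P.Subsu P := by
  obtain ⟨p, rfl⟩ := exists_rep P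
  exact (Iso.refl p).subsu

theorem Subsu.trans {P Q R : Ipomset α} (h : P.Subsu Q) (k : Q.Subsu R) : P.Subsu R := by
  obtain ⟨p, rfl⟩ := exists_rep P
  obtain ⟨q, rfl⟩ := exists_rep Q
  obtain ⟨r, rfl⟩ := exists_rep R
  exact Iposet.Subsu.trans h k

theorem isInterval_mk {P : Iposet α} : (mk P).IsInterval ↔ P.IsInterval := by
  refine ⟨?_, fun h => ⟨P, rfl, h⟩⟩
  rintro ⟨p, hp, b, e, h1, h2⟩
  obtain ⟨f, hf, hf'⟩ := mk_eq.1 hp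
  exact ⟨b ∘ f.symm, e ∘ f.symm, fun x => h1 _, fun x y => by simp [← h2, hf']⟩

theorem IsGlue.assoc {P Q R A S : Ipomset α} (h : IsGlue P Q A) (h' : IsGlue A R S) :
    ∃ B, IsGlue Q R B ∧ IsGlue P B S := by
  obtain ⟨P, rfl⟩ := exists_rep P
  obtain ⟨Q, rfl⟩ := exists_rep Q
  obtain ⟨R, rfl⟩ := exists_rep R
  obtain ⟨A, rfl⟩ := exists_rep A
  obtain ⟨S, rfl⟩ := exists_rep S
  obtain ⟨i, j, h⟩ := isGlue_mk.1 h
  obtain ⟨k, l, h'⟩ := isGlue_mk.1 h'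
  obtain ⟨B, _, _, _, _, h1, h2⟩ := h.assoc h'
  exact ⟨mk B, isGlue_mk.2 ⟨_, _, h1⟩, isGlue_mk.2 ⟨_, _, h2⟩⟩

theorem IsGlue.assoc' {P Q R B S : Ipomset α} (h : IsGlue Q R B) (h' : IsGlue P B S) :
    ∃ A, IsGlue P Q A ∧ IsGlue A R S := by
  obtain ⟨P, rfl⟩ := exists_rep P
  obtain ⟨Q, rfl⟩ := exists_rep Q
  obtain ⟨R, rfl⟩ := exists_rep R
  obtain ⟨B, rfl⟩ := exists_rep B
  obtain ⟨S, rfl⟩ := exists_rep S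
  obtain ⟨i, j, h⟩ := isGlue_mk.1 h
  obtain ⟨k, l, h'⟩ := isGlue_mk.1 h'
  obtain ⟨A, _, _, _, _, h1, h2⟩ := h.assoc' h'
  exact ⟨mk A, isGlue_mk.2 ⟨_, _, h1⟩, isGlue_mk.2 ⟨_, _, h2⟩⟩

theorem IsGlue.mono {P Q R P' Q' : Ipomset α} (h : IsGlue P Q R) (hP : P.Subsu P')
    (hQ : Q.Subsu Q') : ∃ R', IsGlue P' Q' R' ∧ R.Subsu R' := by
  obtain ⟨P, rfl⟩ := exists_rep P
  obtain ⟨Q, rfl⟩ := exists_rep Q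
  obtain ⟨R, rfl⟩ := exists_rep R
  obtain ⟨P', rfl⟩ := exists_rep P'
  obtain ⟨Q', rfl⟩ := exists_rep Q'
  obtain ⟨i, j, h⟩ := isGlue_mk.1 h
  obtain ⟨R', _, _, h1, h2⟩ := h.mono hP hQ
  exact ⟨mk R', isGlue_mk.2 ⟨_, _, h1⟩, h2⟩

theorem IsGlue.isInterval {P Q R : Ipomset α} (h : IsGlue P Q R) (hP : P.IsInterval)
    (hQ : Q.IsInterval) : R.IsInterval := by
  obtain ⟨P, rfl⟩ := exists_rep P
  obtain ⟨Q, rfl⟩ := exists_rep Q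
  obtain ⟨R, rfl⟩ := exists_rep R
  obtain ⟨i, j, h⟩ := isGlue_mk.1 h
  exact isInterval_mk.2 (h.isInterval (isInterval_mk.1 hP) (isInterval_mk.1 hQ))

theorem isInterval_ilo (U : Word α) (S T : Set (Fin U.length)) : (mk (U.ilo S T)).IsInterval :=
  isInterval_mk.2 ⟨fun _ => 0, fun _ => 0, fun _ => le_rfl, fun x y => by simp [Word.ilo]⟩

theorem IsGlue.eq_left {P R : Ipomset α} {U : Word α}
    (h : IsGlue P (mk (U.ilo Set.univ Set.univ)) R) : P = R := by
  obtain ⟨P, rfl⟩ := exists_rep P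
  obtain ⟨R, rfl⟩ := exists_rep R
  obtain ⟨i, j, h⟩ := isGlue_mk.1 h
  exact mk_eq.2 (h.iso_left rfl rfl)

theorem IsGlue.eq_right {Q R : Ipomset α} {U : Word α}
    (h : IsGlue (mk (U.ilo Set.univ Set.univ)) Q R) : Q = R := by
  obtain ⟨Q, rfl⟩ := exists_rep Q
  obtain ⟨R, rfl⟩ := exists_rep R
  obtain ⟨i, j, h⟩ := isGlue_mk.1 h
  exact mk_eq.2 (h.iso_right rfl rfl)

theorem mem_down_of_mem {L : Set (Ipomset α)} {P : Ipomset α} (h : P ∈ L) (hP : P.IsInterval) :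
    P ∈ down L := ⟨hP, P, h, .refl P⟩

theorem down_mono {L M : Set (Ipomset α)} (h : L ⊆ M) : down L ⊆ down M :=
  fun _ ⟨h1, Q, hQ, h2⟩ => ⟨h1, Q, h hQ, h2⟩

theorem down_down (L : Set (Ipomset α)) : down (down L) = down L :=
  Set.Subset.antisymm (fun _ ⟨h1, _, ⟨_, R, hR, h3⟩, h2⟩ => ⟨h1, R, hR, h2.trans h3⟩)
    fun _ h => mem_down_of_mem h h.1

theorem down_union (L M : Set (Ipomset α)) : down (L ∪ M) = down L ∪ down M := by
  ext P
  simp only [down, Set.mem_union, Set.mem_ofPred_eq]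
  constructor
  · rintro ⟨h, Q, hQ | hQ, k⟩
    · exact .inl ⟨h, Q, hQ, k⟩
    · exact .inr ⟨h, Q, hQ, k⟩
  · rintro (⟨h, Q, hQ, k⟩ | ⟨h, Q, hQ, k⟩)
    · exact ⟨h, Q, .inl hQ, k⟩
    · exact ⟨h, Q, .inr hQ, k⟩

/-- Powers absorb factors on the right. -/
theorem glue_mem_powSucc {L : Set (Ipomset α)} (hL : ∀ P ∈ L, P.IsInterval) {n : ℕ}
    {P Q R : Ipomset α} (hP : P ∈ powSucc L n) (hQ : Q ∈ L) (h : IsGlue P Q R) :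
    R ∈ powSucc L (n + 1) := by
  induction n generalizing P R with
  | zero => exact mem_down_of_mem ⟨P, hP, Q, hQ, h⟩ (h.isInterval (hL _ hP) (hL _ hQ))
  | succ n ih =>
    obtain ⟨hPi, P', ⟨A, hA, B, hB, hAB⟩, hs⟩ := hP
    -- With P subsumed by A * B, reassociate (A * B) * Q to A * (B * Q) and absorb Q into the
    -- shorter power.
    obtain ⟨R', h', hs'⟩ := h.mono hs (.refl Q)
    obtain ⟨C, hC, hC'⟩ := hAB.assoc h'
    exact ⟨h.isInterval hPi (hL _ hQ), R', ⟨A, hA, C, ih hB hC, hC'⟩, hs'⟩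

end Ipomset

end

/-! ### Cells of track objects -/

namespace Word

theorem Coface.emb_mem {U V : Word α} (d : U ⟶ V) (k : Fin V.length) :
    (k ∈ Coface.unstarted d ∨ k ∈ Coface.terminated d) ↔ ∀ l, Coface.emb d l ≠ k := by
  have := Set.ext_iff.1 (Coface.union_eq d) k
  simpa using this

theorem comp_unstarted {U V W : Word α} (d : U ⟶ V) (e : V ⟶ W) :
    Coface.unstarted (d ≫ e) = Coface.emb e '' Coface.unstarted d ∪ Coface.unstarted e := rfl

theorem comp_terminated {U V W : Word α} (d : U ⟶ V) (e : V ⟶ W) :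
    Coface.terminated (d ≫ e) = Coface.emb e '' Coface.terminated d ∪ Coface.terminated e := rfl

theorem comp_emb {U V W : Word α} (d : U ⟶ V) (e : V ⟶ W) (k : Fin U.length) :
    Coface.emb (d ≫ e) k = Coface.emb e (Coface.emb d k) := rfl

theorem id_emb {U : Word α} (k : Fin U.length) : Coface.emb (𝟙 U) k = k := rfl

theorem id_unstarted (U : Word α) : Coface.unstarted (𝟙 U) = ∅ := rfl

theorem id_terminated (U : Word α) : Coface.terminated (𝟙 U) = ∅ := rfl

/-- Words are rigid: the only order automorphism of `Fin n` is the identity, so isomorphic words are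
equal. This is why interfaces can later be compared by equations between words. -/
theorem ext_of_strictMono {U V : Word α} (f : Fin U.length → Fin V.length) (hf : StrictMono f)
    (hs : Function.Surjective f) (hl : ∀ k, V.label (f k) = U.label k) : U = V := by
  obtain ⟨n, a⟩ := U
  obtain ⟨m, b⟩ := V
  have e : n = m := by simpa using Fintype.card_congr (Equiv.ofBijective f ⟨hf.injective, hs⟩)
  subst e
  have : f = id := by
    have := Subsingleton.elim (StrictMono.orderIsoOfSurjective f hf hs) (OrderIso.refl _)
    funext k
    exact congrArg (fun g : Fin n ≃o Fin n => g k) this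
  subst this
  congr
  funext k
  exact (hl k).symm

end Word

/-- A cell over `V` of the track object of `P`: every point of `P` is unstarted, terminated, or is
one of the events of `V`, and all predecessors of points that are not unstarted are terminated. -/
structure TrackCell (P : Iposet α) (V : Word α) where
  emb : Fin V.length → P.carrier
  unstarted : Set P.carrier
  terminated : Set P.carrier
  label_emb : ∀ k, P.label (emb k) = V.label k
  evord_emb : ∀ k l, k < l → P.evord (emb k) (emb l)
  disjoint : ∀ x ∈ unstarted, x ∉ terminated
  union_iff : ∀ x, (x ∈ unstarted ∨ x ∈ terminated) ↔ ∀ k, emb k ≠ x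
  prec_closed : ∀ x y, P.prec x y → x ∈ terminated ∨ y ∈ unstarted

namespace TrackCell

variable {P : Iposet α} {U V W : Word α}

theorem emb_lt_iff (c : TrackCell P V) {k l : Fin V.length} :
    P.evord (c.emb k) (c.emb l) ↔ k < l := by
  refine ⟨fun h => ?_, c.evord_emb k l⟩
  rcases lt_trichotomy k l with e | rfl | e
  · exact e
  · exact absurd h (P.evord_irrefl _)
  · exact absurd h (P.evord_asymm (c.evord_emb _ _ e))

theorem emb_injective (c : TrackCell P V) : Function.Injective c.emb := by
  intro k l e
  rcases lt_trichotomy k l with h | h | h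
  · exact absurd (e ▸ c.evord_emb _ _ h) (P.evord_irrefl _)
  · exact h
  · exact absurd (e ▸ c.evord_emb _ _ h) (P.evord_irrefl _)

theorem emb_not_mem (c : TrackCell P V) (k : Fin V.length) :
    c.emb k ∉ c.unstarted ∧ c.emb k ∉ c.terminated := by
  have := (c.union_iff (c.emb k)).not
  push Not at this
  exact this.2 ⟨k, rfl⟩

theorem exists_emb (c : TrackCell P V) {x : P.carrier} (h1 : x ∉ c.unstarted)
    (h2 : x ∉ c.terminated) : ∃ k, c.emb k = x := by
  have := (c.union_iff x).not
  push Not at this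
  exact this.1 ⟨h1, h2⟩

theorem not_prec_emb (c : TrackCell P V) (k l : Fin V.length) : ¬ P.prec (c.emb k) (c.emb l) :=
  fun h => (c.prec_closed _ _ h).elim (c.emb_not_mem k).2 (c.emb_not_mem l).1

/-- The face of a cell along a coface map. -/
def face (d : U ⟶ V) (c : TrackCell P V) : TrackCell P U where
  emb k := c.emb (Word.Coface.emb d k)
  unstarted := c.emb '' Word.Coface.unstarted d ∪ c.unstarted
  terminated := c.emb '' Word.Coface.terminated d ∪ c.terminated
  label_emb k := (c.label_emb _).trans (Word.Coface.label_emb d k)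
  evord_emb k l h := c.evord_emb _ _ ((Word.Coface.emb d).strictMono h)
  disjoint := by
    rintro _ (⟨k, hk, rfl⟩ | hx) (⟨l, hl, e⟩ | hx')
    · obtain rfl := c.emb_injective e
      exact Set.disjoint_left.1 (Word.Coface.disjoint d) hk hl
    · exact (c.emb_not_mem k).2 hx'
    · exact (c.emb_not_mem l).1 (e ▸ hx)
    · exact c.disjoint _ hx hx'
  union_iff x := by
    constructor
    · rintro ((⟨k, hk, rfl⟩ | hx) | (⟨k, hk, rfl⟩ | hx)) l e
      · exact (Word.Coface.emb_mem d k).1 (.inl hk) _ (c.emb_injective e)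
      · exact (c.emb_not_mem _).1 (e ▸ hx)
      · exact (Word.Coface.emb_mem d k).1 (.inr hk) _ (c.emb_injective e)
      · exact (c.emb_not_mem _).2 (e ▸ hx)
    · intro h
      by_cases h1 : x ∈ c.unstarted
      · exact .inl (.inr h1)
      by_cases h2 : x ∈ c.terminated
      · exact .inr (.inr h2)
      obtain ⟨k, rfl⟩ := c.exists_emb h1 h2
      rcases (Word.Coface.emb_mem d k).2 fun l e => h l (congrArg c.emb e) with hk | hk
      · exact .inl (.inl ⟨k, hk, rfl⟩)
      · exact .inr (.inl ⟨k, hk, rfl⟩)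
  prec_closed x y h := (c.prec_closed x y h).imp .inr .inr

theorem ext_sets {c c' : TrackCell P V} (h1 : c.unstarted = c'.unstarted)
    (h2 : c.terminated = c'.terminated) (h3 : c.emb = c'.emb) : c = c' := by
  cases c
  cases c'
  simp_all

theorem face_face (d : U ⟶ V) (e : V ⟶ W) (c : TrackCell P W) :
    (c.face e).face d = c.face (d ≫ e) := by
  refine ext_sets ?_ ?_ rfl
  · simp [face, Word.comp_unstarted, Set.image_union, Set.image_image, Set.union_assoc]
  · simp [face, Word.comp_terminated, Set.image_union, Set.image_image, Set.union_assoc]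

theorem face_id (c : TrackCell P V) : c.face (𝟙 V) = c := by
  refine ext_sets ?_ ?_ rfl
  · simp [face, Word.id_unstarted]
  · simp [face, Word.id_terminated]

/-- If `c'` has more unstarted and more terminated points than `c` then it is a face of `c`. -/
theorem exists_face (c : TrackCell P V) (c' : TrackCell P U) (h1 : c.unstarted ⊆ c'.unstarted)
    (h2 : c.terminated ⊆ c'.terminated) : ∃ d : U ⟶ V, c' = c.face d ∧
      (∀ k, c.emb (Word.Coface.emb d k) = c'.emb k) ∧
      (∀ k, k ∈ Word.Coface.unstarted d ↔ c.emb k ∈ c'.unstarted) ∧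
      (∀ k, k ∈ Word.Coface.terminated d ↔ c.emb k ∈ c'.terminated) := by
  -- A point outside the larger sets of `c'` is also outside those of `c`, so every event of `c'` is
  -- an event of `c`. The coface map records what became of the remaining events.
  have ex : ∀ k, ∃ l, c.emb l = c'.emb k := fun k =>
    c.exists_emb (fun h => (c'.emb_not_mem k).1 (h1 h)) fun h => (c'.emb_not_mem k).2 (h2 h)
  choose f hf using ex
  have hm : StrictMono f := fun k l h => by
    rw [← c.emb_lt_iff, hf, hf]
    exact c'.evord_emb _ _ h
  let d : Word.Coface U V :=
    { emb := OrderEmbedding.ofStrictMono f hm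
      unstarted := {k | c.emb k ∈ c'.unstarted}
      terminated := {k | c.emb k ∈ c'.terminated}
      label_emb := fun k => by
        have := c.label_emb (f k)
        rw [hf, c'.label_emb] at this
        exact this.symm
      disjoint := Set.disjoint_left.2 fun k => c'.disjoint _
      union_eq := by
        ext k
        simp only [Set.mem_union, Set.mem_ofPred_eq, Set.mem_compl_iff, Set.mem_range, not_exists,
          OrderEmbedding.coe_ofStrictMono]
        rw [c'.union_iff]
        refine forall_congr' fun l => not_congr ?_
        rw [← hf, c.emb_injective.eq_iff] }
  refine ⟨d, ?_, hf, fun k => Iff.rfl, fun k => Iff.rfl⟩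
  refine ext_sets ?_ ?_ (funext fun k => (hf k).symm)
  · ext x
    constructor
    · intro hx
      by_cases h3 : x ∈ c.unstarted
      · exact .inr h3
      · obtain ⟨k, rfl⟩ := c.exists_emb h3 fun h => c'.disjoint _ hx (h2 h)
        exact .inl ⟨k, hx, rfl⟩
    · rintro (⟨k, hk, rfl⟩ | hx)
      · exact hk
      · exact h1 hx
  · ext x
    constructor
    · intro hx
      by_cases h3 : x ∈ c.terminated
      · exact .inr h3
      · obtain ⟨k, rfl⟩ := c.exists_emb (fun h => c'.disjoint _ (h1 h) hx) h3
        exact .inl ⟨k, hx, rfl⟩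
    · rintro (⟨k, hk, rfl⟩ | hx)
      · exact hk
      · exact h2 hx

/-- A cell is determined by its sets of unstarted and terminated points. -/
theorem word_eq (c : TrackCell P V) (c' : TrackCell P U) (h1 : c.unstarted = c'.unstarted)
    (h2 : c.terminated = c'.terminated) : U = V := by
  obtain ⟨d, hd, he, hu, ht⟩ := c.exists_face c' h1.subset h2.subset
  refine Word.ext_of_strictMono _ (Word.Coface.emb d).strictMono (fun k => ?_)
    (Word.Coface.label_emb d)
  by_contra hk
  push Not at hk
  rcases (Word.Coface.emb_mem d k).2 hk with h | h
  · rw [hu, ← h1] at h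
    exact (c.emb_not_mem k).1 h
  · rw [ht, ← h2] at h
    exact (c.emb_not_mem k).2 h

theorem eq_of_sets {c c' : TrackCell P V} (h1 : c.unstarted = c'.unstarted)
    (h2 : c.terminated = c'.terminated) : c = c' := by
  obtain ⟨d, hd, he, hu, ht⟩ := c.exists_face c' h1.subset h2.subset
  have hs : Function.Surjective (Word.Coface.emb d) := by
    intro k
    by_contra hk
    push Not at hk
    rcases (Word.Coface.emb_mem d k).2 hk with h | h
    · rw [hu, ← h1] at h
      exact (c.emb_not_mem k).1 h
    · rw [ht, ← h2] at h
      exact (c.emb_not_mem k).2 h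
  have := Subsingleton.elim
    (StrictMono.orderIsoOfSurjective _ (Word.Coface.emb d).strictMono hs) (OrderIso.refl _)
  refine ext_sets h1 h2 (funext fun k => ?_)
  rw [← he k]
  exact (congrArg (fun g : Fin V.length ≃o Fin V.length => c.emb (g k)) this).symm

/-- Every admissible pair of sets of points defines a cell. -/
theorem exists_cell (P : Iposet α) (A B : Set P.carrier) (disj : ∀ x ∈ A, x ∉ B)
    (closed : ∀ x y, P.prec x y → x ∈ B ∨ y ∈ A) :
    ∃ (V : Word α) (c : TrackCell P V), c.unstarted = A ∧ c.terminated = B := by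
  classical
  have := P.finite
  let E := {x : P.carrier // x ∉ A ∧ x ∉ B}
  have inc : ∀ x y : E, ¬ P.prec x y := fun x y h => (closed _ _ h).elim x.2.2 y.2.1
  let _ : Fintype E := Fintype.ofFinite E
  -- By `closed` no two of the remaining points are related by precedence, so the event order is
  -- total on them and its enumeration is the word of the cell.
  have sto : IsStrictTotalOrder E fun x y => P.evord x y :=
    { trichotomous := fun x y h1 h2 => by
        rcases P.comparable x y with h | h | h | h | h
        · exact Subtype.ext h
        · exact absurd h (inc _ _)
        · exact absurd h (inc _ _)
        · exact absurd h h1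
        · exact absurd h h2
      irrefl := fun x => P.evord_irrefl x
      trans := fun x y z => P.evord_trans x y z }
  let _ : LinearOrder E := linearOrderOfSTO fun x y => P.evord x y
  let f : Fin (Fintype.card E) ≃o E := Fintype.orderIsoFinOfCardEq E rfl
  refine ⟨⟨Fintype.card E, fun k => P.label (f k)⟩, ⟨fun k => f k, A, B, fun k => rfl,
    fun k l h => ?_, disj, fun x => ?_, closed⟩, rfl, rfl⟩
  · exact (f.lt_iff_lt.2 h : f k < f l)
  · constructor
    · rintro h k rfl
      exact h.elim (f k).2.1 (f k).2.2
    · intro h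
      by_contra hx
      push Not at hx
      exact h (f.symm ⟨x, hx⟩) (by simp)

/-- The cell of the start of `P`. -/
def IsSrc (c : TrackCell P V) : Prop := (∀ x, x ∈ c.unstarted ↔ x ∉ P.src) ∧ c.terminated = ∅

/-- The cell of the end of `P`. -/
def IsTgt (c : TrackCell P V) : Prop := (∀ x, x ∈ c.terminated ↔ x ∉ P.tgt) ∧ c.unstarted = ∅

theorem exists_isSrc (P : Iposet α) : ∃ (V : Word α) (c : TrackCell P V), c.IsSrc := by
  obtain ⟨V, c, h1, h2⟩ := exists_cell P P.srcᶜ ∅ (by simp) fun x y h => .inr fun hy =>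
    P.src_minimal _ hy _ h
  exact ⟨V, c, by simp [h1], h2⟩

theorem exists_isTgt (P : Iposet α) : ∃ (V : Word α) (c : TrackCell P V), c.IsTgt := by
  obtain ⟨V, c, h1, h2⟩ := exists_cell P ∅ P.tgtᶜ (by simp) fun x y h => .inl fun hy =>
    P.tgt_maximal _ hy _ h
  exact ⟨V, c, by simp [h2], h1⟩

theorem IsSrc.word_eq {c : TrackCell P V} {c' : TrackCell P U} (h : c.IsSrc) (h' : c'.IsSrc) :
    U = V :=
  c.word_eq c' (Set.ext fun x => (h.1 x).trans (h'.1 x).symm) (h.2.trans h'.2.symm)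

theorem IsTgt.word_eq {c : TrackCell P V} {c' : TrackCell P U} (h : c.IsTgt) (h' : c'.IsTgt) :
    U = V :=
  c.word_eq c' (h.2.trans h'.2.symm) (Set.ext fun x => (h.1 x).trans (h'.1 x).symm)

theorem IsSrc.eq {c c' : TrackCell P V} (h : c.IsSrc) (h' : c'.IsSrc) : c = c' :=
  eq_of_sets (Set.ext fun x => (h.1 x).trans (h'.1 x).symm) (h.2.trans h'.2.symm)

theorem IsTgt.eq {c c' : TrackCell P V} (h : c.IsTgt) (h' : c'.IsTgt) : c = c' :=
  eq_of_sets (h.2.trans h'.2.symm) (Set.ext fun x => (h.1 x).trans (h'.1 x).symm)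

theorem IsTgt.emb_mem {c : TrackCell P V} (h : c.IsTgt) (k) : c.emb k ∈ P.tgt := by
  by_contra hk
  exact (c.emb_not_mem k).2 ((h.1 _).2 hk)

theorem IsTgt.exists_emb {c : TrackCell P V} (h : c.IsTgt) {x} (hx : x ∈ P.tgt) :
    ∃ k, c.emb k = x :=
  c.exists_emb (by simp [h.2]) fun hk => (h.1 _).1 hk hx

theorem IsSrc.emb_mem {c : TrackCell P V} (h : c.IsSrc) (k) : c.emb k ∈ P.src := by
  by_contra hk
  exact (c.emb_not_mem k).1 ((h.1 _).2 hk)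

theorem IsSrc.exists_emb {c : TrackCell P V} (h : c.IsSrc) {x} (hx : x ∈ P.src) :
    ∃ k, c.emb k = x :=
  c.exists_emb (fun hk => (h.1 _).1 hk hx) (by simp [h.2])

/-- Cells of the track object of a discrete iposet are coface maps. -/
def ofCoface (S T : Set (Fin V.length)) (d : U ⟶ V) : TrackCell (V.ilo S T) U where
  emb := Word.Coface.emb d
  unstarted := Word.Coface.unstarted d
  terminated := Word.Coface.terminated d
  label_emb := Word.Coface.label_emb d
  evord_emb _ _ h := (Word.Coface.emb d).strictMono h
  disjoint _ := fun h => Set.disjoint_left.1 (Word.Coface.disjoint d) h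
  union_iff := Word.Coface.emb_mem d
  prec_closed _ _ h := h.elim

theorem ofCoface_comp {S T : Set (Fin V.length)} (e : W ⟶ U) (d : U ⟶ V) :
    (ofCoface S T d).face e = ofCoface S T (e ≫ d) := rfl

/-- The cell of `𝟙 V` has nothing unstarted and nothing terminated, so every cell is a face of it.
Together with `ofCoface_injective`, this identifies the track object of a discrete iposet with a
representable presheaf. -/
theorem exists_ofCoface {S T : Set (Fin V.length)} (c : TrackCell (V.ilo S T) U) :
    ∃ d : U ⟶ V, ofCoface S T d = c := by
  obtain ⟨d, h, -⟩ := (ofCoface S T (𝟙 V)).exists_face c (Set.empty_subset _) (Set.empty_subset _)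
  exact ⟨d, by rw [h, ofCoface_comp, Category.comp_id]⟩

theorem ofCoface_injective {S T : Set (Fin V.length)} :
    Function.Injective (ofCoface S T : (U ⟶ V) → _) := by
  intro d e h
  apply Word.Coface.ext
  · exact RelEmbedding.ext fun k => congrFun (congrArg emb h) k
  · exact congrArg unstarted h
  · exact congrArg terminated h

/-- Pull back a cell along an injection whose image contains all its events. -/
theorem exists_restrict {Q : Iposet α} (c : TrackCell P U) (i : Q.carrier → P.carrier)
    (inj : Function.Injective i) (lab : ∀ a, P.label (i a) = Q.label a)
    (prec : ∀ {a b}, Q.prec a b → P.prec (i a) (i b))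
    (evord : ∀ {a b}, Q.evord a b → ¬ Q.prec a b → ¬ Q.prec b a → P.evord (i a) (i b))
    (range : ∀ k, ∃ a, i a = c.emb k) :
    ∃ c' : TrackCell Q U, (∀ k, i (c'.emb k) = c.emb k) ∧ c'.unstarted = i ⁻¹' c.unstarted ∧
      c'.terminated = i ⁻¹' c.terminated := by
  choose g hg using range
  refine ⟨⟨g, i ⁻¹' c.unstarted, i ⁻¹' c.terminated, fun k => ?_, fun k l h => ?_,
    fun x => c.disjoint _, fun x => ?_, fun x y h => c.prec_closed _ _ (prec h)⟩, hg, rfl, rfl⟩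
  · rw [← lab, hg, c.label_emb]
  · have h1 : ∀ k l, ¬ Q.prec (g k) (g l) := fun k l h => by
      have := prec h
      rw [hg, hg] at this
      exact c.not_prec_emb _ _ this
    refine Iposet.evord_of_evord_map evord ?_ (h1 _ _) (h1 _ _)
    rw [hg, hg]
    exact c.evord_emb _ _ h
  · refine (c.union_iff (i x)).trans (forall_congr' fun k => not_congr ?_)
    rw [← hg, inj.eq_iff]

/-- Push a cell forward along the inclusion of an initial part; the points outside of it are
unstarted. -/
def extend {Q : Iposet α} (c : TrackCell P U) (i : P.carrier → Q.carrier)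
    (inj : Function.Injective i) (lab : ∀ a, Q.label (i a) = P.label a)
    (prec : ∀ {a b}, Q.prec (i a) (i b) → P.prec a b)
    (initial : ∀ {x b}, Q.prec x (i b) → ∃ a, i a = x)
    (evord : ∀ {a b}, P.evord a b → ¬ P.prec a b → ¬ P.prec b a → Q.evord (i a) (i b)) :
    TrackCell Q U where
  emb k := i (c.emb k)
  unstarted := {x | ∀ a, i a = x → a ∈ c.unstarted}
  terminated := i '' c.terminated
  label_emb k := (lab _).trans (c.label_emb k)
  evord_emb k l h := evord (c.evord_emb k l h) (c.not_prec_emb _ _) (c.not_prec_emb _ _)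
  disjoint := by
    rintro _ h ⟨a, ha, rfl⟩
    exact c.disjoint _ (h a rfl) ha
  union_iff x := by
    constructor
    · rintro (h | ⟨a, ha, rfl⟩) k e
      · exact (c.emb_not_mem k).1 (h _ e)
      · exact (c.emb_not_mem k).2 (inj e ▸ ha)
    · intro h
      by_cases hx : ∃ a, i a = x
      · obtain ⟨a, rfl⟩ := hx
        rcases (c.union_iff a).2 fun k e => h k (congrArg i e) with ha | ha
        · exact .inl fun b e => inj e ▸ ha
        · exact .inr ⟨a, ha, rfl⟩
      · exact .inl fun a e => absurd ⟨a, e⟩ hx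
  prec_closed x y h := by
    by_cases hy : ∃ b, i b = y
    · obtain ⟨b, rfl⟩ := hy
      obtain ⟨a, rfl⟩ := initial h
      rcases c.prec_closed _ _ (prec h) with h | h
      · exact .inl ⟨a, h, rfl⟩
      · exact .inr fun b' e => inj e ▸ h
    · exact .inr fun b e => absurd ⟨b, e⟩ hy

end TrackCell

/-! ### Interfaces as words, and when ipomsets compose. -/

section

open Word (Coface)

/-- The discrete ipomset of an up-step along `d`. -/
def starter {U V : Word α} (d : U ⟶ V) : Iposet α := V.ilo (Coface.unstarted d)ᶜ Set.univ

/-- The discrete ipomset of a down-step along `d`. -/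
def terminator {U V : Word α} (d : U ⟶ V) : Iposet α := V.ilo Set.univ (Coface.terminated d)ᶜ

namespace TrackCell

variable {P Q R : Iposet α} {U V W : Word α}

theorem isSrc_starter (d : U ⟶ V) (hd : Coface.terminated d = ∅) :
    (ofCoface (Coface.unstarted d)ᶜ Set.univ d).IsSrc :=
  ⟨fun _ => not_not.symm, hd⟩

theorem isTgt_starter (d : U ⟶ V) :
    (ofCoface (Coface.unstarted d)ᶜ Set.univ (𝟙 V)).IsTgt :=
  ⟨fun _ => ⟨False.elim, fun h => h trivial⟩, rfl⟩

theorem isSrc_terminator (d : U ⟶ V) :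
    (ofCoface Set.univ (Coface.terminated d)ᶜ (𝟙 V)).IsSrc :=
  ⟨fun _ => ⟨False.elim, fun h => h trivial⟩, rfl⟩

theorem isTgt_terminator (d : U ⟶ V) (hd : Coface.unstarted d = ∅) :
    (ofCoface Set.univ (Coface.terminated d)ᶜ d).IsTgt :=
  ⟨fun _ => not_not.symm, hd⟩

theorem isSrc_id (V : Word α) : (ofCoface Set.univ Set.univ (𝟙 V)).IsSrc :=
  ⟨fun _ => ⟨False.elim, fun h => h trivial⟩, rfl⟩

theorem isTgt_id (V : Word α) : (ofCoface Set.univ Set.univ (𝟙 V)).IsTgt :=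
  ⟨fun _ => ⟨False.elim, fun h => h trivial⟩, rfl⟩

end TrackCell

namespace Iposet.IsGluing

open TrackCell

variable {P Q R : Iposet α} {U V W : Word α} {i : P.carrier → R.carrier}
  {j : Q.carrier → R.carrier}

theorem restrict_left (h : IsGluing P Q R i j) (c : TrackCell R U)
    (range : ∀ k, ∃ a, i a = c.emb k) :
    ∃ c' : TrackCell P U, (∀ k, i (c'.emb k) = c.emb k) ∧ c'.unstarted = i ⁻¹' c.unstarted ∧
      c'.terminated = i ⁻¹' c.terminated :=
  c.exists_restrict i h.inj_left h.label_left h.prec_left.2 h.evord_left range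

theorem restrict_right (h : IsGluing P Q R i j) (c : TrackCell R U)
    (range : ∀ k, ∃ a, j a = c.emb k) :
    ∃ c' : TrackCell Q U, (∀ k, j (c'.emb k) = c.emb k) ∧ c'.unstarted = j ⁻¹' c.unstarted ∧
      c'.terminated = j ⁻¹' c.terminated :=
  c.exists_restrict j h.inj_right h.label_right h.prec_right.2 h.evord_right range

theorem exists_isSrc (h : IsGluing P Q R i j) {c : TrackCell P U} (hc : c.IsSrc) :
    ∃ c' : TrackCell R U, c'.IsSrc ∧ ∀ k, c'.emb k = i (c.emb k) := by
  obtain ⟨V, c', hc'⟩ := TrackCell.exists_isSrc R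
  obtain ⟨c'', h1, h2, h3⟩ := h.restrict_left c' fun k =>
    ((h.src_iff _).1 (hc'.emb_mem k)).imp fun _ => And.right
  have : c''.IsSrc := by
    refine ⟨fun x => ?_, by rw [h3, hc'.2]; rfl⟩
    rw [h2, Set.mem_preimage, hc'.1, h.src_iff]
    exact not_congr ⟨fun ⟨p, hp, e⟩ => h.inj_left e ▸ hp, fun hx => ⟨x, hx, rfl⟩⟩
  obtain rfl := this.word_eq hc
  obtain rfl := this.eq hc
  exact ⟨c', hc', fun k => (h1 k).symm⟩

theorem exists_isTgt (h : IsGluing P Q R i j) {c : TrackCell Q U} (hc : c.IsTgt) :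
    ∃ c' : TrackCell R U, c'.IsTgt ∧ ∀ k, c'.emb k = j (c.emb k) := by
  obtain ⟨V, c', hc'⟩ := TrackCell.exists_isTgt R
  obtain ⟨c'', h1, h2, h3⟩ := h.restrict_right c' fun k =>
    ((h.tgt_iff _).1 (hc'.emb_mem k)).imp fun _ => And.right
  have : c''.IsTgt := by
    refine ⟨fun x => ?_, by rw [h2, hc'.2]; rfl⟩
    rw [h3, Set.mem_preimage, hc'.1, h.tgt_iff]
    exact not_congr ⟨fun ⟨p, hp, e⟩ => h.inj_right e ▸ hp, fun hx => ⟨x, hx, rfl⟩⟩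
  obtain rfl := this.word_eq hc
  obtain rfl := this.eq hc
  exact ⟨c', hc', fun k => (h1 k).symm⟩

/-- In a gluing, the words of the two identified interfaces agree. -/
theorem exists_middle (h : IsGluing P Q R i j) : ∃ (V : Word α) (t : TrackCell P V)
    (s : TrackCell Q V), t.IsTgt ∧ s.IsSrc ∧ ∀ k, i (t.emb k) = j (s.emb k) := by
  -- The middle configuration: what is not in P is unstarted and what is not in Q is terminated, so
  -- its events are exactly the identified points.
  obtain ⟨V, m, hu, ht⟩ := exists_cell R {x | ∀ p, i p ≠ x} {x | ∀ q, j q ≠ x}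
    (fun x h1 h2 => (h.cover x).elim (fun ⟨p, e⟩ => h1 p e) fun ⟨q, e⟩ => h2 q e)
    (fun x y hxy => by
      by_contra hx
      push Not at hx
      simp only [Set.mem_ofPred_eq, not_forall, not_not] at hx
      obtain ⟨⟨q, rfl⟩, p, rfl⟩ := hx
      exact h.not_prec _ _ hxy)
  have h1 : ∀ k, ∃ p, i p = m.emb k := fun k => by
    have := (m.emb_not_mem k).1
    rw [hu] at this
    simpa using this
  have h2 : ∀ k, ∃ p, j p = m.emb k := fun k => by
    have := (m.emb_not_mem k).2
    rw [ht] at this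
    simpa using this
  obtain ⟨t, t1, t2, t3⟩ := h.restrict_left m h1
  obtain ⟨s, s1, s2, s3⟩ := h.restrict_right m h2
  refine ⟨V, t, s, ⟨fun x => ?_, ?_⟩, ⟨fun x => ?_, ?_⟩, fun k => by rw [t1, s1]⟩
  · rw [t3, Set.mem_preimage, ht, Set.mem_ofPred_eq, ← not_exists]
    exact not_congr ⟨fun ⟨q, e⟩ => (h.overlap e.symm).1, fun hx => h.of_tgt x hx⟩
  · rw [t2, hu]
    ext x
    simp
  · rw [s2, Set.mem_preimage, hu, Set.mem_ofPred_eq, ← not_exists]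
    exact not_congr ⟨fun ⟨q, e⟩ => (h.overlap e).2, fun hx => h.of_src x hx⟩
  · rw [s3, ht]
    ext x
    simp

theorem middle_word (h : IsGluing P Q R i j) {t : TrackCell P V} (ht : t.IsTgt)
    {s : TrackCell Q U} (hs : s.IsSrc) : U = V := by
  obtain ⟨W, t', s', ht', hs', _⟩ := h.exists_middle
  exact (hs'.word_eq hs).trans (ht'.word_eq ht).symm

/-- By rigidity of words the identification is forced: the k-th event of one interface is glued to
the k-th event of the other. -/
theorem middle_eq (h : IsGluing P Q R i j) {t : TrackCell P V} (ht : t.IsTgt)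
    {s : TrackCell Q V} (hs : s.IsSrc) (k) : i (t.emb k) = j (s.emb k) := by
  obtain ⟨W, t', s', ht', hs', e⟩ := h.exists_middle
  obtain rfl := ht.word_eq ht'
  obtain rfl := ht.eq ht'
  obtain rfl := hs.eq hs'
  exact e k

end Iposet.IsGluing

/-- Iposets whose interfaces have the same word can be glued. -/
theorem TrackCell.exists_isGluing {P Q : Iposet α} {V : Word α} {t : TrackCell P V}
    (ht : t.IsTgt) {s : TrackCell Q V} (hs : s.IsSrc) : ∃ R i j, Iposet.IsGluing P Q R i j := by
  obtain ⟨f, -⟩ := Iposet.exists_match (P := P) (Q := Q)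
    (fun p q => ∃ k, t.emb k = p ∧ s.emb k = q)
    (by rintro _ _ ⟨k, rfl, rfl⟩; exact ⟨ht.emb_mem k, hs.emb_mem k⟩)
    (fun p hp => by obtain ⟨k, e⟩ := ht.exists_emb hp; exact ⟨_, k, e, rfl⟩)
    (fun p hp => by obtain ⟨k, e⟩ := hs.exists_emb hp; exact ⟨_, k, rfl, e⟩)
    (by rintro _ _ _ ⟨k, rfl, rfl⟩ ⟨l, rfl, e⟩; rw [s.emb_injective e])
    (by rintro _ _ _ ⟨k, rfl, rfl⟩ ⟨l, e, rfl⟩; rw [t.emb_injective e])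
    (by rintro _ _ ⟨k, rfl, rfl⟩; rw [t.label_emb, s.label_emb])
    (by
      rintro _ _ _ _ ⟨k, rfl, rfl⟩ ⟨l, rfl, rfl⟩ h
      rw [t.emb_lt_iff] at h
      exact s.evord_emb _ _ h)
  exact ⟨_, _, _, f.isGluing⟩

namespace Ipomset

/-- `P` has source interface `U` and target interface `V`. -/
def HasWords (P : Ipomset α) (U V : Word α) : Prop :=
  ∃ p, mk p = P ∧ (∃ s : TrackCell p U, s.IsSrc) ∧ ∃ t : TrackCell p V, t.IsTgt

theorem HasWords.of_mk {p : Iposet α} {U V : Word α} (h : (mk p).HasWords U V) :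
    (∃ s : TrackCell p U, s.IsSrc) ∧ ∃ t : TrackCell p V, t.IsTgt := by
  obtain ⟨q, hq, ⟨s, hs⟩, t, ht⟩ := h
  obtain ⟨f, hf, hf'⟩ := mk_eq.1 hq.symm
  constructor
  · obtain ⟨c, -, c2, c3⟩ := s.exists_restrict f f.injective hf.label_eq (fun {a b} => (hf' a b).1)
      (fun {a b} => hf.evord_of a b) fun k => f.surjective _
    refine ⟨c, fun x => ?_, by simp [c3, hs.2]⟩
    rw [c2, Set.mem_preimage, hs.1, hf.src_iff]
  · obtain ⟨c, -, c2, c3⟩ := t.exists_restrict f f.injective hf.label_eq (fun {a b} => (hf' a b).1)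
      (fun {a b} => hf.evord_of a b) fun k => f.surjective _
    refine ⟨c, fun x => ?_, by simp [c2, ht.2]⟩
    rw [c3, Set.mem_preimage, ht.1, hf.tgt_iff]

/-- With `HasWords.exists_isGlue`, this makes ipomsets compose like morphisms between words: two of
them can be glued precisely when their middle words are equal. -/
theorem IsGlue.hasWords {P Q R : Ipomset α} {U V V' W : Word α} (h : IsGlue P Q R)
    (hP : P.HasWords U V) (hQ : Q.HasWords V' W) : V' = V ∧ R.HasWords U W := by
  obtain ⟨P, rfl⟩ := exists_rep P
  obtain ⟨Q, rfl⟩ := exists_rep Q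
  obtain ⟨R, rfl⟩ := exists_rep R
  obtain ⟨i, j, h⟩ := isGlue_mk.1 h
  obtain ⟨⟨s, hs⟩, t, ht⟩ := hP.of_mk
  obtain ⟨⟨s', hs'⟩, t', ht'⟩ := hQ.of_mk
  obtain ⟨s'', hs'', -⟩ := h.exists_isSrc hs
  obtain ⟨t'', ht'', -⟩ := h.exists_isTgt ht'
  exact ⟨h.middle_word ht hs', R, rfl, ⟨s'', hs''⟩, t'', ht''⟩

theorem HasWords.exists_isGlue {P Q : Ipomset α} {U V W : Word α} (hP : P.HasWords U V)
    (hQ : Q.HasWords V W) : ∃ R, IsGlue P Q R := by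
  obtain ⟨P, rfl⟩ := exists_rep P
  obtain ⟨Q, rfl⟩ := exists_rep Q
  obtain ⟨⟨s, hs⟩, t, ht⟩ := hP.of_mk
  obtain ⟨⟨s', hs'⟩, t', ht'⟩ := hQ.of_mk
  obtain ⟨R, i, j, h⟩ := TrackCell.exists_isGluing ht hs'
  exact ⟨mk R, isGlue_mk.2 ⟨i, j, h⟩⟩

theorem hasWords_id (U : Word α) : (mk (U.ilo Set.univ Set.univ)).HasWords U U :=
  ⟨_, rfl, ⟨_, TrackCell.isSrc_id U⟩, _, TrackCell.isTgt_id U⟩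

theorem hasWords_starter {U V : Word α} (d : U ⟶ V) (hd : Coface.terminated d = ∅) :
    (mk (starter d)).HasWords U V :=
  ⟨_, rfl, ⟨_, TrackCell.isSrc_starter d hd⟩, _, TrackCell.isTgt_starter d⟩

theorem hasWords_terminator {U V : Word α} (d : U ⟶ V) (hd : Coface.unstarted d = ∅) :
    (mk (terminator d)).HasWords V U :=
  ⟨_, rfl, ⟨_, TrackCell.isSrc_terminator d⟩, _, TrackCell.isTgt_terminator d hd⟩

theorem HasWords.glue_id {P : Ipomset α} {U V : Word α} (hP : P.HasWords U V) :
    IsGlue P (mk (V.ilo Set.univ Set.univ)) P := by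
  obtain ⟨R, hR⟩ := hP.exists_isGlue (hasWords_id V)
  have := hR.eq_left
  rwa [← this] at hR

theorem HasWords.id_glue {P : Ipomset α} {U V : Word α} (hP : P.HasWords U V) :
    IsGlue (mk (U.ilo Set.univ Set.univ)) P P := by
  obtain ⟨R, hR⟩ := (hasWords_id U).exists_isGlue hP
  have := hR.eq_right
  rwa [← this] at hR

end Ipomset

/-! ### Automata whose edges are starters and terminators. -/

open Ipomset

/-- A finite automaton whose states have words of events and whose edges are labelled by starters
and terminators. -/
structure STGraph (α : Type u) where
  of ::
  node : Word α → Type v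
  finite : Finite (Σ U, node U)
  -- An edge may carry any coface map; `Reach` uses it only if nothing is terminated (up) or
  -- unstarted (down).
  up : ∀ {U V : Word α}, (U ⟶ V) → node U → node V → Prop
  down : ∀ {U V : Word α}, (U ⟶ V) → node V → node U → Prop
  start : Set (Σ U, node U)
  accept : Set (Σ U, node U)

namespace STGraph

variable (A : STGraph.{u, v} α)

/-- `A.Reach x y P` says that there is a path from `x` to `y` with ipomset `P`. -/
inductive Reach {U : Word α} (x : A.node U) : {V : Word α} → A.node V → Ipomset α → Prop
  | nil : Reach x x (mk (U.ilo Set.univ Set.univ))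
  | up {V W : Word α} (d : V ⟶ W) (hd : Coface.terminated d = ∅) {y : A.node V} {z : A.node W}
      {P R : Ipomset α} : Reach x y P → A.up d y z → IsGlue P (mk (starter d)) R → Reach x z R
  | down {V W : Word α} (d : V ⟶ W) (hd : Coface.unstarted d = ∅) {y : A.node W} {z : A.node V}
      {P R : Ipomset α} : Reach x y P → A.down d y z → IsGlue P (mk (terminator d)) R → Reach x z R

/-- The set of ipomsets of accepting paths. -/
def lang : Set (Ipomset α) :=
  {P | ∃ x ∈ A.start, ∃ y ∈ A.accept, A.Reach x.2 y.2 P}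

variable {A} {U V W : Word α} {x : A.node U} {y : A.node V} {z : A.node W}

theorem Reach.isInterval {P : Ipomset α} (h : A.Reach x y P) : P.IsInterval := by
  induction h with
  | nil => exact isInterval_ilo _ _ _
  | up d hd _ _ h ih => exact h.isInterval ih (isInterval_ilo _ _ _)
  | down d hd _ _ h ih => exact h.isInterval ih (isInterval_ilo _ _ _)

theorem Reach.hasWords {P : Ipomset α} (h : A.Reach x y P) : P.HasWords U V := by
  induction h with
  | nil => exact hasWords_id U
  | up d hd _ _ h ih => exact (h.hasWords ih (hasWords_starter d hd)).2
  | down d hd _ _ h ih => exact (h.hasWords ih (hasWords_terminator d hd)).2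

theorem Reach.trans {P Q R : Ipomset α} (h : A.Reach x y P) (k : A.Reach y z Q)
    (g : IsGlue P Q R) : A.Reach x z R := by
  induction k generalizing R with
  | nil => exact g.eq_left ▸ h
  | up d hd _ e h' ih =>
    obtain ⟨B, h1, h2⟩ := h'.assoc' g
    exact .up d hd (ih h1) e h2
  | down d hd _ e h' ih =>
    obtain ⟨B, h1, h2⟩ := h'.assoc' g
    exact .down d hd (ih h1) e h2

end STGraph

/-- The states and steps of an HDA. -/
def HDA.toSTGraph (X : HDA α) : STGraph.{u, 0} α where
  node U := X.presheaf.obj (Opposite.op U)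
  finite := X.finite
  up d x y := x = X.presheaf.map d.op y
  down d x y := y = X.presheaf.map d.op x
  start := X.start
  accept := X.accept

theorem HDA.reach_of_ev (X : HDA α) {x y : X.Cell} {p : X.Path x y} {P : Ipomset α}
    (h : HDA.Path.Ev X p P) : X.toSTGraph.Reach x.2 y.2 P := by
  induction h with
  | nil => exact .nil
  | up d hd x p _ h ih => exact .up d hd ih rfl h
  | down d hd x p _ h ih => exact .down d hd ih rfl h

theorem HDA.exists_ev (X : HDA α) {U V : Word α} {x : X.toSTGraph.node U} {y : X.toSTGraph.node V}
    {P : Ipomset α} (h : X.toSTGraph.Reach x y P) :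
    ∃ p : X.Path ⟨U, x⟩ ⟨V, y⟩, HDA.Path.Ev X p P := by
  induction h with
  | nil => exact ⟨_, .nil _⟩
  | up d hd _ e h ih =>
    obtain rfl := e
    obtain ⟨p, hp⟩ := ih
    exact ⟨_, .up d hd _ p hp h⟩
  | down d hd _ e h ih =>
    obtain rfl := e
    obtain ⟨p, hp⟩ := ih
    exact ⟨_, .down d hd _ p hp h⟩

theorem HDA.lang_toSTGraph (X : HDA α) : X.toSTGraph.lang = X.lang := by
  ext P
  constructor
  · rintro ⟨x, hx, y, hy, h⟩
    obtain ⟨p, hp⟩ := X.exists_ev h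
    exact ⟨x, hx, y, hy, p, hp⟩
  · rintro ⟨x, hx, y, hy, p, hp⟩
    exact ⟨x, hx, y, hy, X.reach_of_ev hp⟩

end

section

open Word (Coface)

/-! ### Decomposition of interval iposets into steps -/

namespace TrackCell

variable {P Q : Iposet α} {U V : Word α}

/-- Extension is a map of presheaves, so a family indexed by the cells of an iposet restricts to the
cells of an initial part. The induction in `STGraph.reach_of_track` rests on this. -/
theorem extend_face (c : TrackCell P V) (d : U ⟶ V) {i : P.carrier → Q.carrier}
    (inj : Function.Injective i) (lab : ∀ a, Q.label (i a) = P.label a)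
    (prec : ∀ {a b}, Q.prec (i a) (i b) → P.prec a b)
    (initial : ∀ {x b}, Q.prec x (i b) → ∃ a, i a = x)
    (evord : ∀ {a b}, P.evord a b → ¬ P.prec a b → ¬ P.prec b a → Q.evord (i a) (i b)) :
    (c.face d).extend i inj lab prec initial evord =
      (c.extend i inj lab prec initial evord).face d := by
  refine ext_sets ?_ ?_ rfl
  · ext x
    simp only [extend, face, Set.mem_union, Set.mem_ofPred_eq, Set.mem_image]
    constructor
    · intro h
      by_cases hx : ∃ a, i a = x
      · obtain ⟨a, rfl⟩ := hx
        rcases h a rfl with ⟨k, hk, rfl⟩ | ha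
        · exact .inl ⟨k, hk, rfl⟩
        · exact .inr fun b e => inj e ▸ ha
      · exact .inr fun a e => absurd ⟨a, e⟩ hx
    · rintro (⟨k, hk, rfl⟩ | h) a e
      · exact .inl ⟨k, hk, (inj e).symm⟩
      · exact .inr (h a e)
  · ext x
    simp only [extend, face, Set.mem_union, Set.mem_image]
    constructor
    · rintro ⟨a, ⟨k, hk, rfl⟩ | ha, rfl⟩
      · exact .inl ⟨k, hk, rfl⟩
      · exact .inr ⟨a, ha, rfl⟩
    · rintro (⟨k, hk, rfl⟩ | ⟨a, ha, rfl⟩)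
      · exact ⟨_, .inl ⟨k, hk, rfl⟩, rfl⟩
      · exact ⟨a, .inr ha, rfl⟩

theorem isSrc_extend {c : TrackCell P U} (hc : c.IsSrc) {i : P.carrier → Q.carrier}
    (inj : Function.Injective i) (lab : ∀ a, Q.label (i a) = P.label a)
    (prec : ∀ {a b}, Q.prec (i a) (i b) → P.prec a b)
    (initial : ∀ {x b}, Q.prec x (i b) → ∃ a, i a = x)
    (evord : ∀ {a b}, P.evord a b → ¬ P.prec a b → ¬ P.prec b a → Q.evord (i a) (i b))
    (src : ∀ x, x ∈ Q.src ↔ ∃ p ∈ P.src, i p = x) :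
    (c.extend i inj lab prec initial evord).IsSrc := by
  refine ⟨fun x => ?_, by simp [extend, hc.2]⟩
  simp only [extend, Set.mem_ofPred_eq, src, hc.1]
  push Not
  exact ⟨fun h a ha e => h a e ha, fun h a e ha => h a ha e⟩

end TrackCell

namespace Iposet

/-- The same iposet with all maximal points in the target interface. -/
def maximize (R : Iposet α) : Iposet α :=
  { R with
    tgt := {x | ∀ y, ¬ R.prec x y}
    tgt_maximal := fun _ h => h }

/-- Removal of a point. -/
def remove (R : Iposet α) (t : R.carrier) : Iposet α where
  carrier := {x : R.carrier // x ≠ t}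
  finite := have := R.finite; inferInstance
  prec x y := R.prec x y
  evord x y := R.evord x y
  src := {x | x.1 ∈ R.src}
  tgt := {x | x.1 ∈ R.tgt}
  label x := R.label x
  prec_irrefl x := R.prec_irrefl x
  prec_trans x y z := R.prec_trans x y z
  evord_irrefl x := R.evord_irrefl x
  evord_trans x y z := R.evord_trans x y z
  comparable x y := by simpa [Subtype.ext_iff] using R.comparable x y
  src_minimal x hx y := R.src_minimal x hx y
  tgt_maximal x hx y := R.tgt_maximal x hx y

/-- In an interval iposet with points outside of the target interface, which contains all maximal
points, some point of the target interface is preceded by all points outside of it. -/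
theorem IsInterval.exists_last {R : Iposet α} (h : R.IsInterval)
    (ht : ∀ x, (∀ y, ¬ R.prec x y) → x ∈ R.tgt) (hR : ¬ (R.src = Set.univ ∧ R.tgt = Set.univ)) :
    ∃ t ∈ R.tgt, t ∉ R.src ∧ ∀ x ∉ R.tgt, R.prec x t := by
  by_cases hu : R.tgt = Set.univ
  · have : R.src ≠ Set.univ := fun h => hR ⟨h, hu⟩
    obtain ⟨t, ht⟩ := (Set.ne_univ_iff_exists_notMem _).1 this
    exact ⟨t, by simp [hu], ht, by simp [hu]⟩
  · obtain ⟨x, hx⟩ := (Set.ne_univ_iff_exists_notMem _).1 hu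
    obtain ⟨b, e, hbe, hp⟩ := h
    have := R.finite
    have : Nonempty R.carrier := ⟨x⟩
    -- Take the point whose interval begins last. It is maximal, and a point outside the target has
    -- a successor, so it ends before that successor begins and therefore before `t` begins.
    obtain ⟨t, htm⟩ := Finite.exists_max b
    have h1 : ∀ y, ¬ R.prec t y := fun y k => by
      rw [hp] at k
      linarith [htm y, hbe t]
    have h2 : ∀ x ∉ R.tgt, R.prec x t := fun x hx => by
      have := mt (ht x) hx
      push Not at this
      obtain ⟨y, k⟩ := this
      rw [hp] at k ⊢
      linarith [htm y]
    exact ⟨t, ht t h1, fun hs => R.src_minimal _ hs _ (h2 x hx), h2⟩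

end Iposet

open Iposet TrackCell Ipomset

/-- A family of nodes indexed by the cells of the track object of an interval iposet, with edges
along all lower and upper faces, yields a path. -/
theorem STGraph.reach_of_track {A : STGraph.{u, v} α} {R : Iposet α} (hR : R.IsInterval)
    (σ : ∀ {V : Word α}, TrackCell R V → A.node V)
    (hup : ∀ {U V : Word α} (d : U ⟶ V) (c : TrackCell R V), Coface.terminated d = ∅ →
      A.up d (σ (c.face d)) (σ c))
    (hdown : ∀ {U V : Word α} (d : U ⟶ V) (c : TrackCell R V), Coface.unstarted d = ∅ →
      A.down d (σ c) (σ (c.face d)))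
    {U V : Word α} {s : TrackCell R U} (hs : s.IsSrc) {t : TrackCell R V} (ht : t.IsTgt) :
    A.Reach (σ s) (σ t) (mk R) := by
  have := R.finite
  -- The last step is split off. Undoing a start lowers the number of points; undoing terminations
  -- keeps the points but lowers the number of those outside the target.
  induction hn : Nat.card R.carrier + R.tgtᶜ.ncard using Nat.strong_induction_on
    generalizing R V with
  | _ n ih =>
  by_cases hmax : ∀ x, (∀ y, ¬ R.prec x y) → x ∈ R.tgt
  · by_cases hu : R.src = Set.univ ∧ R.tgt = Set.univ
    · have s1 : s.unstarted = ∅ := Set.ext fun x => by simp [hs.1, hu.1]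
      have t1 : t.terminated = ∅ := Set.ext fun x => by simp [ht.1, hu.2]
      obtain rfl := s.word_eq t (s1.trans ht.2.symm) (hs.2.trans t1.symm)
      obtain rfl := eq_of_sets (s1.trans ht.2.symm) (hs.2.trans t1.symm)
      have : mk R = mk (V.ilo Set.univ Set.univ) := by
        refine (mk_eq.2 ⟨Equiv.ofBijective s.emb ⟨s.emb_injective, fun x =>
          s.exists_emb (by simp [s1]) (by simp [t1])⟩, ⟨fun x => ?_, fun x => ?_, s.label_emb,
          fun x y h => absurd h (s.not_prec_emb _ _), fun x y h _ _ => s.evord_emb _ _ h⟩,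
          fun x y => iff_of_false id (s.not_prec_emb _ _)⟩).symm
        · exact iff_of_true trivial (by simp [hu.1])
        · exact iff_of_true trivial (by simp [hu.2])
      rw [this]
      exact .nil
    -- All maximal points are still running, so the last step starts the single event `t₀`.
    · obtain ⟨t₀, h1, h2, h3⟩ := hR.exists_last hmax hu
      let R' := R.remove t₀
      let i : R'.carrier → R.carrier := Subtype.val
      have inj : Function.Injective i := Subtype.val_injective
      have lab : ∀ a, R.label (i a) = R'.label a := fun _ => rfl
      have prec : ∀ {a b}, R.prec (i a) (i b) → R'.prec a b := id
      have ini : ∀ {x b}, R.prec x (i b) → ∃ a, i a = x := fun {x b} h =>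
        ⟨⟨x, fun e => R.tgt_maximal _ (e ▸ h1) _ h⟩, rfl⟩
      have evo : ∀ {a b}, R'.evord a b → ¬ R'.prec a b → ¬ R'.prec b a → R.evord (i a) (i b) :=
        fun h _ _ => h
      have src : ∀ x, x ∈ R.src ↔ ∃ p ∈ R'.src, i p = x := fun x =>
        ⟨fun hx => ⟨⟨x, fun e => h2 (e ▸ hx)⟩, hx, rfl⟩, by rintro ⟨p, hp, rfl⟩; exact hp⟩
      obtain ⟨U', s', hs'⟩ := TrackCell.exists_isSrc R'
      obtain ⟨V', t', ht'⟩ := TrackCell.exists_isTgt R'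
      have hs'' := isSrc_extend hs' inj lab prec ini evo src
      obtain rfl := hs.word_eq hs''
      obtain rfl := hs.eq hs''
      -- The configuration just before the last step: only `t₀` is unstarted, so it is a lower face
      -- of the end cell.
      let e := t'.extend i inj lab prec ini evo
      have eu : ∀ x, x ∈ e.unstarted ↔ x = t₀ := fun x => by
        simp only [e, extend, ht'.2, Set.mem_ofPred_eq, Set.mem_empty_iff_false]
        exact ⟨fun h => by_contra fun hx => h ⟨x, hx⟩ rfl, by rintro rfl a h; exact a.2 h⟩
      have et : e.terminated = t.terminated := Set.ext fun x => by
        simp only [e, extend, Set.mem_image, ht.1, ht'.1]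
        constructor
        · rintro ⟨a, ha, rfl⟩
          exact ha
        · intro hx
          exact ⟨⟨x, fun h => hx (h ▸ h1)⟩, hx, rfl⟩
      obtain ⟨d, hd, -, hdu, hdt⟩ := t.exists_face e (by simp [ht.2]) et.symm.subset
      have hd0 : Coface.terminated d = ∅ := Set.ext fun k => by
        rw [hdt, et]
        exact iff_of_false (t.emb_not_mem k).2 id
      have ku : ∀ k, k ∈ Coface.unstarted d ↔ t.emb k = t₀ := fun k => (hdu k).trans (eu _)
      have G : IsGluing R' (starter d) R i t.emb :=
        { inj_left := inj
          inj_right := t.emb_injective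
          cover := fun r => by
            by_cases hr : r = t₀
            · exact .inr (ht.exists_emb (hr ▸ h1))
            · exact .inl ⟨⟨r, hr⟩, rfl⟩
          overlap := fun {p k} h => ⟨show p.1 ∈ R.tgt by
              rw [show p.1 = t.emb k from h]; exact ht.emb_mem k,
            fun hk => p.2 (by rw [show p.1 = t.emb k from h]; exact (ku k).1 hk)⟩
          of_tgt := fun p hp => ht.exists_emb hp
          of_src := fun k hk => ⟨⟨t.emb k, fun h => hk ((ku k).2 h)⟩, rfl⟩
          label_left := lab
          label_right := t.label_emb
          src_iff := src
          tgt_iff := fun r => ⟨fun hr => (ht.exists_emb hr).imp fun k e => ⟨trivial, e⟩, by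
            rintro ⟨k, -, rfl⟩; exact ht.emb_mem k⟩
          prec_left := Iff.rfl
          prec_right := iff_of_false (t.not_prec_emb _ _) id
          -- Here the interval property is decisive: every point already terminated must precede the
          -- newly started event, which is what `exists_last` provides.
          prec_cross := fun {p k} hp hk => by
            rw [(ku k).1 (not_not.1 hk)]
            exact h3 _ hp
          evord_left := evo
          evord_right := fun h _ _ => t.evord_emb _ _ h }
      have hR' : R'.IsInterval := by
        obtain ⟨b, e, h1, h2⟩ := hR
        exact ⟨fun x => b x.1, fun x => e x.1, fun x => h1 _, fun x y => h2 _ _⟩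
      have hlt : Nat.card R'.carrier + R'.tgtᶜ.ncard < n := by
        rw [← hn]
        have e1 : Nat.card R'.carrier < Nat.card R.carrier :=
          Finite.card_subtype_lt (p := fun x => x ≠ t₀) (x := t₀) (by simp)
        have e2 : R'.tgtᶜ.ncard ≤ R.tgtᶜ.ncard :=
          Set.ncard_le_ncard_of_injOn i (fun x hx => hx) inj.injOn
        omega
      have key := ih _ hlt hR' (fun c => σ (c.extend i inj lab prec ini evo))
        (fun d c hd => by
          rw [extend_face]
          exact hup d _ hd)
        (fun d c hd => by
          rw [extend_face]
          exact hdown d _ hd) hs' ht' R'.finite rfl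
      refine .up d hd0 key ?_ (isGlue_mk.2 ⟨_, _, G⟩)
      change A.up d (σ e) (σ t)
      rw [hd]
      exact hup d t hd0
  -- Some maximal point is no longer running, so the last step terminates all maximal points outside
  -- the target at once. Before it, the running events are all the maximal points, and the end cell
  -- is an upper face of that configuration.
  · push Not at hmax
    obtain ⟨m, hm, hmt⟩ := hmax
    let R' := R.maximize
    let i : R'.carrier → R.carrier := id
    have inj : Function.Injective i := Function.injective_id
    have lab : ∀ a, R.label (i a) = R'.label a := fun _ => rfl
    have prec : ∀ {a b}, R.prec (i a) (i b) → R'.prec a b := id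
    have ini : ∀ {x b}, R.prec x (i b) → ∃ a, i a = x := fun {x b} h => ⟨x, rfl⟩
    have evo : ∀ {a b}, R'.evord a b → ¬ R'.prec a b → ¬ R'.prec b a → R.evord (i a) (i b) :=
      fun h _ _ => h
    have src : ∀ x, x ∈ R.src ↔ ∃ p ∈ R'.src, i p = x := fun x =>
      ⟨fun hx => ⟨x, hx, rfl⟩, by rintro ⟨p, hp, rfl⟩; exact hp⟩
    have tm : ∀ x ∈ R.tgt, x ∈ R'.tgt := R.tgt_maximal
    obtain ⟨U', s', hs'⟩ := TrackCell.exists_isSrc R'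
    obtain ⟨V', t', ht'⟩ := TrackCell.exists_isTgt R'
    have hs'' := isSrc_extend hs' inj lab prec ini evo src
    obtain rfl := hs.word_eq hs''
    obtain rfl := hs.eq hs''
    let e := t'.extend i inj lab prec ini evo
    have eu : e.unstarted = ∅ := Set.ext fun x => by
      simp only [e, extend, ht'.2, Set.mem_ofPred_eq, Set.mem_empty_iff_false, iff_false]
      exact fun h => h x rfl
    have et : ∀ x, x ∈ e.terminated ↔ x ∉ R'.tgt := fun x => by
      simp only [e, extend, Set.mem_image, ht'.1]
      exact ⟨by rintro ⟨a, ha, rfl⟩; exact ha, fun hx => ⟨x, hx, rfl⟩⟩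
    obtain ⟨d, hd, -, hdu, hdt⟩ := e.exists_face t (by simp [eu])
      fun x hx => (ht.1 x).2 fun h => (et x).1 hx (tm x h)
    have hd0 : Coface.unstarted d = ∅ := Set.ext fun k => by
      rw [hdu, ht.2]
      exact Iff.rfl
    have kt : ∀ k, k ∈ Coface.terminated d ↔ t'.emb k ∉ R.tgt := fun k => (hdt k).trans (ht.1 _)
    have G : IsGluing R' (terminator d) R i t'.emb :=
      { inj_left := inj
        inj_right := t'.emb_injective
        cover := fun r => .inl ⟨r, rfl⟩
        overlap := fun {p k} h => ⟨by
          rw [show p = t'.emb k from h]; exact ht'.emb_mem k, trivial⟩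
        of_tgt := fun p hp => ht'.exists_emb hp
        of_src := fun k _ => ⟨t'.emb k, rfl⟩
        label_left := lab
        label_right := t'.label_emb
        src_iff := src
        tgt_iff := fun r => by
          constructor
          · intro hr
            obtain ⟨k, rfl⟩ := ht'.exists_emb (tm r hr)
            exact ⟨k, fun h => (kt k).1 h hr, rfl⟩
          · rintro ⟨k, hk, rfl⟩
            exact by_contra fun h => hk ((kt k).2 h)
        prec_left := Iff.rfl
        prec_right := iff_of_false (t'.not_prec_emb _ _) id
        prec_cross := fun _ hk => absurd trivial hk
        evord_left := evo
        evord_right := fun h _ _ => t'.evord_emb _ _ h }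
    have hlt : Nat.card R'.carrier + R'.tgtᶜ.ncard < n := by
      rw [← hn]
      have : R'.tgtᶜ.ncard < R.tgtᶜ.ncard :=
        Set.ncard_lt_ncard ⟨Set.compl_subset_compl.2 tm, fun h =>
          hmt (Set.compl_subset_compl.1 h hm)⟩ (have := R'.finite; Set.toFinite _)
      exact Nat.add_lt_add_left this _
    have key := ih _ hlt (R := R') hR (fun c => σ (c.extend i inj lab prec ini evo))
      (fun d c hd => by
        rw [extend_face]
        exact hup d _ hd)
      (fun d c hd => by
        rw [extend_face]
        exact hdown d _ hd) hs' ht' R'.finite rfl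
    refine .down d hd0 key ?_ (isGlue_mk.2 ⟨_, _, G⟩)
    change A.down d (σ e) (σ t)
    rw [hd]
    exact hdown d e hd0

end

section

open Word (Coface)

/-! ### Lax tracks -/

namespace TrackCell

variable {P Q : Iposet α} {U V : Word α}

/-- `c'` is the restriction of `c` along `i`. -/
structure Restr (i : P.carrier → Q.carrier) (c' : TrackCell P U) (c : TrackCell Q U) : Prop where
  emb : ∀ k, i (c'.emb k) = c.emb k
  unstarted : ∀ x, x ∈ c'.unstarted ↔ i x ∈ c.unstarted
  terminated : ∀ x, x ∈ c'.terminated ↔ i x ∈ c.terminated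

theorem Restr.face {i : P.carrier → Q.carrier} (hi : Function.Injective i) {c' : TrackCell P V}
    {c : TrackCell Q V} (h : Restr i c' c) (d : U ⟶ V) : Restr i (c'.face d) (c.face d) where
  emb k := h.emb _
  unstarted x := by
    simp only [TrackCell.face, Set.mem_union, Set.mem_image, h.unstarted, ← h.emb, hi.eq_iff]
  terminated x := by
    simp only [TrackCell.face, Set.mem_union, Set.mem_image, h.terminated, ← h.emb, hi.eq_iff]

theorem Restr.eq {i : P.carrier → Q.carrier} {c₁ c₂ : TrackCell P V}
    {c : TrackCell Q V} (h₁ : Restr i c₁ c) (h₂ : Restr i c₂ c) : c₁ = c₂ :=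
  eq_of_sets (Set.ext fun x => (h₁.unstarted x).trans (h₂.unstarted x).symm)
    (Set.ext fun x => (h₁.terminated x).trans (h₂.terminated x).symm)

theorem face_terminated (c : TrackCell P V) (d : U ⟶ V) (hd : Coface.terminated d = ∅) :
    (c.face d).terminated = c.terminated := by
  simp [face, hd]

theorem terminated_subset_face (c : TrackCell P V) (d : U ⟶ V) :
    c.terminated ⊆ (c.face d).terminated := Set.subset_union_right

theorem unstarted_subset_face (c : TrackCell P V) (d : U ⟶ V) :
    c.unstarted ⊆ (c.face d).unstarted := Set.subset_union_right

end TrackCell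

/-- A presheaf of preorders on the labelled precube category. -/
structure PreorderPresheaf (α : Type u) where
  obj : Word α → Type w
  map : ∀ {U V : Word α}, (U ⟶ V) → obj V → obj U
  map_map : ∀ {U V W : Word α} (d : U ⟶ V) (e : V ⟶ W) (x : obj W), map d (map e x) = map (d ≫ e) x
  le : ∀ {U : Word α}, obj U → obj U → Prop
  refl : ∀ {U : Word α} (x : obj U), le x x
  trans : ∀ {U : Word α} {x y z : obj U}, le x y → le y z → le x z
  map_le : ∀ {U V : Word α} (d : U ⟶ V) {x y : obj V}, le x y → le (map d x) (map d y)

/-- A lax morphism from the track object of `P` to `F`: it is strict on lower faces, and strict on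
all faces of the cell of the end of `P`. -/
structure IsLaxTrack (F : PreorderPresheaf.{u, w} α) (P : Iposet α)
    (σ : ∀ W : Word α, TrackCell P W → F.obj W) : Prop where
  lax : ∀ {U V : Word α} (d : U ⟶ V) (c : TrackCell P V), F.le (F.map d (σ V c)) (σ U (c.face d))
  lower : ∀ {U V : Word α} (d : U ⟶ V) (c : TrackCell P V), Coface.terminated d = ∅ →
    σ U (c.face d) = F.map d (σ V c)
  strict : ∀ {U V : Word α} (d : U ⟶ V) (c : TrackCell P V), c.IsTgt →
    σ U (c.face d) = F.map d (σ V c)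

/-- `P` has a lax track from `x` to `y`. -/
def HasTrack (F : PreorderPresheaf.{u, w} α) (P : Iposet α) {U V : Word α} (x : F.obj U)
    (y : F.obj V) : Prop :=
  ∃ σ : ∀ W : Word α, TrackCell P W → F.obj W, IsLaxTrack F P σ ∧
    (∃ s : TrackCell P U, s.IsSrc ∧ F.le x (σ U s)) ∧ ∃ t : TrackCell P V, t.IsTgt ∧ F.le (σ V t) y

open TrackCell Iposet

/-- A cell of R is late if the points of P outside its target are all terminated, and early if the
points of Q outside its source are all unstarted. Since `prec_cross` orders these points, each cell
is late or early. The track uses `σQ` on late cells and `σP` on the others. Faces of late cells are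
late, and lower faces of cells that are not late are not late, so the border is crossed only along
faces where laxness suffices. -/
theorem HasTrack.glue {F : PreorderPresheaf.{u, w} α} {P Q R : Iposet α} {U V W : Word α}
    {x : F.obj U} {y : F.obj V} {z : F.obj W} (hP : HasTrack F P x y) (hQ : HasTrack F Q y z)
    {i j} (h : IsGluing P Q R i j) : HasTrack F R x z := by
  classical
  obtain ⟨σP, hσP, ⟨sP, hsP, hxP⟩, tP, htP, hyP⟩ := hP
  obtain ⟨σQ, hσQ, ⟨sQ, hsQ, hyQ⟩, tQ, htQ, hzQ⟩ := hQ
  let Late : ∀ {W : Word α}, TrackCell R W → Prop := fun c => ∀ p ∉ P.tgt, i p ∈ c.terminated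
  let Early : ∀ {W : Word α}, TrackCell R W → Prop := fun c => ∀ q ∉ Q.src, j q ∈ c.unstarted
  have early : ∀ {W : Word α} (c : TrackCell R W), ¬ Late c → Early c := by
    intro W c hc q hq
    simp only [Late, not_forall] at hc
    obtain ⟨p, hp, hp'⟩ := hc
    exact (c.prec_closed _ _ (h.prec_cross hp hq)).resolve_left hp'
  have exP : ∀ {W : Word α} (c : TrackCell R W), Early c → ∃ c' : TrackCell P W, Restr i c' c := by
    intro W c hc
    obtain ⟨c', h1, h2, h3⟩ := h.restrict_left c fun k => by
      rcases h.cases (c.emb k) with e | ⟨q, hq, e⟩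
      · exact e
      · exact absurd (e ▸ hc q hq) (c.emb_not_mem k).1
    exact ⟨c', h1, fun x => by rw [h2]; rfl, fun x => by rw [h3]; rfl⟩
  have exQ : ∀ {W : Word α} (c : TrackCell R W), Late c → ∃ c' : TrackCell Q W, Restr j c' c := by
    intro W c hc
    obtain ⟨c', h1, h2, h3⟩ := h.restrict_right c fun k => by
      rcases h.cases' (c.emb k) with ⟨p, hp, e⟩ | e
      · exact absurd (e ▸ hc p hp) (c.emb_not_mem k).2
      · exact e
    exact ⟨c', h1, fun x => by rw [h2]; rfl, fun x => by rw [h3]; rfl⟩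
  -- A cell that is both early and late is a face of the interface: in P a face of the end cell, in
  -- Q a face of the start cell, along the same coface map `d`.
  have bridge : ∀ {W : Word α} (c : TrackCell R W) (a : TrackCell P W) (b : TrackCell Q W),
      Late c → Early c → Restr i a c → Restr j b c → F.le (σP W a) (σQ W b) := by
    intro W c a b hl he ha hb
    obtain ⟨d, hd, -, hdu, hdt⟩ := tP.exists_face a (by simp [htP.2]) fun p hp =>
      (ha.terminated p).2 (hl p ((htP.1 p).1 hp))
    have hm := h.middle_eq htP hsQ
    have ku : ∀ k, k ∈ Coface.unstarted d ↔ j (sQ.emb k) ∈ c.unstarted := fun k => by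
      rw [hdu, ha.unstarted, hm]
    have kt : ∀ k, k ∈ Coface.terminated d ↔ j (sQ.emb k) ∈ c.terminated := fun k => by
      rw [hdt, ha.terminated, hm]
    have hb' : b = sQ.face d := by
      refine eq_of_sets (Set.ext fun q => ?_) (Set.ext fun q => ?_)
      · rw [hb.unstarted]
        by_cases hq : q ∈ Q.src
        · obtain ⟨k, rfl⟩ := hsQ.exists_emb hq
          rw [← ku]
          constructor
          · exact fun hk => .inl ⟨k, hk, rfl⟩
          · rintro (⟨l, hl, e⟩ | hk)
            · exact sQ.emb_injective e ▸ hl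
            · exact absurd hk (sQ.emb_not_mem k).1
        · exact iff_of_true (he q hq) (.inr ((hsQ.1 q).2 hq))
      · rw [hb.terminated]
        by_cases hq : q ∈ Q.src
        · obtain ⟨k, rfl⟩ := hsQ.exists_emb hq
          rw [← kt]
          constructor
          · exact fun hk => .inl ⟨k, hk, rfl⟩
          · rintro (⟨l, hl, e⟩ | hk)
            · exact sQ.emb_injective e ▸ hl
            · exact absurd hk (sQ.emb_not_mem k).2
        · refine iff_of_false (c.disjoint _ (he q hq)) ?_
          rintro (⟨l, hl, e⟩ | hk)
          · exact hq (e ▸ hsQ.emb_mem l)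
          · simp [hsQ.2] at hk
    -- Strictness at the end of P gives equality on that side, the passage through `y` is monotone
    -- under `d`, and laxness at the start of Q finishes. This is the use of the condition `strict`.
    rw [hd, hb', hσP.strict d tP htP]
    exact F.trans (F.map_le d (F.trans hyP hyQ)) (hσQ.lax d sQ)
  choose cP hcP using @exP
  choose cQ hcQ using @exQ
  let σ : ∀ W : Word α, TrackCell R W → F.obj W := fun W c =>
    if hc : Late c then σQ W (cQ c hc) else σP W (cP c (early c hc))
  have σ_late : ∀ {W : Word α} (c : TrackCell R W) (b : TrackCell Q W), Late c → Restr j b c →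
      σ W c = σQ W b := fun {W} c b hc hb => by
    simp only [σ, dif_pos hc]
    rw [(hcQ c hc).eq hb]
  have σ_early : ∀ {W : Word α} (c : TrackCell R W) (a : TrackCell P W), ¬ Late c → Restr i a c →
      σ W c = σP W a := fun {W} c a hc ha => by
    simp only [σ, dif_neg hc]
    rw [(hcP c (early c hc)).eq ha]
  have late_face : ∀ {U V : Word α} (d : U ⟶ V) (c : TrackCell R V), Late c → Late (c.face d) :=
    fun d c hc p hp => c.terminated_subset_face d (hc p hp)
  refine ⟨σ, ⟨?_, ?_, ?_⟩, ?_, ?_⟩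
  · intro U V d c
    by_cases hc : Late c
    · rw [σ_late c _ hc (hcQ c hc), σ_late _ _ (late_face d c hc) ((hcQ c hc).face h.inj_right d)]
      exact hσQ.lax d _
    · have r := hcP c (early c hc)
      rw [σ_early c _ hc r]
      refine F.trans (hσP.lax d _) ?_
      by_cases hc' : Late (c.face d)
      · rw [σ_late _ _ hc' (hcQ _ hc')]
        exact bridge _ _ _ hc' (fun q hq => c.unstarted_subset_face d (early c hc q hq))
          (r.face h.inj_left d) (hcQ _ hc')
      · rw [σ_early _ _ hc' (r.face h.inj_left d)]
        exact F.refl _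
  · intro U V d c hd
    by_cases hc : Late c
    · rw [σ_late c _ hc (hcQ c hc), σ_late _ _ (late_face d c hc) ((hcQ c hc).face h.inj_right d)]
      exact hσQ.lower d _ hd
    · have r := hcP c (early c hc)
      -- A lower face terminates nothing, so it cannot become late.
      have hc' : ¬ Late (c.face d) := fun k => hc fun p hp => by
        have := k p hp
        rwa [c.face_terminated d hd] at this
      rw [σ_early c _ hc r, σ_early _ _ hc' (r.face h.inj_left d)]
      exact hσP.lower d _ hd
  · intro U V d c hct
    have hc : Late c := fun p hp => (hct.1 _).2 fun k => by
      obtain ⟨q, -, e⟩ := (h.tgt_iff _).1 k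
      exact hp (h.overlap e.symm).1
    have r := hcQ c hc
    rw [σ_late c _ hc r, σ_late _ _ (late_face d c hc) (r.face h.inj_right d)]
    refine hσQ.strict d _ ⟨fun q => ?_, ?_⟩
    · rw [r.terminated, hct.1, h.tgt_iff]
      exact not_congr ⟨fun ⟨q', hq', e⟩ => h.inj_right e ▸ hq', fun hq => ⟨q, hq, rfl⟩⟩
    · ext q
      rw [r.unstarted, hct.2]
      exact Iff.rfl
  · obtain ⟨c, hc, he⟩ := h.exists_isSrc hsP
    have r : Restr i sP c := ⟨fun k => (he k).symm, fun p => by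
      rw [hsP.1, hc.1, h.src_iff]
      exact not_congr ⟨fun hp => ⟨p, hp, rfl⟩, fun ⟨p', hp', e⟩ => h.inj_left e ▸ hp'⟩, fun p => by
      simp [hsP.2, hc.2]⟩
    refine ⟨c, hc, F.trans hxP ?_⟩
    by_cases hl : Late c
    · rw [σ_late c _ hl (hcQ c hl)]
      refine bridge c _ _ hl (fun q hq => (hc.1 _).2 fun k => ?_) r (hcQ c hl)
      obtain ⟨p, -, e⟩ := (h.src_iff _).1 k
      exact hq (h.overlap e).2
    · rw [σ_early c _ hl r]
      exact F.refl _
  · obtain ⟨c, hc, he⟩ := h.exists_isTgt htQ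
    have r : Restr j tQ c := ⟨fun k => (he k).symm, fun p => by simp [htQ.2, hc.2], fun q => by
      rw [htQ.1, hc.1, h.tgt_iff]
      exact not_congr ⟨fun hp => ⟨q, hp, rfl⟩, fun ⟨p', hp', e⟩ => h.inj_right e ▸ hp'⟩⟩
    have hl : Late c := fun p hp => (hc.1 _).2 fun k => by
      obtain ⟨q, -, e⟩ := (h.tgt_iff _).1 k
      exact hp (h.overlap e.symm).1
    exact ⟨c, hc, by rwa [σ_late c _ hl r]⟩

/-- Tracks of a discrete iposet from its top cell. -/
theorem hasTrack_ilo (F : PreorderPresheaf.{u, w} α) {U V W : Word α} {S T : Set (Fin V.length)}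
    (n : F.obj V) (s : U ⟶ V) (t : W ⟶ V) (hs : (ofCoface S T s).IsSrc)
    (ht : (ofCoface S T t).IsTgt) {x : F.obj U} {y : F.obj W} (hx : F.le x (F.map s n))
    (hy : F.le (F.map t n) y) : HasTrack F (V.ilo S T) x y := by
  -- As in the Yoneda lemma, a cell is a coface map `d`, and its value is the face of `n` along `d`;
  -- this track is strict everywhere.
  choose g hg using @exists_ofCoface α
  let σ : ∀ W : Word α, TrackCell (V.ilo S T) W → F.obj W := fun _ c => F.map (g c) n
  have hσ : ∀ {W : Word α} (d : W ⟶ V), σ W (ofCoface S T d) = F.map d n := fun d => by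
    simp only [σ]
    rw [ofCoface_injective (hg (ofCoface S T d))]
  have str : ∀ {U V' : Word α} (d : U ⟶ V') (c : TrackCell (V.ilo S T) V'),
      σ U (c.face d) = F.map d (σ V' c) := fun d c => by
    obtain ⟨e, rfl⟩ := exists_ofCoface c
    rw [ofCoface_comp, hσ, hσ, F.map_map]
  exact ⟨σ, ⟨fun d c => by rw [str]; exact F.refl _, fun d c _ => str d c, fun d c _ => str d c⟩,
    ⟨_, hs, by rwa [hσ]⟩, _, ht, by rwa [hσ]⟩

/-- A subsumption maps cells to cells. -/
def TrackCell.mapSubsu {P Q : Iposet α} {f : P.carrier ≃ Q.carrier} (hf : IsSubsumption P Q f)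
    {V : Word α} (c : TrackCell P V) : TrackCell Q V where
  emb k := f (c.emb k)
  unstarted := {x | f.symm x ∈ c.unstarted}
  terminated := {x | f.symm x ∈ c.terminated}
  label_emb k := (hf.label_eq _).trans (c.label_emb k)
  evord_emb k l h := hf.evord_of _ _ (c.evord_emb k l h) (c.not_prec_emb _ _) (c.not_prec_emb _ _)
  disjoint x := c.disjoint _
  union_iff x := (c.union_iff _).trans (forall_congr' fun k => not_congr
    (Equiv.eq_symm_apply f))
  -- The target of a subsumption has no precedence beyond that of P, so the configuration stays
  -- admissible.
  prec_closed x y h := c.prec_closed _ _ (hf.prec_of _ _ (by simpa using h))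

theorem TrackCell.mapSubsu_face {P Q : Iposet α} {f : P.carrier ≃ Q.carrier}
    (hf : IsSubsumption P Q f) {U V : Word α} (d : U ⟶ V) (c : TrackCell P V) :
    (c.face d).mapSubsu hf = (c.mapSubsu hf).face d := by
  refine ext_sets ?_ ?_ rfl
  · ext x
    simp only [mapSubsu, face, Set.mem_union, Set.mem_image, Set.mem_ofPred_eq,
      ← Equiv.eq_symm_apply f]
  · ext x
    simp only [mapSubsu, face, Set.mem_union, Set.mem_image, Set.mem_ofPred_eq,
      ← Equiv.eq_symm_apply f]

theorem TrackCell.IsSrc.mapSubsu {P Q : Iposet α} {f : P.carrier ≃ Q.carrier}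
    (hf : IsSubsumption P Q f) {V : Word α} {c : TrackCell P V} (hc : c.IsSrc) :
    (c.mapSubsu hf).IsSrc :=
  ⟨fun x => (hc.1 _).trans (not_congr (by simp [hf.src_iff])), by
    ext x; simp [TrackCell.mapSubsu, hc.2]⟩

theorem TrackCell.IsTgt.mapSubsu {P Q : Iposet α} {f : P.carrier ≃ Q.carrier}
    (hf : IsSubsumption P Q f) {V : Word α} {c : TrackCell P V} (hc : c.IsTgt) :
    (c.mapSubsu hf).IsTgt :=
  ⟨fun x => (hc.1 _).trans (not_congr (by simp [hf.tgt_iff])), by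
    ext x; simp [TrackCell.mapSubsu, hc.2]⟩

/-- Tracks pull back along subsumptions. -/
theorem HasTrack.subsu {F : PreorderPresheaf.{u, w} α} {P Q : Iposet α} {U V : Word α}
    {x : F.obj U} {y : F.obj V} (hQ : HasTrack F Q x y) (h : Subsu P Q) : HasTrack F P x y := by
  obtain ⟨f, hf⟩ := h
  obtain ⟨σ, hσ, ⟨s, hs, hx⟩, t, ht, hy⟩ := hQ
  refine ⟨fun W c => σ W (c.mapSubsu hf), ⟨fun d c => ?_, fun d c hd => ?_, fun d c hc => ?_⟩, ?_, ?_⟩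
  · simp only [mapSubsu_face]
    exact hσ.lax _ _
  · simp only [mapSubsu_face]
    exact hσ.lower _ _ hd
  · simp only [mapSubsu_face]
    exact hσ.strict _ _ (hc.mapSubsu hf)
  · obtain ⟨V, c, hc⟩ := TrackCell.exists_isSrc P
    obtain rfl := hs.word_eq (hc.mapSubsu hf)
    exact ⟨c, hc, by rwa [hs.eq (hc.mapSubsu hf)] at hx⟩
  · obtain ⟨V, c, hc⟩ := TrackCell.exists_isTgt P
    obtain rfl := ht.word_eq (hc.mapSubsu hf)
    exact ⟨c, hc, by rwa [ht.eq (hc.mapSubsu hf)] at hy⟩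

end

section

open Word (Coface)

open TrackCell Iposet

/-! ### The nerve of a presheaf of preorders -/

/-- A coface map into V, including its domain, is determined by its unstarted and terminated sets,
so V has only finitely many faces. -/
instance finite_sigma_coface (V : Word α) : Finite (Σ U, (U ⟶ V)) := by
  refine Finite.of_injective (β := Set (Fin V.length) × Set (Fin V.length))
    (fun p => (Coface.unstarted p.2, Coface.terminated p.2)) ?_
  rintro ⟨U, d⟩ ⟨U', d'⟩ h
  simp only [Prod.mk.injEq] at h
  obtain rfl := (ofCoface ∅ ∅ d).word_eq (ofCoface ∅ ∅ d') h.1 h.2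
  have : ofCoface ∅ ∅ d = ofCoface ∅ ∅ d' := eq_of_sets h.1 h.2
  rw [ofCoface_injective this]

instance finite_coface (U V : Word α) : Finite (U ⟶ V) :=
  Finite.of_injective (fun d => (⟨U, d⟩ : Σ U, (U ⟶ V))) fun _ _ h => by simpa using h

namespace PreorderPresheaf

variable (F : PreorderPresheaf.{u, w} α)

/-- Lax morphisms from the standard cube on `U` to `F` that are strict on lower faces. -/
@[ext]
structure Nerve (U : Word α) : Type (max u w) where
  val : ∀ V, (V ⟶ U) → F.obj V
  lax : ∀ V W (e : W ⟶ V) (d : V ⟶ U), F.le (F.map e (val V d)) (val W (e ≫ d))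
  lower : ∀ V W (e : W ⟶ V) (d : V ⟶ U), Coface.terminated e = ∅ →
    val W (e ≫ d) = F.map e (val V d)

variable {F}

/-- Restriction of a lax morphism to a face. -/
def Nerve.face {U V : Word α} (d : U ⟶ V) (φ : F.Nerve V) : F.Nerve U where
  val W e := φ.val W (e ≫ d)
  lax V W e d' := by
    rw [Category.assoc]
    exact φ.lax _ _ _ _
  lower V W e d' he := by
    rw [Category.assoc]
    exact φ.lower _ _ _ _ he

theorem Nerve.face_id {U : Word α} (φ : F.Nerve U) : φ.face (𝟙 U) = φ := by
  ext V d
  simp [face]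

theorem Nerve.face_face {U V W : Word α} (d : U ⟶ V) (e : V ⟶ W) (φ : F.Nerve W) :
    (φ.face e).face d = φ.face (d ≫ e) := by
  ext V d
  simp [face]

/-- The value on the top cell. -/
def Nerve.top {U : Word α} (φ : F.Nerve U) : F.obj U := φ.val U (𝟙 U)

/-- The composite with the identity is left as it is, in the form to which `lax` and `lower` apply.
-/
theorem Nerve.top_face {U V : Word α} (d : U ⟶ V) (φ : F.Nerve V) :
    (φ.face d).top = φ.val U (d ≫ 𝟙 V) := by
  simp [top, face]

theorem Nerve.le_top_face {U V : Word α} (d : U ⟶ V) (φ : F.Nerve V) :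
    F.le (F.map d φ.top) (φ.face d).top := by
  rw [top_face]
  exact φ.lax _ _ _ _

theorem Nerve.top_face_lower {U V : Word α} (d : U ⟶ V) (hd : Coface.terminated d = ∅)
    (φ : F.Nerve V) : (φ.face d).top = F.map d φ.top := by
  rw [top_face]
  exact φ.lower _ _ _ _ hd

instance finite_nerve [h : Finite (Σ U, F.obj U)] (U : Word α) : Finite (F.Nerve U) := by
  refine Finite.of_injective (β := (Σ V, (V ⟶ U)) → Σ V, F.obj V)
    (fun φ p => ⟨p.1, φ.val p.1 p.2⟩) fun φ ψ e => Nerve.ext ?_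
  funext V d
  simpa using congrFun e ⟨V, d⟩

instance finite_sigma_nerve [h : Finite (Σ U, F.obj U)] : Finite (Σ U, F.Nerve U) := by
  -- The top value is an element of F over U, so only the finitely many words over which F is
  -- inhabited occur.
  refine Finite.of_injective (β := Σ p : (Σ U, F.obj U), F.Nerve p.1)
    (fun p => ⟨⟨p.1, p.2.top⟩, p.2⟩) ?_
  rintro ⟨U, φ⟩ ⟨V, ψ⟩ e
  simp only [Sigma.mk.injEq] at e
  obtain ⟨⟨rfl, -⟩, h⟩ := e
  simpa using h

variable (F)

/-- The HDA of lax morphisms from cubes to `F`. -/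
noncomputable def nerve [Finite (Σ U, F.obj U)] (S T : Set (Σ U, F.obj U)) : HDA α where
  presheaf :=
    -- The cells of an HDA must lie in `Type`; a finite type is small, so it can be moved there.
    { obj := fun U => Shrink.{0} (F.Nerve U.unop)
      map := fun {U V} d => TypeCat.ofHom fun φ =>
        equivShrink.{0} _ (((equivShrink.{0} (F.Nerve U.unop)).symm φ).face d.unop)
      map_id := fun U => by
        ext φ
        simp [Nerve.face_id]
      map_comp := fun d e => by
        ext φ
        simp [Nerve.face_face] }
  finite := by
    refine Finite.of_injective (β := Σ U, F.Nerve U)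
      (fun p => ⟨p.1, (equivShrink.{0} (F.Nerve p.1)).symm p.2⟩) ?_
    rintro ⟨U, φ⟩ ⟨V, ψ⟩ e
    simp only [Sigma.mk.injEq] at e
    obtain ⟨rfl, h⟩ := e
    simpa using h
  -- The preorder is allowed to act before the first step and after the last one.
  start := {p | ∃ x, ⟨p.1, x⟩ ∈ S ∧ F.le x ((equivShrink.{0} (F.Nerve p.1)).symm p.2).top}
  accept := {p | ∃ y, ⟨p.1, y⟩ ∈ T ∧ F.le ((equivShrink.{0} (F.Nerve p.1)).symm p.2).top y}

end PreorderPresheaf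

end

/-! ### Languages of nerves. -/

section

open Word (Coface)

open TrackCell Iposet

namespace PreorderPresheaf

variable {F : PreorderPresheaf.{u, w} α}

/-- The lax morphism underlying a cell of the nerve. -/
noncomputable def ofNode [Finite (Σ U, F.obj U)] {S T : Set (Σ U, F.obj U)} {U : Word α}
    (φ : (F.nerve S T).toSTGraph.node U) : F.Nerve U := (equivShrink.{0} (F.Nerve U)).symm φ

/-- The cell of the nerve of a lax morphism. -/
noncomputable def toNode [Finite (Σ U, F.obj U)] (S T : Set (Σ U, F.obj U)) {U : Word α}
    (φ : F.Nerve U) : (F.nerve S T).toSTGraph.node U := equivShrink.{0} (F.Nerve U) φ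

theorem ofNode_toNode [Finite (Σ U, F.obj U)] {S T : Set (Σ U, F.obj U)} {U : Word α}
    (φ : F.Nerve U) : ofNode (toNode S T φ) = φ := by
  simp [ofNode, toNode]

theorem ofNode_map [Finite (Σ U, F.obj U)] {S T : Set (Σ U, F.obj U)} {U V : Word α} (d : U ⟶ V)
    (φ : (F.nerve S T).toSTGraph.node V) :
    ofNode (S := S) (T := T) ((F.nerve S T).presheaf.map d.op φ) = (ofNode φ).face d :=
  Equiv.symm_apply_apply _ _

theorem toNode_face [Finite (Σ U, F.obj U)] {S T : Set (Σ U, F.obj U)} {U V : Word α} (d : U ⟶ V)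
    (φ : F.Nerve V) : toNode S T (φ.face d) = (F.nerve S T).presheaf.map d.op (toNode S T φ) := by
  change _ = equivShrink.{0} _ ((ofNode (toNode S T φ)).face d)
  rw [ofNode_toNode]
  rfl

/-- A lax track sends a cell `c` to the lax morphism `d ↦ σ (c.face d)`, and this assignment
commutes strictly with faces. The laxness is thus hidden inside the cells of the nerve, and the
interval iposet R can be traversed by a genuine path. -/
theorem mem_lang_nerve [Finite (Σ U, F.obj U)] {S T : Set (Σ U, F.obj U)} {R : Iposet α}
    (hR : R.IsInterval) {U V : Word α} {x : F.obj U} {y : F.obj V} (h : HasTrack F R x y)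
    (hx : ⟨U, x⟩ ∈ S) (hy : ⟨V, y⟩ ∈ T) : Ipomset.mk R ∈ (F.nerve S T).lang := by
  obtain ⟨σ, hσ, ⟨s, hs, hxs⟩, t, ht, hty⟩ := h
  rw [← HDA.lang_toSTGraph]
  let φ : ∀ {W : Word α}, TrackCell R W → F.Nerve W := fun c =>
    { val := fun V d => σ V (c.face d)
      lax := fun V W e d => by
        rw [← face_face]
        exact hσ.lax e _
      lower := fun V W e d he => by
        rw [← face_face]
        exact hσ.lower e _ he }
  have hφ : ∀ {U V : Word α} (d : U ⟶ V) (c : TrackCell R V), φ (c.face d) = (φ c).face d := by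
    intro U V d c
    ext W e
    simp only [φ, Nerve.face, face_face]
  have top : ∀ {W : Word α} (c : TrackCell R W), (φ c).top = σ W c := fun c => by
    simp only [φ, Nerve.top, face_id]
  refine ⟨⟨U, toNode S T (φ s)⟩, ⟨x, hx, ?_⟩, ⟨V, toNode S T (φ t)⟩, ⟨y, hy, ?_⟩,
    STGraph.reach_of_track hR (fun c => toNode S T (φ c)) (fun d c _ => ?_) (fun d c _ => ?_) hs ht⟩
  · change F.le x (ofNode (toNode S T (φ s))).top
    rwa [ofNode_toNode, top]
  · change F.le (ofNode (toNode S T (φ t))).top y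
    rwa [ofNode_toNode, top]
  · change toNode S T (φ (c.face d)) = (F.nerve S T).presheaf.map d.op (toNode S T (φ c))
    rw [hφ, toNode_face]
  · change toNode S T (φ (c.face d)) = (F.nerve S T).presheaf.map d.op (toNode S T (φ c))
    rw [hφ, toNode_face]

end PreorderPresheaf

/-! ### Relaxed runs -/

/-- `R` is a snapshot of `W` along `d`: the points of `R` are those points of `W` that are not among
the unstarted events of `d`, with possibly more precedence, and the target interface of `R` is
the part of that of `W` which is in the image of `d`. -/
structure Snapshot (R W : Iposet α) {U V : Word α} (d : U ⟶ V) (t : TrackCell R U)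
    (t' : TrackCell W V) (f : R.carrier → W.carrier) : Prop where
  isTgt_left : t.IsTgt
  isTgt_right : t'.IsTgt
  inj : Function.Injective f
  label : ∀ x, W.label (f x) = R.label x
  src_iff : ∀ x, x ∈ R.src ↔ f x ∈ W.src
  src_range : ∀ y ∈ W.src, ∃ x, f x = y
  range : ∀ y, (∃ x, f x = y) ↔ ∀ k ∈ Coface.unstarted d, t'.emb k ≠ y
  tgt : ∀ k, f (t.emb k) = t'.emb (Coface.emb d k)
  prec : ∀ {x y}, W.prec (f x) (f y) → R.prec x y
  evord : ∀ {x y}, R.evord x y → ¬ R.prec x y → ¬ R.prec y x → W.evord (f x) (f y)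

/-- `R` is a snapshot of `W` along `d`. -/
def IsSnapshot (R W : Iposet α) {U V : Word α} (d : U ⟶ V) : Prop :=
  ∃ t t' f, Snapshot R W d t t' f

theorem isSnapshot_id (U : Word α) :
    IsSnapshot (U.ilo Set.univ Set.univ) (U.ilo Set.univ Set.univ) (𝟙 U) :=
  ⟨_, _, id,
    { isTgt_left := isTgt_id U
      isTgt_right := isTgt_id U
      inj := Function.injective_id
      label := fun _ => rfl
      src_iff := fun _ => Iff.rfl
      src_range := fun y _ => ⟨y, rfl⟩
      range := fun y => iff_of_true ⟨y, rfl⟩ fun _ h => h.elim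
      tgt := fun _ => rfl
      prec := id
      evord := fun h _ _ => h }⟩

/-- Along the identity no event is unstarted, so the inclusion is onto, and both configurations have
the same running events, so the target interfaces match. -/
theorem IsSnapshot.subsu {R W : Iposet α} {U : Word α} (h : IsSnapshot R W (𝟙 U)) :
    Subsu R W := by
  obtain ⟨t, t', f, h⟩ := h
  have surj : Function.Surjective f := fun y => (h.range y).2 fun _ h => h.elim
  refine ⟨Equiv.ofBijective f ⟨h.inj, surj⟩, ⟨h.src_iff, fun x => ?_, h.label, fun _ _ => h.prec,
    fun _ _ => h.evord⟩⟩
  change x ∈ R.tgt ↔ f x ∈ W.tgt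
  constructor
  · intro hx
    obtain ⟨k, rfl⟩ := h.isTgt_left.exists_emb hx
    rw [h.tgt]
    exact h.isTgt_right.emb_mem _
  · intro hx
    obtain ⟨k, e⟩ := h.isTgt_right.exists_emb hx
    rw [← h.inj ((h.tgt k).trans e)]
    exact h.isTgt_left.emb_mem _

/-- Start events in the snapshot. -/
theorem IsSnapshot.start_left {R R' W : Iposet α} {U U' V : Word α} {e : U ⟶ U'} {d : U' ⟶ V}
    (h : IsSnapshot R W (e ≫ d)) (he : Coface.terminated e = ∅) {i j}
    (g : IsGluing R (starter e) R' i j) : IsSnapshot R' W d := by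
  obtain ⟨t, t', f, h⟩ := h
  have hm := g.middle_eq h.isTgt_left (isSrc_starter e he)
  have agree : ∀ a k, i a = j k → f a = t'.emb (Coface.emb d k) := fun a k ea => by
    obtain ⟨l, rfl⟩ := h.isTgt_left.exists_emb (g.overlap ea).1
    rw [hm] at ea
    rw [h.tgt, ← g.inj_right ea]
    rfl
  have ex : ∀ r, ∃ y, (∀ a, i a = r → y = f a) ∧ ∀ k, j k = r → y = t'.emb (Coface.emb d k) := by
    intro r
    rcases g.cover r with ⟨a, rfl⟩ | ⟨k, rfl⟩
    · exact ⟨f a, fun b e => by rw [g.inj_left e], fun k e => agree a k e.symm⟩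
    · exact ⟨t'.emb (Coface.emb d k), fun b e => (agree b k e).symm, fun l e => by
        rw [g.inj_right e]⟩
  choose f' hf1 hf2 using ex
  have fi : ∀ a, f' (i a) = f a := fun a => hf1 _ a rfl
  have fj : ∀ k, f' (j k) = t'.emb (Coface.emb d k) := fun k => hf2 _ k rfl
  have un : ∀ k, k ∉ (starter e).src → k ∈ Coface.unstarted e := fun k hk => not_not.1 hk
  -- An event newly started in R was already running in W but unstarted along `e ≫ d`, so its image
  -- is new.
  have nr : ∀ k, k ∉ (starter e).src → ∀ a, f a ≠ t'.emb (Coface.emb d k) := fun k hk a ea =>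
    (h.range _).1 ⟨a, ea⟩ _ (.inl ⟨k, un k hk, rfl⟩) rfl
  obtain ⟨c, hc, hce⟩ := g.exists_isTgt (isTgt_starter e)
  refine ⟨c, t', f', hc, h.isTgt_right, ?_, ?_, ?_, ?_, ?_, ?_, ?_, ?_⟩
  · intro x y exy
    rcases g.cases x with ⟨a, rfl⟩ | ⟨k, hk, rfl⟩ <;> rcases g.cases y with ⟨b, rfl⟩ | ⟨l, hl, rfl⟩ <;>
      simp only [fi, fj] at exy
    · rw [h.inj exy]
    · exact absurd exy (nr l hl a)
    · exact absurd exy.symm (nr k hk b)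
    · rw [(Coface.emb d).injective (t'.emb_injective exy)]
  · intro x
    rcases g.cover x with ⟨a, rfl⟩ | ⟨k, rfl⟩
    · rw [fi, h.label, g.label_left]
    · rw [fj, t'.label_emb]
      exact (Coface.label_emb d k).trans (g.label_right k).symm
  · intro x
    rw [g.src_iff]
    rcases g.cases x with ⟨a, rfl⟩ | ⟨k, hk, rfl⟩
    · rw [fi, ← h.src_iff]
      exact ⟨fun ⟨b, hb, e⟩ => g.inj_left e ▸ hb, fun ha => ⟨a, ha, rfl⟩⟩
    · rw [fj]
      refine iff_of_false (fun ⟨b, _, e⟩ => hk (g.overlap e).2) fun hs => ?_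
      obtain ⟨a, ha⟩ := h.src_range _ hs
      exact nr k hk a ha
  · intro y hy
    obtain ⟨a, rfl⟩ := h.src_range y hy
    exact ⟨i a, fi a⟩
  · intro y
    constructor
    · rintro ⟨x, rfl⟩ k hk ek
      rcases g.cover x with ⟨a, rfl⟩ | ⟨l, rfl⟩
      · rw [fi] at ek
        exact (h.range _).1 ⟨a, rfl⟩ k (.inr hk) ek
      · rw [fj] at ek
        exact (Coface.emb_mem d k).1 (.inl hk) l (t'.emb_injective ek).symm
    · intro hy
      by_cases hr : ∃ a, f a = y
      · obtain ⟨a, rfl⟩ := hr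
        exact ⟨i a, fi a⟩
      · have := mt (h.range y).2 hr
        push Not at this
        obtain ⟨k, ⟨l, hl, rfl⟩ | hk, rfl⟩ := this
        · exact ⟨j l, fj l⟩
        · exact absurd rfl (hy k hk)
  · intro k
    rw [hce, fj]
    rfl
  · intro x y hxy
    rcases g.cover x with ⟨a, rfl⟩ | ⟨k, rfl⟩
    · rcases g.cases y with ⟨b, rfl⟩ | ⟨l, hl, rfl⟩
      · rw [fi, fi] at hxy
        exact g.prec_left.2 (h.prec hxy)
      -- Everything terminated in R precedes the new event; W may lack this precedence. If `a` were
      -- still running in R, its image would be running in W, hence maximal there.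
      · refine g.prec_cross (fun ha => ?_) hl
        obtain ⟨k, rfl⟩ := h.isTgt_left.exists_emb ha
        rw [fi, h.tgt] at hxy
        exact W.tgt_maximal _ (h.isTgt_right.emb_mem _) _ hxy
    · rw [fj] at hxy
      exact absurd hxy (W.tgt_maximal _ (h.isTgt_right.emb_mem _) _)
  · intro x y hxy h1 h2
    rcases g.incomparable_cases h1 h2 with ⟨a, b, rfl, rfl⟩ | ⟨a, b, rfl, rfl⟩
    · rw [g.prec_left] at h1 h2
      rw [fi, fi]
      exact h.evord (evord_of_evord_map g.evord_left hxy h1 h2) h1 h2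
    · rw [g.prec_right] at h1 h2
      rw [fj, fj]
      exact t'.evord_emb _ _ ((Coface.emb d).strictMono
        (evord_of_evord_map g.evord_right hxy h1 h2))

/-- Terminate events in the snapshot. -/
theorem IsSnapshot.terminate_left {R R' W : Iposet α} {U U' V : Word α} {e : U' ⟶ U} {d : U ⟶ V}
    (h : IsSnapshot R W d) (he : Coface.unstarted e = ∅) {i j}
    (g : IsGluing R (terminator e) R' i j) : IsSnapshot R' W (e ≫ d) := by
  obtain ⟨t, t', f, h⟩ := h
  have hm := g.middle_eq h.isTgt_left (isSrc_terminator e)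
  have surj : ∀ r, ∃ a, i a = r := fun r => (g.cases r).resolve_right fun ⟨q, hq, _⟩ => hq trivial
  choose l hl using surj
  have li : ∀ a, l (i a) = a := fun a => g.inj_left (hl _)
  obtain ⟨c, hc, hce⟩ := g.exists_isTgt (isTgt_terminator e he)
  refine ⟨c, t', f ∘ l, hc, h.isTgt_right, ?_, ?_, ?_, ?_, ?_, ?_, ?_, ?_⟩
  · intro x y exy
    rw [← hl x, h.inj exy, hl]
  · intro x
    rw [← hl x, g.label_left, ← h.label, hl]
    rfl
  · intro x
    rw [g.src_iff, Function.comp_apply, ← h.src_iff]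
    exact ⟨by rintro ⟨p, hp, rfl⟩; rwa [li], fun hx => ⟨_, hx, hl x⟩⟩
  · intro y hy
    obtain ⟨a, rfl⟩ := h.src_range y hy
    exact ⟨i a, by simp [li]⟩
  · intro y
    -- Terminating events adds no unstarted ones, so the range is unchanged.
    rw [Word.comp_unstarted, he, Set.image_empty, Set.empty_union, ← h.range]
    exact ⟨fun ⟨x, e⟩ => ⟨_, e⟩, fun ⟨x, e⟩ => ⟨i x, by simpa [li] using e⟩⟩
  · intro k
    have : c.emb k = i (t.emb (Coface.emb e k)) := (hce k).trans (hm (Coface.emb e k)).symm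
    rw [this, Function.comp_apply, li, h.tgt, Word.comp_emb]
  · intro x y hxy
    have := h.prec hxy
    rwa [← g.prec_left, hl, hl] at this
  · intro x y hxy h1 h2
    rw [← hl x, ← hl y] at hxy h1 h2
    rw [g.prec_left] at h1 h2
    exact h.evord (evord_of_evord_map g.evord_left hxy h1 h2) h1 h2

/-- Start events which are unstarted in the snapshot. -/
theorem IsSnapshot.start_right {R W W' : Iposet α} {U V V' : Word α} {d : U ⟶ V} {e : V ⟶ V'}
    (h : IsSnapshot R W d) (he : Coface.terminated e = ∅) {i j}
    (g : IsGluing W (starter e) W' i j) : IsSnapshot R W' (d ≫ e) := by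
  obtain ⟨t, t', f, h⟩ := h
  have hm := g.middle_eq h.isTgt_right (isSrc_starter e he)
  obtain ⟨c, hc, hce⟩ := g.exists_isTgt (isTgt_starter e)
  have hce' : ∀ k, c.emb k = j k := hce
  have hm' : ∀ k, i (t'.emb k) = j (Coface.emb e k) := hm
  refine ⟨t, c, i ∘ f, h.isTgt_left, hc, g.inj_left.comp h.inj, ?_, ?_, ?_, ?_, ?_, ?_, ?_⟩
  · exact fun x => (g.label_left _).trans (h.label x)
  · intro x
    rw [h.src_iff, g.src_iff]
    exact ⟨fun hx => ⟨_, hx, rfl⟩, fun ⟨p, hp, e⟩ => g.inj_left e ▸ hp⟩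
  · intro y hy
    obtain ⟨w, hw, rfl⟩ := (g.src_iff y).1 hy
    obtain ⟨x, rfl⟩ := h.src_range w hw
    exact ⟨x, rfl⟩
  · intro y
    rcases g.cases y with ⟨w, rfl⟩ | ⟨k, hk, rfl⟩
    · simp only [Function.comp_apply, g.inj_left.eq_iff, h.range]
      constructor
      · rintro hw k (⟨l, hl, rfl⟩ | hk) ek
        · rw [hce', ← hm'] at ek
          exact hw l hl (g.inj_left ek)
        · rw [hce'] at ek
          exact (g.overlap ek.symm).2 hk
      · intro hw k hk ek
        exact hw _ (.inl ⟨k, hk, rfl⟩) (by rw [hce', ← hm', ek])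
    · refine iff_of_false (fun ⟨x, ex⟩ => hk (g.overlap ex).2) fun hy => ?_
      exact hy k (.inr (not_not.1 hk)) (hce' k)
  · intro k
    rw [hce', Function.comp_apply, h.tgt, hm']
    rfl
  · exact fun hxy => h.prec (g.prec_left.1 hxy)
  · exact fun hxy h1 h2 => g.evord_left (h.evord hxy h1 h2) (fun k => h1 (h.prec k))
      fun k => h2 (h.prec k)

/-- Terminate events which are terminated in the snapshot. -/
theorem IsSnapshot.terminate_right {R W W' : Iposet α} {U V V' : Word α} {d : U ⟶ V'} {e : V' ⟶ V}
    (h : IsSnapshot R W (d ≫ e)) (he : Coface.unstarted e = ∅) {i j}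
    (g : IsGluing W (terminator e) W' i j) : IsSnapshot R W' d := by
  obtain ⟨t, t', f, h⟩ := h
  have hm := g.middle_eq h.isTgt_right (isSrc_terminator e)
  obtain ⟨c, hc, hce⟩ := g.exists_isTgt (isTgt_terminator e he)
  have hce' : ∀ k, c.emb k = i (t'.emb (Coface.emb e k)) := fun k => (hce k).trans (hm _).symm
  have surj : ∀ r, ∃ a, i a = r := fun r => (g.cases r).resolve_right fun ⟨q, hq, _⟩ => hq trivial
  refine ⟨t, c, i ∘ f, h.isTgt_left, hc, g.inj_left.comp h.inj, ?_, ?_, ?_, ?_, ?_, ?_, ?_⟩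
  · exact fun x => (g.label_left _).trans (h.label x)
  · intro x
    rw [h.src_iff, g.src_iff]
    exact ⟨fun hx => ⟨_, hx, rfl⟩, fun ⟨p, hp, e⟩ => g.inj_left e ▸ hp⟩
  · intro y hy
    obtain ⟨w, hw, rfl⟩ := (g.src_iff y).1 hy
    obtain ⟨x, rfl⟩ := h.src_range w hw
    exact ⟨x, rfl⟩
  · intro y
    obtain ⟨w, rfl⟩ := surj y
    simp only [Function.comp_apply, g.inj_left.eq_iff, h.range, Word.comp_unstarted, he,
      Set.union_empty, Set.forall_mem_image, hce', ne_eq]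
  · intro k
    rw [hce', Function.comp_apply, h.tgt]
    rfl
  · exact fun hxy => h.prec (g.prec_left.1 hxy)
  · exact fun hxy h1 h2 => g.evord_left (h.evord hxy h1 h2) (fun k => h1 (h.prec k))
      fun k => h2 (h.prec k)

/-! ### Down-closures of graph languages are regular -/

namespace STGraph

variable (A : STGraph.{u, v} α)

/-- Moves of the graph under a fixed face of its current word. -/
inductive Move {U : Word α} : (Σ W, A.node W × (U ⟶ W)) → (Σ W, A.node W × (U ⟶ W)) → Prop
  -- From the point of view of U, the events started by an up-move are still unstarted, and those
  -- ended by a down-move had been terminated already.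
  | up {W W' : Word α} (e : W ⟶ W') (he : Coface.terminated e = ∅) {q : A.node W} {r : A.node W'}
      (h : A.up e q r) (d : U ⟶ W) : Move ⟨W, q, d⟩ ⟨W', r, d ≫ e⟩
  | down {W Z : Word α} (e : Z ⟶ W) (he : Coface.unstarted e = ∅) {q : A.node W} {r : A.node Z}
      (h : A.down e q r) (d : U ⟶ Z) : Move ⟨W, q, d ≫ e⟩ ⟨Z, r, d⟩

/-- The free presheaf on the nodes, preordered by moves. -/
def free : PreorderPresheaf.{u, max u v} α where
  obj U := Σ W, A.node W × (U ⟶ W)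
  map d n := ⟨n.1, n.2.1, d ≫ n.2.2⟩
  map_map d e n := by simp
  le := Relation.ReflTransGen A.Move
  refl _ := .refl
  trans := .trans
  map_le {U V} d {x y} h := by
    induction h with
    | refl => exact .refl
    | tail _ k ih =>
      refine ih.tail ?_
      cases k with
      | up e he h d' =>
        have := Move.up e he h (d ≫ d')
        rwa [Category.assoc] at this
      | down e he h d' =>
        have := Move.down e he h (d ≫ d')
        rwa [Category.assoc] at this

instance : Finite (Σ U, A.free.obj U) := by
  have := A.finite
  refine Finite.of_injective (β := Σ p : (Σ W, A.node W), Σ U, (U ⟶ p.1))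
    (fun n => ⟨⟨n.2.1, n.2.2.1⟩, n.1, n.2.2.2⟩) ?_
  rintro ⟨U, W, q, d⟩ ⟨U', W', q', d'⟩ h
  simp only [Sigma.mk.injEq] at h
  obtain ⟨⟨rfl, h1⟩, h2⟩ := h
  obtain rfl := eq_of_heq h1
  have h2 := eq_of_heq h2
  simp only [Sigma.mk.injEq] at h2
  obtain ⟨rfl, h2⟩ := h2
  obtain rfl := eq_of_heq h2
  rfl

/-- The HDA that recognises the down-closure of the language of a graph. -/
noncomputable def hda : HDA α :=
  A.free.nerve {n | ∃ x ∈ A.start, n = ⟨x.1, x.1, x.2, 𝟙 _⟩} {n | ∃ x ∈ A.accept, n = ⟨x.1, x.1, x.2, 𝟙 _⟩}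

variable {A}

/-- The track of a single step is represented by the larger of its two states; the move along the
edge supplies the inequality at the smaller end. The steps are then joined by `HasTrack.glue`. -/
theorem Reach.hasTrack {U V : Word α} {x : A.node U} {y : A.node V} {P : Ipomset α}
    (h : A.Reach x y P) : ∃ R, Ipomset.mk R = P ∧
      HasTrack A.free R (⟨U, x, 𝟙 U⟩ : A.free.obj U) (⟨V, y, 𝟙 V⟩ : A.free.obj V) := by
  have id_le : ∀ {U V : Word α} (d : U ⟶ V) (n : A.node V),
      A.free.map d (⟨V, n, 𝟙 V⟩ : A.free.obj V) = ⟨V, n, d⟩ := fun d n => by simp [free]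
  induction h with
  | nil =>
    refine ⟨_, rfl, hasTrack_ilo _ (⟨U, x, 𝟙 U⟩ : A.free.obj U) (𝟙 U) (𝟙 U) (isSrc_id U)
      (isTgt_id U) ?_ ?_⟩ <;> rw [id_le] <;> exact A.free.refl _
  | @up V W d hd y z P R _ e g ih =>
    obtain ⟨R₁, rfl, h₁⟩ := ih
    obtain ⟨R, rfl⟩ := Ipomset.exists_rep R
    obtain ⟨i, j, g⟩ := Ipomset.isGlue_mk.1 g
    refine ⟨R, rfl, h₁.glue (hasTrack_ilo _ (⟨W, z, 𝟙 W⟩ : A.free.obj W) d (𝟙 W)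
      (isSrc_starter d hd) (isTgt_starter d) ?_ ?_) g⟩ <;> rw [id_le]
    · have := Move.up d hd e (𝟙 V)
      rw [Category.id_comp] at this
      exact .single this
    · exact A.free.refl _
  | @down V W d hd y z P R _ e g ih =>
    obtain ⟨R₁, rfl, h₁⟩ := ih
    obtain ⟨R, rfl⟩ := Ipomset.exists_rep R
    obtain ⟨i, j, g⟩ := Ipomset.isGlue_mk.1 g
    refine ⟨R, rfl, h₁.glue (hasTrack_ilo _ (⟨W, y, 𝟙 W⟩ : A.free.obj W) (𝟙 W) d
      (isSrc_terminator d) (isTgt_terminator d hd) ?_ ?_) g⟩ <;> rw [id_le]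
    · exact A.free.refl _
    · have := Move.down d hd e (𝟙 V)
      rw [Category.id_comp] at this
      exact .single this

/-- `n` is reached by a relaxed run with ipomset `P`. -/
def Relaxed (P : Ipomset α) {U : Word α} (n : A.free.obj U) : Prop :=
  ∃ R W, Ipomset.mk R = P ∧ (∃ x ∈ A.start, A.Reach x.2 n.2.1 (Ipomset.mk W)) ∧ IsSnapshot R W n.2.2

/-- A move prolongs the run W of the graph and leaves the observed iposet R as it is. -/
theorem Relaxed.move {P : Ipomset α} {U : Word α} {n n' : A.free.obj U} (h : Relaxed P n)
    (k : A.Move n n') : Relaxed P n' := by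
  obtain ⟨R, W, hR, ⟨x, hx, r⟩, s⟩ := h
  cases k with
  | up e he h d =>
    obtain ⟨W', hW'⟩ := r.hasWords.exists_isGlue (Ipomset.hasWords_starter e he)
    obtain ⟨W', rfl⟩ := Ipomset.exists_rep W'
    obtain ⟨i, j, g⟩ := Ipomset.isGlue_mk.1 hW'
    exact ⟨R, W', hR, ⟨x, hx, .up e he r h hW'⟩, s.start_right he g⟩
  | down e he h d =>
    obtain ⟨W', hW'⟩ := r.hasWords.exists_isGlue (Ipomset.hasWords_terminator e he)
    obtain ⟨W', rfl⟩ := Ipomset.exists_rep W'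
    obtain ⟨i, j, g⟩ := Ipomset.isGlue_mk.1 hW'
    exact ⟨R, W', hR, ⟨x, hx, .down e he r h hW'⟩, s.terminate_right he g⟩

theorem Relaxed.le {P : Ipomset α} {U : Word α} {n n' : A.free.obj U} (h : Relaxed P n)
    (k : A.free.le n n') : Relaxed P n' := by
  induction k with
  | refl => exact h
  | tail _ k ih => exact ih.move k

open PreorderPresheaf in
-- The invariant is carried by the top value of the current cell. On an up-step, strictness on lower
-- faces makes the old top value exactly a face of the new one. On a down-step, the face of the old
-- top value lies below the new one, and the moves between them are added to the run.
theorem relaxed_of_reach {U V : Word α} {x : A.hda.toSTGraph.node U} {y : A.hda.toSTGraph.node V}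
    {P : Ipomset α} (h : A.hda.toSTGraph.Reach x y P) (hx : ⟨U, x⟩ ∈ A.hda.start) :
    Relaxed P (ofNode y).top := by
  induction h with
  | nil =>
    obtain ⟨n, ⟨⟨U', q⟩, hq, ⟨⟩⟩, hle⟩ := hx
    exact Relaxed.le ⟨_, _, rfl, ⟨_, hq, .nil⟩, isSnapshot_id U⟩ hle
  | @up V W d hd y z P R _ e g ih =>
    obtain ⟨R₁, W₁, rfl, hr, hs⟩ := ih
    obtain ⟨R, rfl⟩ := Ipomset.exists_rep R
    obtain ⟨i, j, g⟩ := Ipomset.isGlue_mk.1 g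
    have e' : (ofNode y).top = A.free.map d (ofNode z).top := by
      rw [show y = _ from e]
      erw [ofNode_map, Nerve.top_face_lower d hd]
    rw [e'] at hr hs
    exact ⟨R, W₁, rfl, hr, hs.start_left hd g⟩
  | @down V W d hd y z P R _ e g ih =>
    obtain ⟨R₁, W₁, rfl, hr, hs⟩ := ih
    obtain ⟨R, rfl⟩ := Ipomset.exists_rep R
    obtain ⟨i, j, g⟩ := Ipomset.isGlue_mk.1 g
    have e' : A.free.le (A.free.map d (ofNode y).top) (ofNode z).top := by
      rw [show z = _ from e]
      erw [ofNode_map]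
      exact Nerve.le_top_face d _
    exact Relaxed.le ⟨R, W₁, rfl, hr, hs.terminate_left hd g⟩ e'

variable (A) in
-- An accepting state is reached with the identity as its face, where a snapshot is a subsumption;
-- this gives one inclusion. For the other, the lax track of a run is pulled back to an interval
-- ipomset below it and realised in the nerve.
theorem lang_hda : A.hda.lang = Ipomset.down A.lang := by
  ext P
  constructor
  · intro hP
    rw [← HDA.lang_toSTGraph] at hP
    obtain ⟨⟨U, x⟩, hx, ⟨V, y⟩, ⟨n, ⟨⟨V', q⟩, hq, ⟨⟩⟩, hle⟩, h⟩ := hP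
    obtain ⟨R, W, rfl, ⟨z, hz, hr⟩, hs⟩ := (relaxed_of_reach h hx).le hle
    exact ⟨h.isInterval, Ipomset.mk W, ⟨z, hz, _, hq, hr⟩, hs.subsu⟩
  · rintro ⟨hP, Q, ⟨x, hx, y, hy, h⟩, hPQ⟩
    obtain ⟨P, rfl⟩ := Ipomset.exists_rep P
    obtain ⟨R, rfl, ht⟩ := h.hasTrack
    exact PreorderPresheaf.mem_lang_nerve (Ipomset.isInterval_mk.1 hP) (ht.subsu hPQ)
      ⟨x, hx, rfl⟩ ⟨y, hy, rfl⟩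

theorem isRegular_down_lang (A : STGraph.{u, v} α) : IsRegular (Ipomset.down A.lang) :=
  ⟨A.hda, A.lang_hda⟩

end STGraph

end

section

open Word (Coface)

open TrackCell Iposet

/-! ### Parallel composition of HDAs -/

/-- A decomposition of the word `U` as the concatenation of `V` and `W`. -/
structure Split (U V W : Word α) where
  emb : Fin U.length → Fin V.length ⊕ Fin W.length
  strict : ∀ k l, k < l → Sum.Lex (· < ·) (· < ·) (emb k) (emb l)
  label : ∀ k, Sum.elim V.label W.label (emb k) = U.label k
  surj : Function.Surjective emb

namespace Split

variable {U U' V W : Word α}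

theorem lt_of_lex (s : Split U V W) {k l : Fin U.length}
    (h : Sum.Lex (· < ·) (· < ·) (s.emb k) (s.emb l)) : k < l := by
  by_contra hkl
  rcases (not_lt.1 hkl).eq_or_lt with e | e
  · subst e
    exact irrefl_of (Sum.Lex (· < ·) (· < ·)) _ h
  · exact irrefl_of (Sum.Lex (· < ·) (· < ·)) _ (trans_of (Sum.Lex (· < ·) (· < ·)) h (s.strict _ _ e))

theorem injective (s : Split U V W) : Function.Injective s.emb := by
  intro k l e
  rcases lt_trichotomy k l with h | h | h
  · exact absurd (e ▸ s.strict _ _ h) (irrefl_of (Sum.Lex (· < ·) (· < ·)) _)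
  · exact h
  · exact absurd (e ▸ s.strict _ _ h) (irrefl_of (Sum.Lex (· < ·) (· < ·)) _)

theorem word_eq (s : Split U V W) (s' : Split U' V W) : U = U' := by
  have ex : ∀ k, ∃ l, s'.emb l = s.emb k := fun k => s'.surj _
  choose f hf using ex
  refine Word.ext_of_strictMono f (fun k l h => s'.lt_of_lex ?_) (fun l => ?_) fun k => ?_
  · rw [hf, hf]
    exact s.strict _ _ h
  · obtain ⟨k, e⟩ := s.surj (s'.emb l)
    exact ⟨k, s'.injective ((hf k).trans e)⟩
  · rw [← s'.label, hf, s.label]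

end Split

/-- The target cell of a subsumption into a parallel composition splits accordingly. -/
theorem map_tgt_par {R P Q : Iposet α} {U V W : Word α} {f : R.carrier ≃ (P.par Q).carrier}
    (hf : IsSubsumption R (P.par Q) f) {tR : TrackCell R U} (hR : tR.IsTgt) {tP : TrackCell P V}
    (hP : tP.IsTgt) {tQ : TrackCell Q W} (hQ : tQ.IsTgt) (s : Split U V W) (k) :
    f (tR.emb k) = Sum.map tP.emb tQ.emb (s.emb k) := by
  have tgt : ∀ x, x ∈ (P.par Q).tgt ↔ ∃ y, Sum.map tP.emb tQ.emb y = x := by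
    rintro (p | q)
    · refine ⟨fun h => ?_, ?_⟩
      · obtain ⟨k, rfl⟩ := hP.exists_emb h
        exact ⟨.inl k, rfl⟩
      · rintro ⟨k | k, e⟩
        · exact Sum.inl_injective e ▸ hP.emb_mem k
        · simp at e
    · refine ⟨fun h => ?_, ?_⟩
      · obtain ⟨k, rfl⟩ := hQ.exists_emb h
        exact ⟨.inr k, rfl⟩
      · rintro ⟨k | k, e⟩
        · simp at e
        · exact Sum.inr_injective e ▸ hQ.emb_mem k
  -- The split assembles the end cells of P and Q into an end cell of the parallel composition, and
  -- an end cell is unique.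
  let c : TrackCell (P.par Q) U :=
    { emb := fun k => Sum.map tP.emb tQ.emb (s.emb k)
      unstarted := ∅
      terminated := (P.par Q).tgtᶜ
      label_emb := fun k => by
        rw [← s.label]
        rcases s.emb k with l | l
        · exact tP.label_emb l
        · exact tQ.label_emb l
      evord_emb := fun k l h => by
        have := s.strict k l h
        generalize s.emb k = a at this
        generalize s.emb l = b at this
        cases this with
        | inl h => exact .inl (tP.evord_emb _ _ h)
        | inr h => exact .inr (tQ.evord_emb _ _ h)
        | sep => exact .sep _ _
      disjoint := fun _ h => h.elim
      union_iff := fun x => by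
        rw [Set.mem_compl_iff, tgt]
        push Not
        simp only [Set.mem_empty_iff_false, false_or]
        exact ⟨fun h k => h _, fun h y e => by
          obtain ⟨k, rfl⟩ := s.surj y
          exact h k e⟩
      prec_closed := fun x y h => .inl fun hx => (P.par Q).tgt_maximal _ hx _ h }
  have hc : c.IsTgt := ⟨fun x => Iff.rfl, rfl⟩
  exact congrFun (congrArg TrackCell.emb ((hR.mapSubsu hf).eq hc)) k

/-- Lax interchange of gluing with steps and parallel composition. -/
theorem interchange {R P Q R' P' Q' : Iposet α} {U V W U' V' W' : Word α}
    {f : R.carrier ≃ (P.par Q).carrier} (hf : IsSubsumption R (P.par Q) f)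
    {A B : Set (Fin U'.length)} {A₁ B₁ : Set (Fin V'.length)} {A₂ B₂ : Set (Fin W'.length)}
    {i j i₁ j₁ i₂ j₂} (g : IsGluing R (U'.ilo A B) R' i j) (g₁ : IsGluing P (V'.ilo A₁ B₁) P' i₁ j₁)
    (g₂ : IsGluing Q (W'.ilo A₂ B₂) Q' i₂ j₂) (s : Split U V W) (s' : Split U' V' W')
    (hB : ∀ k, k ∈ B ↔ Sum.elim (· ∈ B₁) (· ∈ B₂) (s'.emb k))
    {d : U ⟶ U'} {d₁ : V ⟶ V'} {d₂ : W ⟶ W'}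
    (hd : (ofCoface A B d).IsSrc) (hd₁ : (ofCoface A₁ B₁ d₁).IsSrc)
    (hd₂ : (ofCoface A₂ B₂ d₂).IsSrc)
    (compat : ∀ k, s'.emb (Coface.emb d k) = Sum.map (Coface.emb d₁) (Coface.emb d₂) (s.emb k)) :
    Subsu R' (P'.par Q') := by
  obtain ⟨U₀, tR, hR⟩ := TrackCell.exists_isTgt R
  obtain ⟨V₀, tP, hP⟩ := TrackCell.exists_isTgt P
  obtain ⟨W₀, tQ, hQ⟩ := TrackCell.exists_isTgt Q
  obtain rfl := g.middle_word hR hd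
  obtain rfl := g₁.middle_word hP hd₁
  obtain rfl := g₂.middle_word hQ hd₂
  have hm : ∀ k, i (tR.emb k) = j (Coface.emb d k) := g.middle_eq hR hd
  have hm₁ : ∀ k, i₁ (tP.emb k) = j₁ (Coface.emb d₁ k) := g₁.middle_eq hP hd₁
  have hm₂ : ∀ k, i₂ (tQ.emb k) = j₂ (Coface.emb d₂ k) := g₂.middle_eq hQ hd₂
  have hT := map_tgt_par hf hR hP hQ s
  -- `G` places the old points and `K` the events of the step; they meet exactly in the glued
  -- interface.
  let G : R.carrier → (P'.par Q').carrier := fun a => Sum.map i₁ i₂ (f a)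
  let K : Fin U'.length → (P'.par Q').carrier := fun k => Sum.map j₁ j₂ (s'.emb k)
  have Kinj : Function.Injective K := (g₁.inj_right.sumMap g₂.inj_right).comp s'.injective
  have GK : ∀ k, G (tR.emb k) = K (Coface.emb d k) := fun k => by
    change Sum.map i₁ i₂ (f (tR.emb k)) = Sum.map j₁ j₂ (s'.emb (Coface.emb d k))
    rw [hT, compat]
    rcases s.emb k with l | l
    · exact congrArg Sum.inl (hm₁ l)
    · exact congrArg Sum.inr (hm₂ l)
  have GKt : ∀ a k, G a = K k → a ∈ R.tgt := fun a k e => by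
    rw [hf.tgt_iff]
    change Sum.map i₁ i₂ (f a) = Sum.map j₁ j₂ (s'.emb k) at e
    revert e
    generalize f a = x
    rcases x with p | q <;> rcases s'.emb k with l | l <;> intro e
    · exact (g₁.overlap (Sum.inl_injective e)).1
    · exact absurd e Sum.inl_ne_inr
    · exact absurd e Sum.inr_ne_inl
    · exact (g₂.overlap (Sum.inr_injective e)).1
  suffices h : ∃ F : R'.carrier ≃ (P'.par Q').carrier, IsSubsumption R' (P'.par Q') F ∧
      (∀ p, F (i p) = G p) ∧ ∀ q, F (j q) = K q from ⟨h.choose, h.choose_spec.1⟩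
  -- In general only a subsumption: gluing before splitting also orders terminated points of one
  -- component before new events of the other.
  refine g.subsu (Z := P'.par Q') G K
    ((g₁.inj_left.sumMap g₂.inj_left).comp f.injective) Kinj ?_ ?_ ?_ ?_ ?_ ?_ ?_ ?_ ?_ ?_ ?_
  · rintro (p | q)
    · rcases g₁.cover p with ⟨a, rfl⟩ | ⟨l, rfl⟩
      · exact .inl ⟨f.symm (.inl a), congrArg (Sum.map i₁ i₂) (f.apply_symm_apply _)⟩
      · obtain ⟨k, e⟩ := s'.surj (.inl l)
        exact .inr ⟨k, congrArg (Sum.map j₁ j₂) e⟩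
    · rcases g₂.cover q with ⟨a, rfl⟩ | ⟨l, rfl⟩
      · exact .inl ⟨f.symm (.inr a), congrArg (Sum.map i₁ i₂) (f.apply_symm_apply _)⟩
      · obtain ⟨k, e⟩ := s'.surj (.inr l)
        exact .inr ⟨k, congrArg (Sum.map j₁ j₂) e⟩
  · intro a k
    constructor
    · intro e
      obtain ⟨l, rfl⟩ := hR.exists_emb (GKt a k e)
      rw [hm, ← Kinj ((GK l).symm.trans e)]
    · intro e
      obtain ⟨l, rfl⟩ := hR.exists_emb (g.overlap e).1
      rw [GK, g.inj_right ((hm l).symm.trans e)]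
  · intro a
    rw [← hf.label_eq]
    change (P'.par Q').label (Sum.map i₁ i₂ (f a)) = _
    generalize f a = x
    rcases x with p | q
    · exact g₁.label_left p
    · exact g₂.label_left q
  · intro k
    change (P'.par Q').label (Sum.map j₁ j₂ (s'.emb k)) = U'.label k
    refine Eq.trans ?_ (s'.label k)
    generalize s'.emb k = x
    rcases x with l | l
    · exact g₁.label_right l
    · exact g₂.label_right l
  · have : ∀ r, r ∈ (P'.par Q').src ↔ ∃ x ∈ (P.par Q).src, Sum.map i₁ i₂ x = r := by
      rintro (p | q)
      · refine (g₁.src_iff p).trans ⟨fun ⟨a, ha, e⟩ => ⟨.inl a, ha, congrArg Sum.inl e⟩, ?_⟩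
        rintro ⟨a | a, ha, e⟩
        · exact ⟨a, ha, Sum.inl_injective e⟩
        · exact absurd e Sum.inr_ne_inl
      · refine (g₂.src_iff q).trans ⟨fun ⟨a, ha, e⟩ => ⟨.inr a, ha, congrArg Sum.inr e⟩, ?_⟩
        rintro ⟨a | a, ha, e⟩
        · exact absurd e Sum.inl_ne_inr
        · exact ⟨a, ha, Sum.inr_injective e⟩
    intro r
    rw [this]
    constructor
    · rintro ⟨x, hx, rfl⟩
      exact ⟨f.symm x, by simpa [hf.src_iff] using hx,
        congrArg (Sum.map i₁ i₂) (f.apply_symm_apply _)⟩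
    · rintro ⟨a, ha, rfl⟩
      exact ⟨f a, (hf.src_iff a).1 ha, rfl⟩
  · have : ∀ r, r ∈ (P'.par Q').tgt ↔
        ∃ x, Sum.elim (· ∈ B₁) (· ∈ B₂) x ∧ Sum.map j₁ j₂ x = r := by
      rintro (p | q)
      · refine (g₁.tgt_iff p).trans ⟨fun ⟨a, ha, e⟩ => ⟨.inl a, ha, congrArg Sum.inl e⟩, ?_⟩
        rintro ⟨a | a, ha, e⟩
        · exact ⟨a, ha, Sum.inl_injective e⟩
        · exact absurd e Sum.inr_ne_inl
      · refine (g₂.tgt_iff q).trans ⟨fun ⟨a, ha, e⟩ => ⟨.inr a, ha, congrArg Sum.inr e⟩, ?_⟩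
        rintro ⟨a | a, ha, e⟩
        · exact absurd e Sum.inl_ne_inr
        · exact ⟨a, ha, Sum.inr_injective e⟩
    intro r
    rw [this]
    constructor
    · rintro ⟨x, hx, rfl⟩
      obtain ⟨k, rfl⟩ := s'.surj x
      exact ⟨k, (hB k).2 hx, rfl⟩
    · rintro ⟨k, hk, rfl⟩
      exact ⟨s'.emb k, (hB k).1 hk, rfl⟩
  · intro a b h
    apply hf.prec_of
    change Sum.LiftRel _ _ (Sum.map i₁ i₂ (f a)) (Sum.map i₁ i₂ (f b)) at h
    revert h
    generalize f a = x
    generalize f b = y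
    rcases x with p | q <;> rcases y with p' | q' <;> rintro (h | h)
    · exact .inl (g₁.prec_left.1 h)
    · exact .inr (g₂.prec_left.1 h)
  · intro a b h
    change Sum.LiftRel _ _ (Sum.map j₁ j₂ (s'.emb a)) (Sum.map j₁ j₂ (s'.emb b)) at h
    revert h
    rcases s'.emb a with p | q <;> rcases s'.emb b with p' | q' <;> rintro (h | h)
    · exact g₁.prec_right.1 h
    · exact g₂.prec_right.1 h
  · intro a k _ _ h
    change Sum.LiftRel _ _ (Sum.map j₁ j₂ (s'.emb k)) (Sum.map i₁ i₂ (f a)) at h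
    revert h
    generalize f a = x
    rcases s'.emb k with p | q <;> rcases x with p' | q' <;> rintro (h | h)
    · exact g₁.not_prec _ _ h
    · exact g₂.not_prec _ _ h
  · intro a b h h1 h2
    have h3 := hf.evord_of _ _ h h1 h2
    have h4 := fun k => h1 (hf.prec_of a b k)
    have h5 := fun k => h2 (hf.prec_of b a k)
    change Sum.Lex _ _ (Sum.map i₁ i₂ (f a)) (Sum.map i₁ i₂ (f b))
    revert h3 h4 h5
    generalize f a = x
    generalize f b = y
    rcases x with p | q <;> rcases y with p' | q' <;> rintro (h3 | h3 | _) h4 h5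
    · exact .inl (g₁.evord_left h3 (fun k => h4 (.inl k)) fun k => h5 (.inl k))
    · exact .sep _ _
    · exact .inr (g₂.evord_left h3 (fun k => h4 (.inr k)) fun k => h5 (.inr k))
  · intro a b h _ _
    have h3 := s'.strict a b h
    change Sum.Lex _ _ (Sum.map j₁ j₂ (s'.emb a)) (Sum.map j₁ j₂ (s'.emb b))
    revert h3
    rcases s'.emb a with p | q <;> rcases s'.emb b with p' | q' <;> rintro (h3 | h3 | _)
    · exact .inl (g₁.evord_right h3 id id)
    · exact .sep _ _
    · exact .inr (g₂.evord_right h3 id id)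

end

/-! ### Tensor products of HDAs and tracks of parallel compositions. -/

section

open Word (Coface)

open TrackCell Iposet

/-- The tensor product of two HDAs: pairs of cells, with the concatenation of their words. -/
def HDA.tensor (X Y : HDA α) : STGraph.{u, u} α where
  node U := {p : X.Cell × Y.Cell // Nonempty (Split U p.1.1 p.2.1)}
  finite := by
    have := X.finite
    have := Y.finite
    refine Finite.of_injective (β := X.Cell × Y.Cell) (fun n => n.2.1) ?_
    rintro ⟨U, p, ⟨s⟩⟩ ⟨U', p', ⟨s'⟩⟩ e
    obtain rfl : p = p' := e
    obtain rfl := s.word_eq s'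
    rfl
  up {U U'} d n n' := ∃ (s : Split U n.1.1.1 n.1.2.1) (s' : Split U' n'.1.1.1 n'.1.2.1)
    (d₁ : n.1.1.1 ⟶ n'.1.1.1) (d₂ : n.1.2.1 ⟶ n'.1.2.1),
    (∀ k, s'.emb (Coface.emb d k) = Sum.map (Coface.emb d₁) (Coface.emb d₂) (s.emb k)) ∧
    Coface.terminated d₁ = ∅ ∧ Coface.terminated d₂ = ∅ ∧
    n.1.1.2 = X.presheaf.map d₁.op n'.1.1.2 ∧ n.1.2.2 = Y.presheaf.map d₂.op n'.1.2.2
  down {U U'} d n' n := ∃ (s : Split U n.1.1.1 n.1.2.1) (s' : Split U' n'.1.1.1 n'.1.2.1)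
    (d₁ : n.1.1.1 ⟶ n'.1.1.1) (d₂ : n.1.2.1 ⟶ n'.1.2.1),
    (∀ k, s'.emb (Coface.emb d k) = Sum.map (Coface.emb d₁) (Coface.emb d₂) (s.emb k)) ∧
    Coface.unstarted d₁ = ∅ ∧ Coface.unstarted d₂ = ∅ ∧
    n.1.1.2 = X.presheaf.map d₁.op n'.1.1.2 ∧ n.1.2.2 = Y.presheaf.map d₂.op n'.1.2.2
  start := {n | n.2.1.1 ∈ X.start ∧ n.2.1.2 ∈ Y.start}
  accept := {n | n.2.1.1 ∈ X.accept ∧ n.2.1.2 ∈ Y.accept}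

theorem Split.subsu {U V W : Word α} (s : Split U V W) :
    Subsu (U.ilo Set.univ Set.univ)
      ((V.ilo Set.univ Set.univ).par (W.ilo Set.univ Set.univ)) := by
  refine ⟨Equiv.ofBijective s.emb ⟨s.injective, s.surj⟩, fun k => ?_, fun k => ?_, s.label, ?_,
    fun k l h _ _ => s.strict k l h⟩
  · refine iff_of_true trivial ?_
    change s.emb k ∈ ((V.ilo Set.univ Set.univ).par (W.ilo Set.univ Set.univ)).src
    generalize s.emb k = x
    rcases x with x | x <;> trivial
  · refine iff_of_true trivial ?_
    change s.emb k ∈ ((V.ilo Set.univ Set.univ).par (W.ilo Set.univ Set.univ)).tgt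
    generalize s.emb k = x
    rcases x with x | x <;> trivial
  · intro k l h
    change Sum.LiftRel (fun _ _ => False) (fun _ _ => False) (s.emb k) (s.emb l) at h
    generalize s.emb k = x at h
    generalize s.emb l = y at h
    cases h <;> contradiction

/-- If nothing is unstarted, the events that survive are the range of the coface map, and ranges are
compared componentwise through the splits. -/
theorem Split.mem_terminated_iff {U V W U' V' W' : Word α} (s : Split U V W)
    (s' : Split U' V' W') {d : U ⟶ U'} {d₁ : V ⟶ V'} {d₂ : W ⟶ W'}
    (compat : ∀ k, s'.emb (Coface.emb d k) = Sum.map (Coface.emb d₁) (Coface.emb d₂) (s.emb k))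
    (hd : Coface.unstarted d = ∅) (hd₁ : Coface.unstarted d₁ = ∅)
    (hd₂ : Coface.unstarted d₂ = ∅) (k : Fin U'.length) :
    k ∈ (Coface.terminated d)ᶜ ↔
      Sum.elim (· ∈ (Coface.terminated d₁)ᶜ) (· ∈ (Coface.terminated d₂)ᶜ) (s'.emb k) := by
  have mem : ∀ {U V : Word α} (d : U ⟶ V), Coface.unstarted d = ∅ → ∀ k,
      k ∈ (Coface.terminated d)ᶜ ↔ ∃ l, Coface.emb d l = k := fun d hd k => by
    have := Coface.emb_mem d k
    rw [hd] at this
    simp only [Set.mem_empty_iff_false, false_or] at this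
    rw [Set.mem_compl_iff, this]
    simp
  rw [mem d hd]
  rcases e : s'.emb k with v | v
  · simp only [Sum.elim_inl]
    rw [mem d₁ hd₁]
    constructor
    · rintro ⟨l, rfl⟩
      rw [compat] at e
      generalize s.emb l = x at e
      rcases x with x | x
      · exact ⟨x, Sum.inl_injective e⟩
      · exact absurd e Sum.inr_ne_inl
    · rintro ⟨l, rfl⟩
      obtain ⟨l', e'⟩ := s.surj (.inl l)
      exact ⟨l', s'.injective (by rw [compat, e', e]; rfl)⟩
  · simp only [Sum.elim_inr]
    rw [mem d₂ hd₂]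
    constructor
    · rintro ⟨l, rfl⟩
      rw [compat] at e
      generalize s.emb l = x at e
      rcases x with x | x
      · exact absurd e Sum.inl_ne_inr
      · exact ⟨x, Sum.inr_injective e⟩
    · rintro ⟨l, rfl⟩
      obtain ⟨l', e'⟩ := s.surj (.inr l)
      exact ⟨l', s'.injective (by rw [compat, e', e]; rfl)⟩

/-- Paths in a tensor product are subsumed by parallel compositions of paths. -/
theorem HDA.exists_of_reach_tensor {X Y : HDA α} {U U' : Word α} {n : (X.tensor Y).node U}
    {n' : (X.tensor Y).node U'} {R : Ipomset α} (h : (X.tensor Y).Reach n n' R) :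
    ∃ P Q : Iposet α, X.toSTGraph.Reach n.1.1.2 n'.1.1.2 (Ipomset.mk P) ∧
      Y.toSTGraph.Reach n.1.2.2 n'.1.2.2 (Ipomset.mk Q) ∧ R.Subsu (Ipomset.mk (P.par Q)) := by
  induction h with
  | nil => exact ⟨_, _, .nil, .nil, n.2.some.subsu⟩
  | up d hd _ e g ih =>
    rename_i R R' _
    obtain ⟨P, Q, hP, hQ, hf⟩ := ih
    obtain ⟨R, rfl⟩ := Ipomset.exists_rep R
    obtain ⟨R', rfl⟩ := Ipomset.exists_rep R'
    obtain ⟨f, hf⟩ := Ipomset.subsu_mk.1 hf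
    obtain ⟨s, s', d₁, d₂, compat, hd₁, hd₂, e₁, e₂⟩ := e
    obtain ⟨P', hP'⟩ := hP.hasWords.exists_isGlue (Ipomset.hasWords_starter d₁ hd₁)
    obtain ⟨Q', hQ'⟩ := hQ.hasWords.exists_isGlue (Ipomset.hasWords_starter d₂ hd₂)
    obtain ⟨P', rfl⟩ := Ipomset.exists_rep P'
    obtain ⟨Q', rfl⟩ := Ipomset.exists_rep Q'
    refine ⟨P', Q', .up d₁ hd₁ hP e₁ hP', .up d₂ hd₂ hQ e₂ hQ', ?_⟩
    obtain ⟨i, j, g⟩ := Ipomset.isGlue_mk.1 g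
    obtain ⟨i₁, j₁, g₁⟩ := Ipomset.isGlue_mk.1 hP'
    obtain ⟨i₂, j₂, g₂⟩ := Ipomset.isGlue_mk.1 hQ'
    refine interchange hf g g₁ g₂ s s' (fun k => iff_of_true trivial ?_) (isSrc_starter d hd)
      (isSrc_starter d₁ hd₁) (isSrc_starter d₂ hd₂) compat
    rcases s'.emb k with l | l <;> trivial
  | down d hd _ e g ih =>
    rename_i R R' _
    obtain ⟨P, Q, hP, hQ, hf⟩ := ih
    obtain ⟨R, rfl⟩ := Ipomset.exists_rep R
    obtain ⟨R', rfl⟩ := Ipomset.exists_rep R'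
    obtain ⟨f, hf⟩ := Ipomset.subsu_mk.1 hf
    obtain ⟨s, s', d₁, d₂, compat, hd₁, hd₂, e₁, e₂⟩ := e
    obtain ⟨P', hP'⟩ := hP.hasWords.exists_isGlue (Ipomset.hasWords_terminator d₁ hd₁)
    obtain ⟨Q', hQ'⟩ := hQ.hasWords.exists_isGlue (Ipomset.hasWords_terminator d₂ hd₂)
    obtain ⟨P', rfl⟩ := Ipomset.exists_rep P'
    obtain ⟨Q', rfl⟩ := Ipomset.exists_rep Q'
    refine ⟨P', Q', .down d₁ hd₁ hP e₁ hP', .down d₂ hd₂ hQ e₂ hQ', ?_⟩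
    obtain ⟨i, j, g⟩ := Ipomset.isGlue_mk.1 g
    obtain ⟨i₁, j₁, g₁⟩ := Ipomset.isGlue_mk.1 hP'
    obtain ⟨i₂, j₂, g₂⟩ := Ipomset.isGlue_mk.1 hQ'
    -- The source of a terminator is its whole word, so the source maps are identities and `s'`
    -- serves on both sides.
    refine interchange hf g g₁ g₂ s' s' (s.mem_terminated_iff s' compat hd hd₁ hd₂)
      (isSrc_terminator d) (isSrc_terminator d₁) (isSrc_terminator d₂) fun k => ?_
    rw [Word.id_emb]
    rcases s'.emb k with l | l <;> rfl

/-- The underlying presheaf of an HDA, with the discrete order. -/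
def HDA.discrete (X : HDA α) : PreorderPresheaf.{u, 0} α where
  obj U := X.presheaf.obj (Opposite.op U)
  map d := X.presheaf.map d.op
  map_map d e x := by simp
  le := Eq
  refl _ := rfl
  trans := Eq.trans
  map_le d _ _ := congrArg _

theorem HDA.discrete_map_id (X : HDA α) {U : Word α} (x : X.discrete.obj U) :
    X.discrete.map (𝟙 U) x = x := by
  change X.presheaf.map (𝟙 U).op x = x
  rw [op_id, X.presheaf.map_id]
  rfl

/-- For the discrete order lax means strict, so a path with ipomset P extends to a presheaf morphism
from the whole track object of P to X. -/
theorem HDA.hasTrack_of_reach {X : HDA α} {U V : Word α} {x : X.toSTGraph.node U}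
    {y : X.toSTGraph.node V} {P : Iposet α} (h : X.toSTGraph.Reach x y (Ipomset.mk P)) :
    HasTrack X.discrete P x y := by
  generalize e : Ipomset.mk P = P' at h
  induction h generalizing P with
  | nil =>
    exact (hasTrack_ilo X.discrete x (𝟙 U) (𝟙 U) (isSrc_id U) (isTgt_id U)
      (X.discrete_map_id x).symm (X.discrete_map_id x)).subsu (Ipomset.mk_eq.1 e).subsu
  | @up V W d hd y z Q R _ hyz g ih =>
    subst e
    obtain ⟨Q, rfl⟩ := Ipomset.exists_rep Q
    obtain ⟨i, j, g⟩ := Ipomset.isGlue_mk.1 g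
    exact (ih rfl).glue (hasTrack_ilo X.discrete z d (𝟙 W) (isSrc_starter d hd) (isTgt_starter d)
      hyz (X.discrete_map_id z)) g
  | @down V W d hd y z Q R _ hyz g ih =>
    subst e
    obtain ⟨Q, rfl⟩ := Ipomset.exists_rep Q
    obtain ⟨i, j, g⟩ := Ipomset.isGlue_mk.1 g
    exact (ih rfl).glue (hasTrack_ilo X.discrete y (𝟙 W) d (isSrc_terminator d)
      (isTgt_terminator d hd) (X.discrete_map_id y).symm (Eq.symm hyz)) g

/-- The two components of a cell of a parallel composition. -/
structure ParCell {P Q : Iposet α} {U : Word α} (c : TrackCell (P.par Q) U) where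
  V : Word α
  W : Word α
  left : TrackCell P V
  right : TrackCell Q W
  split : Split U V W
  emb : ∀ k, Sum.map left.emb right.emb (split.emb k) = c.emb k
  unstarted_left : left.unstarted = Sum.inl ⁻¹' c.unstarted
  unstarted_right : right.unstarted = Sum.inr ⁻¹' c.unstarted
  terminated_left : left.terminated = Sum.inl ⁻¹' c.terminated
  terminated_right : right.terminated = Sum.inr ⁻¹' c.terminated

namespace ParCell

variable {P Q : Iposet α} {U U' : Word α}

theorem nonempty (c : TrackCell (P.par Q) U) : Nonempty (ParCell c) := by
  obtain ⟨V, a, a1, a2⟩ := TrackCell.exists_cell P (Sum.inl ⁻¹' c.unstarted)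
    (Sum.inl ⁻¹' c.terminated) (fun x => c.disjoint _) fun x y h => c.prec_closed _ _ (.inl h)
  obtain ⟨W, b, b1, b2⟩ := TrackCell.exists_cell Q (Sum.inr ⁻¹' c.unstarted)
    (Sum.inr ⁻¹' c.terminated) (fun x => c.disjoint _) fun x y h => c.prec_closed _ _ (.inr h)
  have ex : ∀ k, ∃ y, Sum.map a.emb b.emb y = c.emb k := fun k => by
    obtain ⟨h1, h2⟩ := c.emb_not_mem k
    revert h1 h2
    generalize c.emb k = x
    intro h1 h2
    rcases x with x | x
    · obtain ⟨l, rfl⟩ := a.exists_emb (x := x) (a1 ▸ h1) (a2 ▸ h2)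
      exact ⟨.inl l, rfl⟩
    · obtain ⟨l, rfl⟩ := b.exists_emb (x := x) (b1 ▸ h1) (b2 ▸ h2)
      exact ⟨.inr l, rfl⟩
  have inj : Function.Injective (Sum.map a.emb b.emb) := a.emb_injective.sumMap b.emb_injective
  choose e he using ex
  refine ⟨⟨V, W, a, b, ⟨e, fun k l h => ?_, fun k => ?_, fun y => ?_⟩, he, a1, b1, a2, b2⟩⟩
  · have h' := c.evord_emb k l h
    rw [← he, ← he] at h'
    change Sum.Lex _ _ _ _ at h'
    revert h'
    rcases e k with x | x <;> rcases e l with y | y <;> rintro (h' | h' | _)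
    · exact .inl (a.emb_lt_iff.1 h')
    · exact .sep _ _
    · exact .inr (b.emb_lt_iff.1 h')
  · rw [← c.label_emb, ← he]
    rcases e k with x | x
    · exact (a.label_emb x).symm
    · exact (b.label_emb x).symm
  · have : ∃ k, c.emb k = Sum.map a.emb b.emb y := by
      rcases y with y | y
      · exact c.exists_emb (fun h => (a.emb_not_mem y).1 (a1 ▸ h))
          fun h => (a.emb_not_mem y).2 (a2 ▸ h)
      · exact c.exists_emb (fun h => (b.emb_not_mem y).1 (b1 ▸ h))
          fun h => (b.emb_not_mem y).2 (b2 ▸ h)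
    obtain ⟨k, hk⟩ := this
    exact ⟨k, inj ((he k).trans hk)⟩

theorem exists_faces {c : TrackCell (P.par Q) U'} {c' : TrackCell (P.par Q) U} {d : U ⟶ U'}
    (h : c' = c.face d) (p : ParCell c) (p' : ParCell c') :
    ∃ (d₁ : p'.V ⟶ p.V) (d₂ : p'.W ⟶ p.W), p'.left = p.left.face d₁ ∧
      p'.right = p.right.face d₂ ∧
      (∀ k, p.split.emb (Coface.emb d k) =
        Sum.map (Coface.emb d₁) (Coface.emb d₂) (p'.split.emb k)) ∧
      (Coface.terminated d = ∅ → Coface.terminated d₁ = ∅ ∧ Coface.terminated d₂ = ∅) ∧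
      (Coface.unstarted d = ∅ → Coface.unstarted d₁ = ∅ ∧ Coface.unstarted d₂ = ∅) := by
  subst h
  obtain ⟨d₁, e₁, m₁, u₁, t₁⟩ := p.left.exists_face p'.left
    (by rw [p.unstarted_left, p'.unstarted_left]
        exact Set.preimage_mono (c.unstarted_subset_face d))
    (by rw [p.terminated_left, p'.terminated_left]
        exact Set.preimage_mono (c.terminated_subset_face d))
  obtain ⟨d₂, e₂, m₂, u₂, t₂⟩ := p.right.exists_face p'.right
    (by rw [p.unstarted_right, p'.unstarted_right]
        exact Set.preimage_mono (c.unstarted_subset_face d))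
    (by rw [p.terminated_right, p'.terminated_right]
        exact Set.preimage_mono (c.terminated_subset_face d))
  refine ⟨d₁, d₂, e₁, e₂, fun k => ?_, fun hd => ?_, fun hd => ?_⟩
  · apply p.left.emb_injective.sumMap p.right.emb_injective
    rw [p.emb]
    refine (p'.emb k).symm.trans ?_
    rcases p'.split.emb k with l | l
    · exact congrArg Sum.inl (m₁ l).symm
    · exact congrArg Sum.inr (m₂ l).symm
  · have := c.face_terminated d hd
    constructor <;> refine Set.eq_empty_of_forall_notMem fun k hk => ?_
    · rw [t₁, p'.terminated_left, this, ← p.terminated_left] at hk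
      exact (p.left.emb_not_mem k).2 hk
    · rw [t₂, p'.terminated_right, this, ← p.terminated_right] at hk
      exact (p.right.emb_not_mem k).2 hk
  · have : (c.face d).unstarted = c.unstarted := by simp [face, hd]
    constructor <;> refine Set.eq_empty_of_forall_notMem fun k hk => ?_
    · rw [u₁, p'.unstarted_left, this, ← p.unstarted_left] at hk
      exact (p.left.emb_not_mem k).1 hk
    · rw [u₂, p'.unstarted_right, this, ← p.unstarted_right] at hk
      exact (p.right.emb_not_mem k).1 hk

theorem isSrc {c : TrackCell (P.par Q) U} (p : ParCell c) (hc : c.IsSrc) :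
    p.left.IsSrc ∧ p.right.IsSrc := by
  refine ⟨⟨fun x => ?_, ?_⟩, fun x => ?_, ?_⟩
  · rw [p.unstarted_left]
    exact hc.1 _
  · rw [p.terminated_left, hc.2]
    rfl
  · rw [p.unstarted_right]
    exact hc.1 _
  · rw [p.terminated_right, hc.2]
    rfl

theorem isTgt {c : TrackCell (P.par Q) U} (p : ParCell c) (hc : c.IsTgt) :
    p.left.IsTgt ∧ p.right.IsTgt := by
  refine ⟨⟨fun x => ?_, ?_⟩, fun x => ?_, ?_⟩
  · rw [p.terminated_left]
    exact hc.1 _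
  · rw [p.unstarted_left, hc.2]
    rfl
  · rw [p.terminated_right]
    exact hc.1 _
  · rw [p.unstarted_right, hc.2]
    rfl

end ParCell

theorem TrackCell.IsSrc.sigma_eq {F : Word α → Type v} {P : Iposet α}
    (σ : ∀ W : Word α, TrackCell P W → F W) {U V : Word α} {c : TrackCell P U} {c' : TrackCell P V}
    (h : c.IsSrc) (h' : c'.IsSrc) : (⟨U, σ U c⟩ : Σ W, F W) = ⟨V, σ V c'⟩ := by
  obtain rfl := h.word_eq h'
  rw [h.eq h']

theorem TrackCell.IsTgt.sigma_eq {F : Word α → Type v} {P : Iposet α}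
    (σ : ∀ W : Word α, TrackCell P W → F W) {U V : Word α} {c : TrackCell P U} {c' : TrackCell P V}
    (h : c.IsTgt) (h' : c'.IsTgt) : (⟨U, σ U c⟩ : Σ W, F W) = ⟨V, σ V c'⟩ := by
  obtain rfl := h.word_eq h'
  rw [h.eq h']

/-- A cell of R is mapped along the subsumption to `P.par Q`, split into its two components, and
evaluated by the tracks in X and Y. Only R is decomposed into steps; this matters because a parallel
composition of interval iposets need not be interval. -/
theorem HDA.mem_lang_tensor {X Y : HDA α} {R P Q : Iposet α} (hR : R.IsInterval)
    (hP : Ipomset.mk P ∈ X.lang) (hQ : Ipomset.mk Q ∈ Y.lang) (h : Subsu R (P.par Q)) :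
    Ipomset.mk R ∈ (X.tensor Y).lang := by
  rw [← HDA.lang_toSTGraph] at hP hQ
  obtain ⟨x, hx, x', hx', hP⟩ := hP
  obtain ⟨y, hy, y', hy', hQ⟩ := hQ
  obtain ⟨σ, hσ, ⟨s₁, hs₁, ex⟩, t₁, ht₁, ex'⟩ := HDA.hasTrack_of_reach hP
  obtain ⟨τ, hτ, ⟨s₂, hs₂, ey⟩, t₂, ht₂, ey'⟩ := HDA.hasTrack_of_reach hQ
  obtain ⟨f, hf⟩ := h
  let p : ∀ {V : Word α} (c : TrackCell R V), ParCell (c.mapSubsu hf) := fun c =>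
    (ParCell.nonempty (c.mapSubsu hf)).some
  let ρ : ∀ {V : Word α}, TrackCell R V → (X.tensor Y).node V := fun c =>
    ⟨(⟨(p c).V, σ _ (p c).left⟩, ⟨(p c).W, τ _ (p c).right⟩), ⟨(p c).split⟩⟩
  obtain ⟨U, s, hs⟩ := TrackCell.exists_isSrc R
  obtain ⟨V, t, ht⟩ := TrackCell.exists_isTgt R
  refine ⟨⟨U, ρ s⟩, ?_, ⟨V, ρ t⟩, ?_, STGraph.reach_of_track hR ρ ?_ ?_ hs ht⟩
  · obtain ⟨h1, h2⟩ := (p s).isSrc (hs.mapSubsu hf)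
    constructor
    · rw [show (ρ s).1.1 = x from (h1.sigma_eq σ hs₁).trans (Sigma.ext rfl (heq_of_eq ex.symm))]
      exact hx
    · rw [show (ρ s).1.2 = y from (h2.sigma_eq τ hs₂).trans (Sigma.ext rfl (heq_of_eq ey.symm))]
      exact hy
  · obtain ⟨h1, h2⟩ := (p t).isTgt (ht.mapSubsu hf)
    constructor
    · rw [show (ρ t).1.1 = x' from (h1.sigma_eq σ ht₁).trans (Sigma.ext rfl (heq_of_eq ex'))]
      exact hx'
    · rw [show (ρ t).1.2 = y' from (h2.sigma_eq τ ht₂).trans (Sigma.ext rfl (heq_of_eq ey'))]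
      exact hy'
  · intro U V d c hd
    obtain ⟨d₁, d₂, e₁, e₂, e, ht, -⟩ :=
      ParCell.exists_faces (mapSubsu_face hf d c) (p c) (p (c.face d))
    refine ⟨(p (c.face d)).split, (p c).split, d₁, d₂, e, (ht hd).1, (ht hd).2, ?_, ?_⟩
    · exact (congrArg _ e₁).trans (hσ.lax d₁ _).symm
    · exact (congrArg _ e₂).trans (hτ.lax d₂ _).symm
  · intro U V d c hd
    obtain ⟨d₁, d₂, e₁, e₂, e, -, hu⟩ :=
      ParCell.exists_faces (mapSubsu_face hf d c) (p c) (p (c.face d))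
    refine ⟨(p (c.face d)).split, (p c).split, d₁, d₂, e, (hu hd).1, (hu hd).2, ?_, ?_⟩
    · exact (congrArg _ e₁).trans (hσ.lax d₁ _).symm
    · exact (congrArg _ e₂).trans (hτ.lax d₂ _).symm

theorem HDA.parLang_eq (X Y : HDA α) :
    Ipomset.parLang X.lang Y.lang = Ipomset.down (X.tensor Y).lang := by
  ext R
  obtain ⟨R, rfl⟩ := Ipomset.exists_rep R
  constructor
  · rintro ⟨hR, S, ⟨P, hP, Q, hQ, P', Q', rfl, rfl, rfl⟩, h⟩
    exact Ipomset.mem_down_of_mem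
      (HDA.mem_lang_tensor (Ipomset.isInterval_mk.1 hR) hP hQ (Ipomset.subsu_mk.1 h)) hR
  · rintro ⟨hR, S, ⟨n, hn, n', hn', hS⟩, h⟩
    obtain ⟨P, Q, hP, hQ, h'⟩ := HDA.exists_of_reach_tensor hS
    refine ⟨hR, _, ⟨Ipomset.mk P, ?_, Ipomset.mk Q, ?_, P, Q, rfl, rfl, rfl⟩, h.trans h'⟩
    · rw [← HDA.lang_toSTGraph]
      exact ⟨_, hn.1, _, hn'.1, hP⟩
    · rw [← HDA.lang_toSTGraph]
      exact ⟨_, hn.2, _, hn'.2, hQ⟩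

theorem IsRegular.par {L M : Set (Ipomset α)} (hL : IsRegular L) (hM : IsRegular M) :
    IsRegular (Ipomset.parLang L M) := by
  obtain ⟨X, rfl⟩ := hL
  obtain ⟨Y, rfl⟩ := hM
  rw [HDA.parLang_eq]
  exact STGraph.isRegular_down_lang _

end

section

open Word (Coface)

open Iposet

/-! ### Rational languages are regular -/

namespace Ipomset

/-- Discrete ipomsets in which no precedence can be added are minimal for subsumption. -/
theorem eq_of_subsu_ilo {U : Word α} {S T : Set (Fin U.length)}
    (h : ∀ x y, x ∈ T ∨ y ∈ S ∨ x = y) {R : Ipomset α} (hR : R.Subsu (mk (U.ilo S T))) :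
    R = mk (U.ilo S T) := by
  obtain ⟨R, rfl⟩ := exists_rep R
  obtain ⟨f, hf⟩ := subsu_mk.1 hR
  refine mk_eq.2 ⟨f, hf, fun x y => ⟨fun k => ?_, fun k => k.elim⟩⟩
  rcases h (f x) (f y) with e | e | e
  · exact absurd k (R.tgt_maximal _ ((hf.tgt_iff x).2 e) _)
  · exact absurd k (R.src_minimal _ ((hf.src_iff y).2 e) _)
  · rw [f.injective e] at k
    exact absurd k (R.prec_irrefl _)

theorem down_singleton_ilo {U : Word α} {S T : Set (Fin U.length)}
    (h : ∀ x y, x ∈ T ∨ y ∈ S ∨ x = y) :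
    down {mk (U.ilo S T)} = {mk (U.ilo S T)} := by
  refine Set.Subset.antisymm ?_ fun R hR => ?_
  · rintro R ⟨_, _, rfl, hR⟩
    exact eq_of_subsu_ilo h hR
  · exact mem_down_of_mem hR (hR ▸ isInterval_ilo _ _ _)

/-- Reduces the regularity of [a] to that of the two single steps [a•] and [•a]. The side condition
of `down_singleton_ilo` holds as there is only one point. -/
theorem glueLang_letter (a : α) :
    glueLang {mk ((Word.single a).ilo ∅ Set.univ)} {mk ((Word.single a).ilo Set.univ ∅)} =
      {mk ((Word.single a).ilo ∅ ∅)} := by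
  have sub : ∀ x y : Fin (Word.single a).length, x = y :=
    fun x y => (inferInstance : Subsingleton (Fin 1)).elim x y
  have g : IsGluing ((Word.single a).ilo ∅ Set.univ) ((Word.single a).ilo Set.univ ∅)
      ((Word.single a).ilo ∅ ∅) id id :=
    { inj_left := Function.injective_id
      inj_right := Function.injective_id
      cover := fun r => .inl ⟨r, rfl⟩
      overlap := fun _ => ⟨trivial, trivial⟩
      of_tgt := fun p _ => ⟨p, rfl⟩
      of_src := fun p _ => ⟨p, rfl⟩
      label_left := fun _ => rfl
      label_right := fun _ => rfl
      src_iff := fun r => ⟨fun h => h.elim, fun ⟨_, h, _⟩ => h.elim⟩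
      tgt_iff := fun r => ⟨fun h => h.elim, fun ⟨_, h, _⟩ => h.elim⟩
      prec_left := Iff.rfl
      prec_right := Iff.rfl
      prec_cross := fun h => absurd trivial h
      evord_left := fun h _ _ => h
      evord_right := fun h _ _ => h }
  rw [glueLang, ← down_singleton_ilo (U := Word.single a) (S := ∅) (T := ∅)
    fun x y => .inr (.inr (sub x y))]
  congr 1
  ext R
  constructor
  · rintro ⟨_, rfl, _, rfl, h⟩
    obtain ⟨R, rfl⟩ := exists_rep R
    obtain ⟨i, j, h⟩ := isGlue_mk.1 h
    refine mk_eq.2 (h.iso g fun p q => iff_of_true (sub _ _) ?_)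
    obtain ⟨q', e⟩ := h.of_tgt p trivial
    rw [← e, sub q' q]
  · rintro rfl
    exact ⟨_, rfl, _, rfl, isGlue_mk.2 ⟨_, _, g⟩⟩

end Ipomset

/-! ### Graphs for the generators and for union, gluing and plus. -/

open Ipomset

/-- Silent links are up-steps along identities; this makes their ipomset neutral for gluing. -/
theorem starter_id (U : Word α) : starter (𝟙 U) = U.ilo Set.univ Set.univ := by
  simp only [starter, Word.id_unstarted, Set.compl_empty]

namespace STGraph

/-- The graph without states. -/
def empty (α : Type u) : STGraph.{u, 0} α where
  node _ := Empty
  finite := Finite.of_injective (β := Empty) (fun x => x.2) fun x => x.2.elim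
  up _ _ _ := False
  down _ _ _ := False
  start := ∅
  accept := ∅

theorem lang_empty : (empty α).lang = ∅ :=
  Set.eq_empty_of_forall_notMem fun _ ⟨x, _⟩ => x.2.elim

/-- The graph with a single state. -/
def point (U : Word α) : STGraph.{u, 0} α where
  node V := PLift (V = U)
  finite := Finite.of_injective (β := Unit) (fun _ => ()) fun ⟨_, ⟨h⟩⟩ ⟨_, ⟨h'⟩⟩ _ => by
    subst h h'
    rfl
  up _ _ _ := False
  down _ _ _ := False
  start := Set.univ
  accept := Set.univ

theorem lang_point (U : Word α) : (point U).lang = {mk (U.ilo Set.univ Set.univ)} := by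
  ext P
  constructor
  · rintro ⟨⟨_, ⟨rfl⟩⟩, _, ⟨_, _⟩, _, h⟩
    cases h with
    | nil => rfl
    | up d hd _ e _ => exact e.elim
    | down d hd _ e _ => exact e.elim
  · rintro rfl
    exact ⟨⟨U, ⟨rfl⟩⟩, trivial, ⟨U, ⟨rfl⟩⟩, trivial, .nil⟩

/-- The unique edge of the graph of a coface map. -/
inductive EdgeUp {U V : Word α} (d : U ⟶ V) : ∀ {W W' : Word α}, (W ⟶ W') →
    PLift (W = U) ⊕ PLift (W = V) → PLift (W' = U) ⊕ PLift (W' = V) → Prop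
  | edge : EdgeUp d d (.inl ⟨rfl⟩) (.inr ⟨rfl⟩)

/-- The unique edge of the reversed graph of a coface map. -/
inductive EdgeDown {U V : Word α} (d : U ⟶ V) : ∀ {W W' : Word α}, (W ⟶ W') →
    PLift (W' = U) ⊕ PLift (W' = V) → PLift (W = U) ⊕ PLift (W = V) → Prop
  | edge : EdgeDown d d (.inr ⟨rfl⟩) (.inl ⟨rfl⟩)

theorem finite_edge (U V : Word α) : Finite (Σ W, PLift (W = U) ⊕ PLift (W = V)) := by
  refine Finite.of_injective (β := Bool) (fun x => x.2.isLeft) ?_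
  rintro ⟨_, ⟨⟨rfl⟩⟩ | ⟨⟨rfl⟩⟩⟩ ⟨_, ⟨⟨rfl⟩⟩ | ⟨⟨rfl⟩⟩⟩ h
  · rfl
  · exact absurd h (by simp)
  · exact absurd h (by simp)
  · rfl

/-- The graph with a single up-step. -/
def edgeUp {U V : Word α} (d : U ⟶ V) : STGraph.{u, 0} α where
  node W := PLift (W = U) ⊕ PLift (W = V)
  finite := finite_edge U V
  up := EdgeUp d
  down _ _ _ := False
  start := {⟨U, .inl ⟨rfl⟩⟩}
  accept := {⟨V, .inr ⟨rfl⟩⟩}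

/-- The graph with a single down-step. -/
def edgeDown {U V : Word α} (d : U ⟶ V) : STGraph.{u, 0} α where
  node W := PLift (W = U) ⊕ PLift (W = V)
  finite := finite_edge U V
  up _ _ _ := False
  down := EdgeDown d
  start := {⟨V, .inr ⟨rfl⟩⟩}
  accept := {⟨U, .inl ⟨rfl⟩⟩}

theorem lang_edgeUp {U V : Word α} (d : U ⟶ V) (hd : Coface.terminated d = ∅) :
    (edgeUp d).lang = {mk (starter d)} := by
  ext P
  constructor
  · rintro ⟨_, rfl, _, rfl, h⟩
    -- Invariant: the empty path at the first state, the single step at the second.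
    have : ∀ {W : Word α} {y : (edgeUp d).node W} {P : Ipomset α},
        (edgeUp d).Reach (U := U) (.inl ⟨rfl⟩) y P →
        Sum.elim (fun _ => P = mk (U.ilo Set.univ Set.univ)) (fun _ => P = mk (starter d)) y := by
      intro W y P h
      induction h with
      | nil => exact rfl
      | up e he _ k g ih =>
        cases k
        obtain rfl := ih
        exact g.eq_right.symm
      | down e he _ k g ih => exact k.elim
    exact this h
  · rintro rfl
    exact ⟨_, rfl, _, rfl, .up d hd .nil .edge (hasWords_starter d hd).id_glue⟩

theorem lang_edgeDown {U V : Word α} (d : U ⟶ V) (hd : Coface.unstarted d = ∅) :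
    (edgeDown d).lang = {mk (terminator d)} := by
  ext P
  constructor
  · rintro ⟨_, rfl, _, rfl, h⟩
    have : ∀ {W : Word α} {y : (edgeDown d).node W} {P : Ipomset α},
        (edgeDown d).Reach (U := V) (.inr ⟨rfl⟩) y P →
        Sum.elim (fun _ => P = mk (terminator d)) (fun _ => P = mk (V.ilo Set.univ Set.univ)) y := by
      intro W y P h
      induction h with
      | nil => exact rfl
      | up e he _ k g ih => exact k.elim
      | down e he _ k g ih =>
        cases k
        obtain rfl := ih
        exact g.eq_right.symm
    exact this h
  · rintro rfl
    exact ⟨_, rfl, _, rfl, .down d hd .nil .edge (hasWords_terminator d hd).id_glue⟩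

/-- Up-steps of a sum of two graphs, with silent links from the first to the second. -/
inductive SumUp (A B : STGraph.{u, v} α) (l : ∀ {U : Word α}, A.node U → B.node U → Prop) :
    ∀ {U V : Word α}, (U ⟶ V) → A.node U ⊕ B.node U → A.node V ⊕ B.node V → Prop
  | left {U V : Word α} {d : U ⟶ V} {x y} : A.up d x y → SumUp A B l d (.inl x) (.inl y)
  | right {U V : Word α} {d : U ⟶ V} {x y} : B.up d x y → SumUp A B l d (.inr x) (.inr y)
  | link {U : Word α} {x y} : l x y → SumUp A B l (𝟙 U) (.inl x) (.inr y)

theorem finite_sum (A B : STGraph.{u, v} α) : Finite (Σ U, A.node U ⊕ B.node U) := by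
  have := A.finite
  have := B.finite
  refine Finite.of_injective (β := (Σ U, A.node U) ⊕ Σ U, B.node U)
    (fun x => x.2.elim (fun a => .inl ⟨x.1, a⟩) fun b => .inr ⟨x.1, b⟩) ?_
  rintro ⟨U, x | x⟩ ⟨V, y | y⟩ h
  · obtain ⟨⟩ := (Sum.inl_injective h : (⟨U, x⟩ : Σ U, A.node U) = ⟨V, y⟩)
    rfl
  · exact absurd h Sum.inl_ne_inr
  · exact absurd h Sum.inr_ne_inl
  · obtain ⟨⟩ := (Sum.inr_injective h : (⟨U, x⟩ : Σ U, B.node U) = ⟨V, y⟩)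
    rfl

/-- The sum of two graphs, with silent links from the first to the second. -/
def sum (A B : STGraph.{u, v} α) (l : ∀ {U : Word α}, A.node U → B.node U → Prop)
    (start accept : Set (Σ U, A.node U ⊕ B.node U)) : STGraph.{u, v} α where
  node U := A.node U ⊕ B.node U
  finite := finite_sum A B
  up := SumUp A B l
  down d := Sum.LiftRel (A.down d) (B.down d)
  start := start
  accept := accept

section Sum

variable {A B : STGraph.{u, v} α} {l : ∀ {U : Word α}, A.node U → B.node U → Prop}
  {start accept : Set (Σ U, A.node U ⊕ B.node U)} {U V : Word α} {P : Ipomset α}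

theorem Reach.sum_inl {x : A.node U} {y : A.node V} (h : A.Reach x y P) :
    (sum A B l start accept).Reach (U := U) (.inl x) (V := V) (.inl y) P := by
  induction h with
  | nil => exact .nil
  | up d hd _ e g ih => exact .up d hd ih (.left e) g
  | down d hd _ e g ih => exact .down d hd ih (.inl e) g

theorem Reach.sum_inr {x : B.node U} {y : B.node V} (h : B.Reach x y P) :
    (sum A B l start accept).Reach (U := U) (.inr x) (V := V) (.inr y) P := by
  induction h with
  | nil => exact .nil
  | up d hd _ e g ih => exact .up d hd ih (.right e) g
  | down d hd _ e g ih => exact .down d hd ih (.inr e) g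

theorem Reach.of_sum_inr {x : B.node U} {z : (sum A B l start accept).node V}
    (h : (sum A B l start accept).Reach (U := U) (.inr x) z P) :
    Sum.elim (fun _ => False) (fun y => B.Reach x y P) z := by
  induction h with
  | nil => exact .nil
  | up d hd _ e g ih =>
    cases e with
    | left e => exact ih
    | right e => exact .up d hd ih e g
    | link e => exact ih.elim
  | down d hd _ e g ih =>
    cases e with
    | inl e => exact ih
    | inr e => exact .down d hd ih e g

/-- There is no way back from the second graph, so a path uses at most one link, and that link
contributes nothing to the ipomset. -/
theorem Reach.of_sum_inl {x : A.node U} {z : (sum A B l start accept).node V}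
    (h : (sum A B l start accept).Reach (U := U) (.inl x) z P) :
    Sum.elim (fun y => A.Reach x y P) (fun y => ∃ (W : Word α) (x' : A.node W) (y' : B.node W)
      (Q R : Ipomset α), A.Reach x x' Q ∧ l x' y' ∧ B.Reach y' y R ∧ IsGlue Q R P) z := by
  induction h with
  | nil => exact .nil
  | up d hd _ e g ih =>
    cases e with
    | left e => exact .up d hd ih e g
    | right e =>
      obtain ⟨W, x', y', Q, R, h1, h2, h3, h4⟩ := ih
      obtain ⟨R', h5, h6⟩ := h4.assoc g
      exact ⟨W, x', y', Q, R', h1, h2, .up d hd h3 e h5, h6⟩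
    | link e =>
      rw [starter_id] at g
      obtain rfl := g.eq_left
      exact ⟨_, _, _, _, _, ih, e, .nil, g⟩
  | down d hd _ e g ih =>
    cases e with
    | inl e => exact .down d hd ih e g
    | inr e =>
      obtain ⟨W, x', y', Q, R, h1, h2, h3, h4⟩ := ih
      obtain ⟨R', h5, h6⟩ := h4.assoc g
      exact ⟨W, x', y', Q, R', h1, h2, .down d hd h3 e h5, h6⟩

end Sum

/-- The disjoint union of two graphs. -/
def union (A B : STGraph.{u, v} α) : STGraph.{u, v} α :=
  sum A B (fun _ _ => False)
    {x | x.2.elim (fun a => ⟨x.1, a⟩ ∈ A.start) fun b => ⟨x.1, b⟩ ∈ B.start}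
    {x | x.2.elim (fun a => ⟨x.1, a⟩ ∈ A.accept) fun b => ⟨x.1, b⟩ ∈ B.accept}

theorem lang_union (A B : STGraph.{u, v} α) : (A.union B).lang = A.lang ∪ B.lang := by
  ext P
  constructor
  · rintro ⟨⟨U, x | x⟩, hx, ⟨V, y | y⟩, hy, h⟩
    · exact .inl ⟨⟨U, x⟩, hx, ⟨V, y⟩, hy, Reach.of_sum_inl h⟩
    · obtain ⟨_, _, _, _, _, _, h, _⟩ := Reach.of_sum_inl h
      exact h.elim
    · exact (Reach.of_sum_inr h).elim
    · exact .inr ⟨⟨U, x⟩, hx, ⟨V, y⟩, hy, Reach.of_sum_inr h⟩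
  · rintro (⟨x, hx, y, hy, h⟩ | ⟨x, hx, y, hy, h⟩)
    · exact ⟨⟨_, .inl x.2⟩, hx, ⟨_, .inl y.2⟩, hy, h.sum_inl⟩
    · exact ⟨⟨_, .inr x.2⟩, hx, ⟨_, .inr y.2⟩, hy, h.sum_inr⟩

/-- The concatenation of two graphs. -/
def concat (A B : STGraph.{u, v} α) : STGraph.{u, v} α :=
  sum A B (fun {U} x y => ⟨U, x⟩ ∈ A.accept ∧ ⟨U, y⟩ ∈ B.start)
    {x | x.2.elim (fun a => ⟨x.1, a⟩ ∈ A.start) fun _ => False}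
    {x | x.2.elim (fun _ => False) fun b => ⟨x.1, b⟩ ∈ B.accept}

theorem lang_concat (A B : STGraph.{u, v} α) :
    (A.concat B).lang = {R | ∃ P ∈ A.lang, ∃ Q ∈ B.lang, IsGlue P Q R} := by
  ext R
  constructor
  · rintro ⟨⟨U, x | x⟩, hx, ⟨V, y | y⟩, hy, h⟩
    · exact hy.elim
    · obtain ⟨W, x', y', P, Q, h1, ⟨h2, h2'⟩, h3, h4⟩ := Reach.of_sum_inl h
      exact ⟨P, ⟨⟨U, x⟩, hx, ⟨W, x'⟩, h2, h1⟩, Q, ⟨⟨W, y'⟩, h2', ⟨V, y⟩, hy, h3⟩, h4⟩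
    · exact hx.elim
    · exact hx.elim
  · rintro ⟨P, ⟨⟨U, x⟩, hx, ⟨V, y⟩, hy, h⟩, Q, ⟨⟨V', y'⟩, hy', ⟨W, z⟩, hz, h'⟩, g⟩
    obtain ⟨rfl, -⟩ := g.hasWords h.hasWords h'.hasWords
    have hl : (A.concat B).Reach (U := U) (.inl x) (V := V') (.inr y') P :=
      .up (𝟙 V') rfl h.sum_inl (.link ⟨hy, hy'⟩) (starter_id V' ▸ h.hasWords.glue_id)
    exact ⟨⟨U, .inl x⟩, hx, ⟨W, .inr z⟩, hz, hl.trans h'.sum_inr g⟩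

/-- Up-steps of a graph with additional silent links from accepting to starting states. -/
inductive LoopUp (A : STGraph.{u, v} α) :
    ∀ {U V : Word α}, (U ⟶ V) → A.node U → A.node V → Prop
  | base {U V : Word α} {d : U ⟶ V} {x y} : A.up d x y → LoopUp A d x y
  | link {U : Word α} {x y} : ⟨U, x⟩ ∈ A.accept → ⟨U, y⟩ ∈ A.start → LoopUp A (𝟙 U) x y

/-- A graph with additional silent links from accepting to starting states. -/
def loop (A : STGraph.{u, v} α) : STGraph.{u, v} α :=
  { A with up := LoopUp A }

theorem Reach.loop {A : STGraph.{u, v} α} {U V : Word α} {x : A.node U} {y : A.node V}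
    {P : Ipomset α} (h : A.Reach x y P) : A.loop.Reach x y P := by
  induction h with
  | nil => exact .nil
  | up d hd _ e g ih => exact .up d hd ih (.base e) g
  | down d hd _ e g ih => exact .down d hd ih e g

theorem isInterval_of_mem_lang {A : STGraph.{u, v} α} {P : Ipomset α} (h : P ∈ A.lang) :
    P.IsInterval := by
  obtain ⟨_, _, _, _, h⟩ := h
  exact h.isInterval

/-- Cut at the last silent link: what precedes it lies in a power of `A.lang`, and what follows is a
path of A from a start state. -/
theorem Reach.of_loop {A : STGraph.{u, v} α} {U V : Word α} {x : A.node U}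
    (hx : ⟨U, x⟩ ∈ A.start) {y : A.loop.node V} {R : Ipomset α} (h : A.loop.Reach x y R) :
    A.Reach x (V := V) y R ∨ ∃ n, ∃ P ∈ powSucc A.lang n, ∃ b ∈ A.start, ∃ Q,
      A.Reach b.2 (V := V) y Q ∧ IsGlue P Q R := by
  induction h with
  | nil => exact .inl .nil
  | @up V W d hd y z _ _ _ e g ih =>
    change A.node V at y
    change A.node W at z
    change LoopUp A d y z at e
    cases e with
    | base e =>
      rcases ih with ih | ⟨n, P, hP, b, hb, Q, hQ, h⟩
      · exact .inl (.up d hd ih e g)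
      · obtain ⟨Q', h5, h6⟩ := h.assoc g
        exact .inr ⟨n, P, hP, b, hb, Q', .up d hd hQ e h5, h6⟩
    | link e e' =>
      rw [starter_id] at g
      obtain rfl := g.eq_left
      rcases ih with ih | ⟨n, P, hP, b, hb, Q, hQ, h⟩
      · exact .inr ⟨0, _, ⟨_, hx, _, e, ih⟩, _, e', _, .nil, g⟩
      · exact .inr ⟨n + 1, _, glue_mem_powSucc (fun _ => isInterval_of_mem_lang) hP
          ⟨b, hb, _, e, hQ⟩ h, _, e', _, .nil, g⟩
  | down d hd _ e g ih =>
    rcases ih with ih | ⟨n, P, hP, b, hb, Q, hQ, h⟩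
    · exact .inl (.down d hd ih e g)
    · obtain ⟨Q', h5, h6⟩ := h.assoc g
      exact .inr ⟨n, P, hP, b, hb, Q', .down d hd hQ e h5, h6⟩

theorem lang_loop_subset (A : STGraph.{u, v} α) : A.loop.lang ⊆ plusLang A.lang := by
  rintro R ⟨x, hx, y, hy, h⟩
  rcases Reach.of_loop (A := A) hx h with h | ⟨n, P, hP, b, hb, Q, hQ, h⟩
  · exact Set.mem_iUnion.2 ⟨0, x, hx, y, hy, h⟩
  · exact Set.mem_iUnion.2 ⟨n + 1, glue_mem_powSucc (fun _ => isInterval_of_mem_lang) hP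
      ⟨b, hb, y, hy, hQ⟩ h⟩

/-- Each power is closed downwards, so its elements are only subsumed by loop paths; monotonicity of
gluing carries the subsumption through the induction. -/
theorem plusLang_subset (A : STGraph.{u, v} α) : plusLang A.lang ⊆ Ipomset.down A.loop.lang := by
  refine Set.iUnion_subset fun n => ?_
  induction n with
  | zero =>
    intro R hR
    obtain ⟨x, hx, y, hy, h⟩ := hR
    exact mem_down_of_mem ⟨x, hx, y, hy, h.loop⟩ h.isInterval
  | succ n ih =>
    rintro R ⟨hR, R', ⟨P, hP, Q, hQ, g⟩, hs⟩
    obtain ⟨-, Q', ⟨⟨V', y'⟩, hy', ⟨W, z⟩, hz, h'⟩, hs'⟩ := ih hQ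
    obtain ⟨R'', g, hs''⟩ := g.mono (.refl P) hs'
    obtain ⟨⟨U, x⟩, hx, ⟨V, y⟩, hy, h⟩ := hP
    obtain ⟨rfl, -⟩ := g.hasWords h.hasWords h'.hasWords
    have hl : A.loop.Reach x y' P :=
      .up (𝟙 V') rfl h.loop (.link hy hy') (starter_id V' ▸ h.hasWords.glue_id)
    exact ⟨hR, R'', ⟨⟨U, x⟩, hx, ⟨W, z⟩, hz, hl.trans h' g⟩, hs.trans hs''⟩

end STGraph

theorem down_plusLang {L : Set (Ipomset α)} (hL : down L = L) :
    down (plusLang L) = plusLang L := by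
  have hn : ∀ n, down (powSucc L n) = powSucc L n := fun n => by
    cases n with
    | zero => exact hL
    | succ n => exact down_down _
  refine Set.Subset.antisymm ?_ ?_
  · rintro P ⟨h, Q, hQ, k⟩
    obtain ⟨n, hQ⟩ := Set.mem_iUnion.1 hQ
    exact Set.mem_iUnion.2 ⟨n, hn n ▸ ⟨h, Q, hQ, k⟩⟩
  · intro P h
    obtain ⟨n, h⟩ := Set.mem_iUnion.1 h
    rw [← hn n] at h
    obtain ⟨h, Q, hQ, k⟩ := h
    exact ⟨h, Q, Set.mem_iUnion.2 ⟨n, hQ⟩, k⟩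

theorem IsRegular.glue {L M : Set (Ipomset α)} (hL : IsRegular L) (hM : IsRegular M) :
    IsRegular (glueLang L M) := by
  obtain ⟨X, rfl⟩ := hL
  obtain ⟨Y, rfl⟩ := hM
  rw [← X.lang_toSTGraph, ← Y.lang_toSTGraph, glueLang, ← STGraph.lang_concat]
  exact STGraph.isRegular_down_lang _

/-- Graphs only produce down-closures, so closedness of L and M is needed to recover the union
itself. For this reason `IsRational.isRegular` proves regularity and closedness together. -/
theorem IsRegular.union {L M : Set (Ipomset α)} (hL : IsRegular L) (hM : IsRegular M)
    (hL' : down L = L) (hM' : down M = M) : IsRegular (L ∪ M) := by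
  obtain ⟨X, rfl⟩ := hL
  obtain ⟨Y, rfl⟩ := hM
  rw [← hL', ← hM', ← down_union, ← X.lang_toSTGraph, ← Y.lang_toSTGraph, ← STGraph.lang_union]
  exact STGraph.isRegular_down_lang _

theorem IsRegular.plus {L : Set (Ipomset α)} (hL : IsRegular L) (hL' : down L = L) :
    IsRegular (plusLang L) := by
  obtain ⟨X, rfl⟩ := hL
  have : plusLang X.lang = down X.toSTGraph.loop.lang := by
    refine Set.Subset.antisymm ?_ ?_
    · rw [← X.lang_toSTGraph]
      exact STGraph.plusLang_subset _
    · rw [← down_plusLang hL']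
      refine down_mono ?_
      rw [← X.lang_toSTGraph]
      exact STGraph.lang_loop_subset _
  rw [this]
  exact STGraph.isRegular_down_lang _

theorem isRegular_of_lang_eq {U : Word α} {S T : Set (Fin U.length)}
    (h : ∀ x y, x ∈ T ∨ y ∈ S ∨ x = y) {A : STGraph.{u, 0} α} (hA : A.lang = {mk (U.ilo S T)}) :
    IsRegular {mk (U.ilo S T)} := by
  rw [← down_singleton_ilo h, ← hA]
  exact STGraph.isRegular_down_lang _

/-- The coface map from the empty word that starts the letter `a`. -/
def Word.startLetter (a : α) : Word.nil α ⟶ Word.single a :=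
  ({ emb := ⟨⟨Fin.elim0, fun x => x.elim0⟩, fun {x} => x.elim0⟩
     unstarted := Set.univ
     terminated := ∅
     label_emb := fun x => x.elim0
     disjoint := by simp
     union_eq := by
      ext x
      simp only [Set.union_empty, Set.mem_univ, true_iff]
      rintro ⟨y, _⟩
      exact y.elim0 } : Coface _ _)

/-- The coface map from the empty word that terminates the letter `a`. -/
def Word.endLetter (a : α) : Word.nil α ⟶ Word.single a :=
  ({ emb := ⟨⟨Fin.elim0, fun x => x.elim0⟩, fun {x} => x.elim0⟩
     unstarted := ∅
     terminated := Set.univ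
     label_emb := fun x => x.elim0
     disjoint := by simp
     union_eq := by
      ext x
      simp only [Set.empty_union, Set.mem_univ, true_iff]
      rintro ⟨y, _⟩
      exact y.elim0 } : Coface _ _)

theorem isRegular_letter_tgt (a : α) : IsRegular {mk ((Word.single a).ilo ∅ Set.univ)} := by
  refine isRegular_of_lang_eq (fun x y => .inl trivial)
    (A := STGraph.edgeUp (Word.startLetter a)) ?_
  rw [STGraph.lang_edgeUp _ rfl, starter]
  simp [Word.startLetter]

theorem isRegular_letter_src (a : α) : IsRegular {mk ((Word.single a).ilo Set.univ ∅)} := by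
  refine isRegular_of_lang_eq (fun x y => .inr (.inl trivial))
    (A := STGraph.edgeDown (Word.endLetter a)) ?_
  rw [STGraph.lang_edgeDown _ rfl, terminator]
  simp [Word.endLetter]

/-- Rational languages are regular. -/
theorem IsRational.isRegular {L : Set (Ipomset α)} (h : IsRational L) :
    IsRegular L ∧ down L = L := by
  induction h with
  | empty =>
    have : down (∅ : Set (Ipomset α)) = ∅ :=
      Set.eq_empty_of_forall_notMem fun _ ⟨_, _, h, _⟩ => h
    refine ⟨?_, this⟩
    rw [← this, ← STGraph.lang_empty]
    exact STGraph.isRegular_down_lang _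
  | epsilon =>
    have h : ∀ x y : Fin (Word.nil α).length, x ∈ (∅ : Set (Fin (Word.nil α).length)) ∨
        y ∈ (∅ : Set (Fin (Word.nil α).length)) ∨ x = y := fun x => x.elim0
    refine ⟨isRegular_of_lang_eq h (A := .point (Word.nil α)) ?_, down_singleton_ilo h⟩
    rw [STGraph.lang_point]
    congr! 3 <;> exact Set.ext fun x => x.elim0
  | letter a =>
    rw [← glueLang_letter]
    exact ⟨(isRegular_letter_tgt a).glue (isRegular_letter_src a), down_down _⟩
  | letter_src a => exact ⟨isRegular_letter_src a, down_singleton_ilo fun x y => .inr (.inl trivial)⟩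
  | letter_tgt a => exact ⟨isRegular_letter_tgt a, down_singleton_ilo fun x y => .inl trivial⟩
  | letter_src_tgt a =>
    exact ⟨isRegular_of_lang_eq (fun x y => .inl trivial) (STGraph.lang_point _),
      down_singleton_ilo fun x y => .inl trivial⟩
  | union _ _ ihL ihM =>
    exact ⟨ihL.1.union ihM.1 ihL.2 ihM.2, by rw [down_union, ihL.2, ihM.2]⟩
  | glue _ _ ihL ihM => exact ⟨ihL.1.glue ihM.1, down_down _⟩
  | par _ _ ihL ihM => exact ⟨ihL.1.par ihM.1, down_down _⟩
  | plus _ ih => exact ⟨ih.1.plus ih.2, down_plusLang ih.2⟩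

end

section

open Word (Coface)

open Iposet Ipomset

/-! ### Regular languages are rational -/

namespace Iposet

theorem Iso.par {P P' Q Q' : Iposet α} (hP : Iso P P') (hQ : Iso Q Q') :
    Iso (P.par Q) (P'.par Q') := by
  obtain ⟨f, hf, hf'⟩ := hP
  obtain ⟨g, hg, hg'⟩ := hQ
  have hp : ∀ x y, (P.par Q).prec x y ↔ (P'.par Q').prec (f.sumCongr g x) (f.sumCongr g y) := by
    rintro (x | x) (y | y)
    · exact Sum.liftRel_inl_inl.trans ((hf' x y).trans Sum.liftRel_inl_inl.symm)
    · exact iff_of_false (fun h => nomatch h) (fun h => nomatch h)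
    · exact iff_of_false (fun h => nomatch h) (fun h => nomatch h)
    · exact Sum.liftRel_inr_inr.trans ((hg' x y).trans Sum.liftRel_inr_inr.symm)
  refine ⟨f.sumCongr g, ⟨?_, ?_, ?_, fun x y => (hp x y).2, ?_⟩, hp⟩
  · rintro (x | x)
    · exact hf.src_iff x
    · exact hg.src_iff x
  · rintro (x | x)
    · exact hf.tgt_iff x
    · exact hg.tgt_iff x
  · rintro (x | x)
    · exact hf.label_eq x
    · exact hg.label_eq x
  · rintro _ _ (h | h | _) h1 h2
    · exact .inl (hf.evord_of _ _ h (fun k => h1 (.inl k)) fun k => h2 (.inl k))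
    · exact .inr (hg.evord_of _ _ h (fun k => h1 (.inr k)) fun k => h2 (.inr k))
    · exact .sep _ _

theorem iso_par_cons {n : ℕ} (l : Fin (n + 1) → α) (S T : Set (Fin (n + 1))) :
    Iso (((Word.single (l 0)).ilo {_x | 0 ∈ S} {_x | 0 ∈ T}).par
        ((Word.mk n fun k => l k.succ).ilo (Fin.succ ⁻¹' S) (Fin.succ ⁻¹' T)))
      ((Word.mk (n + 1) l).ilo S T) := by
  let F : Fin 1 ⊕ Fin n → Fin (n + 1) := Sum.elim (fun _ => 0) Fin.succ
  have hF : Function.Bijective F := by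
    constructor
    · rintro (x | x) (y | y) h
      · rw [Subsingleton.elim x y]
      · exact absurd h (Fin.succ_ne_zero y).symm
      · exact absurd h (Fin.succ_ne_zero x)
      · rw [Fin.succ_injective n h]
    · intro k
      rcases Fin.eq_zero_or_eq_succ k with rfl | ⟨k, rfl⟩
      · exact ⟨.inl 0, rfl⟩
      · exact ⟨.inr k, rfl⟩
  refine ⟨Equiv.ofBijective F hF, ⟨?_, ?_, ?_, fun x y h => h.elim, ?_⟩, fun x y => ?_⟩
  · rintro (x | x) <;> exact Iff.rfl
  · rintro (x | x) <;> exact Iff.rfl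
  · rintro (x | x) <;> rfl
  · rintro _ _ (h | h | _) _ _
    · exact absurd (h.trans_eq ((inferInstance : Subsingleton (Fin 1)).elim _ _)) (lt_irrefl _)
    · exact Fin.succ_lt_succ_iff.2 h
    · exact Fin.succ_pos _
  · refine iff_of_false (fun h => ?_) id
    cases h <;> contradiction

end Iposet

theorem parLang_singleton (P Q : Iposet α) : parLang {mk P} {mk Q} = down {mk (P.par Q)} := by
  unfold parLang
  congr 1
  ext R
  constructor
  · rintro ⟨_, rfl, _, rfl, p, q, hp, hq, rfl⟩
    exact mk_eq.2 ((mk_eq.1 hp).par (mk_eq.1 hq))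
  · rintro rfl
    exact ⟨_, rfl, _, rfl, P, Q, rfl, rfl, rfl⟩

theorem isRational_single (a : α) (p q : Prop) :
    IsRational {mk ((Word.single a).ilo {_x | p} {_x | q})} := by
  by_cases hp : p <;> by_cases hq : q <;>
    simp only [hp, hq, Set.ofPred_true, Set.ofPred_false]
  · exact .letter_src_tgt a
  · exact .letter_src a
  · exact .letter_tgt a
  · exact .letter a

/-- Letters are split off by parallel composition. The condition forbids any added precedence, so
the down-closure of the product adds nothing; starters satisfy it through T and terminators through
S. -/
theorem isRational_ilo {U : Word α} {S T : Set (Fin U.length)} (h : ∀ x y, x ∈ T ∨ y ∈ S) :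
    IsRational {mk (U.ilo S T)} := by
  obtain ⟨n, l⟩ := U
  induction n with
  | zero =>
    obtain rfl : l = Fin.elim0 := funext fun x => x.elim0
    obtain rfl : S = ∅ := Set.ext fun x => x.elim0
    obtain rfl : T = ∅ := Set.ext fun x => x.elim0
    exact .epsilon
  | succ n ih =>
    have := (isRational_single (l 0) (0 ∈ S) (0 ∈ T)).par
      (ih (fun k => l k.succ) (S := Fin.succ ⁻¹' S) (T := Fin.succ ⁻¹' T) fun x y => h _ _)
    rwa [parLang_singleton, mk_eq.2 (iso_par_cons l S T),
      down_singleton_ilo fun x y => (h x y).imp_right .inl] at this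

theorem isRational_iUnion {ι : Type v} [Finite ι] {f : ι → Set (Ipomset α)}
    (hf : ∀ i, IsRational (f i)) : IsRational (⋃ i, f i) := by
  classical
  have := Fintype.ofFinite ι
  have : ∀ s : Finset ι, IsRational (⋃ i ∈ s, f i) := fun s => by
    induction s using Finset.induction_on with
    | empty => simpa using IsRational.empty
    | insert a s _ ih =>
      rw [Finset.set_biUnion_insert]
      exact (hf a).union ih
  simpa using this Finset.univ

/-! ### Kleene's state elimination. -/

/-- Gluings of labels along nonempty paths in a graph whose edges carry languages, with all
intermediate states in `K`. -/
inductive Via {N : Type v} (E : N → N → Set (Ipomset α)) (K : Set N) (p : N) :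
    N → Ipomset α → Prop
  | edge {q P} : P ∈ E p q → Via E K p q P
  | step {r q P Q R} : Via E K p r P → r ∈ K → Q ∈ E r q → IsGlue P Q R → Via E K p q R

namespace Via

variable {N : Type v} {E : N → N → Set (Ipomset α)} {K K' : Set N} {p q k : N} {P Q R : Ipomset α}

theorem mono (h : K ⊆ K') (hP : Via E K p q P) : Via E K' p q P := by
  induction hP with
  | edge e => exact .edge e
  | step _ hr e g ih => exact .step ih (h hr) e g

theorem trans (hP : Via E K p k P) (hk : k ∈ K) (hQ : Via E K k q Q) (g : IsGlue P Q R) :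
    Via E K p q R := by
  induction hQ generalizing R with
  | edge e => exact .step hP hk e g
  | step _ hr e g' ih =>
    obtain ⟨A, h1, h2⟩ := g'.assoc' g
    exact .step (ih h1) hr e h2

theorem isInterval (hE : ∀ p q, IsRational (E p q)) (h : Via E K p q P) : P.IsInterval := by
  have hI : ∀ p q, ∀ P ∈ E p q, P.IsInterval := fun p q P hP =>
    ((hE p q).isRegular.2.superset hP).1
  induction h with
  | edge e => exact hI _ _ _ e
  | step _ _ e g ih => exact g.isInterval ih (hI _ _ _ e)

theorem glueLang_subset (hk : k ∈ K) {L M : Set (Ipomset α)} (hL : L ⊆ down {P | Via E K p k P})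
    (hM : M ⊆ down {P | Via E K k q P}) : glueLang L M ⊆ down {P | Via E K p q P} := by
  rintro R ⟨hR, R', ⟨P, hP, Q, hQ, g⟩, hs⟩
  obtain ⟨-, P', hP', h1⟩ := hL hP
  obtain ⟨-, Q', hQ', h2⟩ := hM hQ
  obtain ⟨R'', g', h3⟩ := g.mono h1 h2
  exact ⟨hR, R'', hP'.trans hk hQ' g', hs.trans h3⟩

/-- The Kleene decomposition of paths at the visits of `k`. -/
theorem of_insert (hE : ∀ p q, IsRational (E p q)) (h : Via E (insert k K) p q R) :
    Via E K p q R ∨ ∃ P ∈ down {P | Via E K p k P} ∪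
      glueLang (down {P | Via E K p k P}) (plusLang (down {P | Via E K k k P})),
      ∃ Q, Via E K k q Q ∧ IsGlue P Q R := by
  -- `Q` is the part after the last visit of `k`; `P` leads to `k` and may be followed by loops at
  -- `k`.
  induction h with
  | edge e => exact .inl (.edge e)
  | step _ hr e g ih =>
    rcases ih with ih | ⟨P, hP, Q, hQ, g'⟩
    · rcases hr with rfl | hr
      · exact .inr ⟨_, .inl (mem_down_of_mem ih (ih.isInterval hE)), _, .edge e, g⟩
      · exact .inl (.step ih hr e g)
    · rcases hr with rfl | hr
      · refine .inr ⟨_, .inr ?_, _, .edge e, g⟩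
        have hQ' : Q ∈ down {P | Via E K _ _ P} := mem_down_of_mem hQ (hQ.isInterval hE)
        rcases hP with hP | ⟨hPi, P', ⟨A, hA, B, hB, gAB⟩, hs⟩
        · exact mem_down_of_mem ⟨P, hP, Q, Set.mem_iUnion.2 ⟨0, hQ'⟩, g'⟩
            (g'.isInterval hP.1 hQ'.1)
        · obtain ⟨n, hB⟩ := Set.mem_iUnion.1 hB
          obtain ⟨R', g'', hs'⟩ := g'.mono hs (.refl Q)
          obtain ⟨C, gC, gR⟩ := gAB.assoc g''
          -- One more loop at `k` is appended on the right of the power already collected.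
          exact ⟨g'.isInterval hPi hQ'.1, R', ⟨A, hA, C, Set.mem_iUnion.2 ⟨n + 1,
            glue_mem_powSucc (fun _ h => h.1) hB hQ' gC⟩, gR⟩, hs'⟩
      · obtain ⟨B, h1, h2⟩ := g'.assoc g
        exact .inr ⟨P, hP, B, .step hQ hr e h1, h2⟩

/-- Kleene's recursion. Only plus is available, not star, so arriving at `k` without looping is a
separate summand. -/
theorem down_insert (hE : ∀ p q, IsRational (E p q)) :
    down {P | Via E (insert k K) p q P} = down {P | Via E K p q P} ∪
      glueLang (down {P | Via E K p k P} ∪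
        glueLang (down {P | Via E K p k P}) (plusLang (down {P | Via E K k k P})))
        (down {P | Via E K k q P}) := by
  refine Set.Subset.antisymm ?_ (Set.union_subset ?_ ?_)
  · rintro R ⟨hR, R', hR', hs⟩
    rcases of_insert hE hR' with h | ⟨P, hP, Q, hQ, g⟩
    · exact .inl ⟨hR, R', h, hs⟩
    · exact .inr ⟨hR, R', ⟨P, hP, Q, mem_down_of_mem hQ (hQ.isInterval hE), g⟩, hs⟩
  · exact down_mono fun P hP => Via.mono (Set.subset_insert k K) hP
  · have hk : k ∈ insert k K := Set.mem_insert k K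
    have sub : ∀ p q, down {P | Via E K p q P} ⊆ down {P | Via E (insert k K) p q P} :=
      fun p q => down_mono fun P hP => Via.mono (Set.subset_insert k K) hP
    refine glueLang_subset hk (Set.union_subset (sub p k) (glueLang_subset hk (sub p k) ?_)) (sub k q)
    refine Set.iUnion_subset fun n => ?_
    induction n with
    | zero => exact sub k k
    | succ n ih => exact glueLang_subset hk (sub k k) ih

theorem isRational (hE : ∀ p q, IsRational (E p q)) (K : Finset N) (p q : N) :
    IsRational (down {P | Via E (K : Set N) p q P}) := by
  classical
  induction K using Finset.induction_on generalizing p q with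
  | empty =>
    have : {P | Via E ((∅ : Finset N) : Set N) p q P} = E p q := by
      ext P
      constructor
      · rintro (e | ⟨_, hr, _, _⟩)
        · exact e
        · simp at hr
      · exact .edge
    rw [this, (hE p q).isRegular.2]
    exact hE p q
  | insert k K _ ih =>
    rw [Finset.coe_insert, down_insert hE]
    exact (ih p q).union (((ih p k).union ((ih p k).glue (ih k k).plus)).glue (ih k q))

end Via

namespace STGraph

variable (A : STGraph.{u, v} α)

/-- The labels of the edges between two states. -/
inductive Edge : (Σ U, A.node U) → (Σ U, A.node U) → Ipomset α → Prop
  | up {U V : Word α} (d : U ⟶ V) (hd : Coface.terminated d = ∅) {x y} :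
      A.up d x y → Edge ⟨U, x⟩ ⟨V, y⟩ (mk (starter d))
  | down {U V : Word α} (d : U ⟶ V) (hd : Coface.unstarted d = ∅) {x y} :
      A.down d x y → Edge ⟨V, x⟩ ⟨U, y⟩ (mk (terminator d))

variable {A}

/-- There are finitely many coface maps between two words, so this is a finite union of starters and
terminators. -/
theorem isRational_edge (p q : Σ U, A.node U) : IsRational {P | A.Edge p q P} := by
  have fin : {P | A.Edge p q P}.Finite := by
    refine ((Set.finite_range fun d : p.1 ⟶ q.1 => mk (starter d)).union
      (Set.finite_range fun d : q.1 ⟶ p.1 => mk (terminator d))).subset ?_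
    rintro _ (⟨d, _, _⟩ | ⟨d, _, _⟩)
    · exact .inl ⟨d, rfl⟩
    · exact .inr ⟨d, rfl⟩
  have := fin.to_subtype
  have h : {P | A.Edge p q P} = ⋃ P : {P | A.Edge p q P}, {P.1} := by simp
  rw [h]
  refine isRational_iUnion ?_
  rintro ⟨_, ⟨d, _, _⟩ | ⟨d, _, _⟩⟩
  · exact isRational_ilo fun x y => .inl trivial
  · exact isRational_ilo fun x y => .inr trivial

/-- `Via` covers nonempty paths only; the empty path contributes an identity ipomset, which is
itself rational. -/
theorem reach_iff_via {U V : Word α} {x : A.node U} {y : A.node V} {P : Ipomset α} :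
    A.Reach x y P ↔ ((⟨U, x⟩ : Σ U, A.node U) = ⟨V, y⟩ ∧ P = mk (U.ilo Set.univ Set.univ)) ∨
      Via (fun p q => {P | A.Edge p q P}) Set.univ ⟨U, x⟩ ⟨V, y⟩ P := by
  constructor
  · intro h
    induction h with
    | nil => exact .inl ⟨rfl, rfl⟩
    | up d hd _ e g ih =>
      rcases ih with ⟨h, rfl⟩ | ih
      · cases h
        rw [← g.eq_right]
        exact .inr (.edge (.up d hd e))
      · exact .inr (.step ih trivial (.up d hd e) g)
    | down d hd _ e g ih =>
      rcases ih with ⟨h, rfl⟩ | ih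
      · cases h
        rw [← g.eq_right]
        exact .inr (.edge (.down d hd e))
      · exact .inr (.step ih trivial (.down d hd e) g)
  · rintro (⟨h, rfl⟩ | h)
    · cases h
      exact .nil
    · generalize hq : (⟨V, y⟩ : Σ U, A.node U) = q at h
      induction h generalizing V with
      | edge e =>
        subst hq
        rcases e with ⟨d, hd, e⟩ | ⟨d, hd, e⟩
        · exact .up d hd .nil e (hasWords_starter d hd).id_glue
        · exact .down d hd .nil e (hasWords_terminator d hd).id_glue
      | step _ _ e g ih =>
        subst hq
        rcases e with ⟨d, hd, e⟩ | ⟨d, hd, e⟩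
        · exact .up d hd (ih rfl) e g
        · exact .down d hd (ih rfl) e g

theorem isRational_down_reach (p q : Σ U, A.node U) :
    IsRational (Ipomset.down {P | A.Reach p.2 q.2 P}) := by
  classical
  have := A.finite
  have := Fintype.ofFinite (Σ U, A.node U)
  have hv := Via.isRational (isRational_edge (A := A)) Finset.univ p q
  rw [Finset.coe_univ] at hv
  by_cases hpq : p = q
  · have : {P | A.Reach p.2 q.2 P} = {mk (p.1.ilo Set.univ Set.univ)} ∪
        {P | Via (fun p q => {P | A.Edge p q P}) Set.univ p q P} := by
      ext P
      exact reach_iff_via.trans (or_congr_left (and_iff_right hpq))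
    rw [this, down_union, down_singleton_ilo (T := Set.univ) fun x y => .inl trivial]
    exact (isRational_ilo fun x y => .inl trivial).union hv
  · have : {P | A.Reach p.2 q.2 P} =
        {P | Via (fun p q => {P | A.Edge p q P}) Set.univ p q P} := by
      ext P
      exact reach_iff_via.trans (or_iff_right fun h => hpq h.1)
    rwa [this]

theorem isRational_down_lang (A : STGraph.{u, v} α) : IsRational (Ipomset.down A.lang) := by
  have := A.finite
  have h : Ipomset.down A.lang = ⋃ i : A.start × A.accept, Ipomset.down {P | A.Reach i.1.1.2 i.2.1.2 P} := by
    ext P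
    simp only [Set.mem_iUnion]
    constructor
    · rintro ⟨hP, Q, ⟨x, hx, y, hy, h⟩, hs⟩
      exact ⟨(⟨x, hx⟩, ⟨y, hy⟩), hP, Q, h, hs⟩
    · rintro ⟨⟨⟨x, hx⟩, ⟨y, hy⟩⟩, hP, Q, h, hs⟩
      exact ⟨hP, Q, ⟨x, hx, y, hy, h⟩, hs⟩
  rw [h]
  exact isRational_iUnion fun i => isRational_down_reach _ _

end STGraph

/-- Regular languages are rational. -/
theorem IsRegular.isRational {L : Set (Ipomset α)} (h : IsRegular L) (hL : down L ⊆ L) :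
    IsRational L := by
  obtain ⟨X, rfl⟩ := h
  rw [← X.lang_toSTGraph] at hL ⊢
  have := STGraph.isRational_down_lang X.toSTGraph
  -- Ipomsets of paths are interval, so the language is contained in its down-closure and the two
  -- coincide.
  rwa [hL.antisymm fun P hP => mem_down_of_mem hP (STGraph.isInterval_of_mem_lang hP)] at this

end

end HDAKleene

theorem theorem1 {α : Type*} (L : Set (HDAKleene.Ipomset α))
    (hL : HDAKleene.Ipomset.IsLanguage L) :
    HDAKleene.IsRegular L ↔ HDAKleene.IsRational L :=
  ⟨fun h => h.isRational fun P ⟨hP, Q, hQ, hs⟩ => hL.2 P Q hP hs hQ, fun h => h.isRegular.1⟩
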